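/- **Proposition 4.2.** A *point process* on $\mathbb R$ is a random locally finite subset of $\mathbb R$ (a probability measure on the space of locally finite subsets, with the $\sigma$-algebra generated by the numbers of points in Borel sets). A nonnegative measurable function $\rho_n$ on $\mathbb R^n$ is its *$n$-th correlation function* if, for every Borel set $E\subset\mathbb R^n$, the expected number of ordered $n$-tuples of pairwise distinct points of the random set that lie in $E$ equals $\int_E\rho_n(x_1,\dots,x_n)\,dx_1\cdots dx_n$. A kernel $K(x,y)$ on $\mathbb R\times\mathbb R$ *generates a fermion point process* if there is a point process on $\mathbb R$ whose correlation functions are $$\rho_n(x_1,\dots,x_n)=\det[K(x_a,x_b)]_{a,b=1}^n\qquad\text{for all } n .$$ Let $A,B$ be real parameters; each kernel below is given its limit value $K(x,x)=1$ on the diagonal. Then each of the following kernels generates a fermion point process under the stated conditions: 1. (sin/sh kernel) $\displaystyle K(x,y)=\frac{B\sin A(x-y)}{A\sinh B(x-y)}$ with $B>0$, $A\ne0$, if $\displaystyle \tanh\frac{\pi|A|}{2B}\le\frac{|A|}{\pi}$; 2. (sh/sh kernel) $\displaystyle K(x,y)=\frac{B\sinh A(x-y)}{A\sinh B(x-y)}$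 with $B>0$, $A\ne0$, if $\displaystyle 0\le\tan\frac{\pi|A|}{2B}\le\frac{|A|}{\pi}$ and $\displaystyle\frac{|A|}{B}<1$; 3. (limit case $B=0$) $\displaystyle K(x,y)=\frac{\sin A(x-y)}{A(x-y)}$, if $A\ge\pi$; 4. (limit case $A=0$) $\displaystyle K(x,y)=\frac{B(x-y)}{\sinh B(x-y)}$, if $B\ge\pi^2/2$. -/

import Mathlib

open MeasureTheory

open scoped ENNReal

/-- A configuration on the real line: a locally finite set of points. (A process with determinantal
correlation functions almost surely has no multiple points, so nothing is lost by using sets.) -/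
structure Configuration where
  /-- the points of the configuration -/
  points : Set ℝ
  /-- every bounded interval contains finitely many points -/
  locallyFinite : ∀ a b : ℝ, (points ∩ Set.Icc a b).Finite

namespace Configuration

/-- The number of points of the configuration `s` in the set `B`. -/
noncomputable def count (s : Configuration) (B : Set ℝ) : ℕ∞ := (s.points ∩ B).encard

/-- The standard `σ`-algebra on configurations: the smallest one that makes the number of points
in each Borel set measurable. -/
noncomputable instance : MeasurableSpace Configuration :=
  ⨆ (B : Set ℝ) (_ : MeasurableSet B), MeasurableSpace.comap (fun s => s.count B) inferInstance

/-- The ordered `n`-tuples of pairwise distinct points of the configuration. -/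
def tuples (s : Configuration) (n : ℕ) : Set (Fin n → ℝ) :=
  {x | Function.Injective x ∧ ∀ i, x i ∈ s.points}

end Configuration

/-- `ρ` is the `n`-th correlation function, relative to Lebesgue measure, of the point process on
`ℝ` with law `P`: it is a nonnegative density of the `n`-th factorial moment measure, which sends
a Borel set `B` of `ℝⁿ` to the expected number of ordered `n`-tuples of pairwise distinct points
of the random configuration that lie in `B`. -/
def IsCorrelationFunction (P : Measure Configuration) (n : ℕ) (ρ : (Fin n → ℝ) → ℝ) : Prop :=
  Measurable ρ ∧ (∀ x, 0 ≤ ρ x) ∧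
    ∀ B : Set (Fin n → ℝ), MeasurableSet B →
      ∫⁻ s, ((s.tuples n ∩ B).encard : ℝ≥0∞) ∂P = ∫⁻ x in B, ENNReal.ofReal (ρ x)

/-- `P` is (the law of) a fermion point process on `ℝ` with kernel `K`: a random configuration
all of whose correlation functions relative to Lebesgue measure are the determinants
`det [K (x a) (x b)]`. -/
structure IsFermionProcess (K : ℝ → ℝ → ℝ) (P : Measure Configuration) : Prop where
  isProbabilityMeasure : IsProbabilityMeasure P
  isCorrelationFunction : ∀ n : ℕ, IsCorrelationFunction P n
    (fun x => (Matrix.of fun a b : Fin n => K (x a) (x b)).det)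

/-- The kernel `K` generates a fermion point process on `ℝ`. -/
def GeneratesFermionProcess (K : ℝ → ℝ → ℝ) : Prop :=
  ∃ P : Measure Configuration, IsFermionProcess K P

/-- The sin/sh kernel, with its limit value `1` on the diagonal. -/
noncomputable def sinShKernel (A B : ℝ) (x y : ℝ) : ℝ :=
  if x = y then 1 else B * Real.sin (A * (x - y)) / (A * Real.sinh (B * (x - y)))

/-- The sh/sh kernel, with its limit value `1` on the diagonal. -/
noncomputable def shShKernel (A B : ℝ) (x y : ℝ) : ℝ :=
  if x = y then 1 else B * Real.sinh (A * (x - y)) / (A * Real.sinh (B * (x - y)))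

/-- The sine kernel (the limit `B → 0` of the sin/sh kernel), with its limit value `1` on the
diagonal. -/
noncomputable def sineKernel (A : ℝ) (x y : ℝ) : ℝ :=
  if x = y then 1 else Real.sin (A * (x - y)) / (A * (x - y))

/-- The limit `A → 0` of the sin/sh and sh/sh kernels, with its limit value `1` on the
diagonal. -/
noncomputable def linShKernel (B : ℝ) (x y : ℝ) : ℝ :=
  if x = y then 1 else B * (x - y) / Real.sinh (B * (x - y))

/-! Each kernel is a convolution kernel `K x y = k (x - y)` whose Fourier transform lies in `[0, 1]`
(in cases 3 and 4, a pointwise limit of such kernels). Its quadratic form therefore lies between `0`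
and the squared `L²` norm (`IsContractionKernel`), and every such kernel generates a fermion process
(`IsContractionKernel.generates`).

For the Fourier side, the sin/sh and sh/sh kernels are one function with a complex parameter `A`,
imaginary or real. The geometric series of `1 / sinh` and the partial fractions of the cotangent
evaluate `∫ sinh (z x) / sinh (B x)` (`integral_sinh_div_sinh`), so the transform is `p / (q + cosh
(π t / B))` with `p = π sin (π A / B) / A` and `q = cos (π A / B)` (`cosTransform_shQuotient`). Its
maximum, at `t = 0`, is `p / (1 + q)`. Requiring this to be at most `1` is exactly the `tanh` or
`tan` condition. The cases `B = 0` and `A = 0` follow because contraction kernels are closed under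
bounded pointwise limits (`IsContractionKernel.of_tendsto`).

For existence, the candidate law on a bounded window is given by its Janossy densities, the
alternating series in the determinants obtained by inclusion–exclusion (`janossy`). Two facts are
needed.

Positivity: averaging `K` over small cells turns the Janossy density into an alternating sum of
principal minors of a matrix `M` with `0 ≤ M ≤ 1`. This sum is a bordered determinant, nonnegative
by a Schur complement (`Matrix.sum_neg_one_pow_det_nonneg`). Since all determinants lie in `[0, 1]`,
dominated convergence passes to the continuous kernel (`IsContractionKernel.janossy_nonneg`).

Consistency: integrating out the points of an added region gives the Janossy density of the smaller
window (`IsCorrelation.integral_janossy_append`), because an alternating sum over pairs of tuples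
collapses as in `exp x * exp (-x) = 1`. Ratios of Janossy densities on consecutive windows are thus
conditional densities, and the Ionescu-Tulcea construction adds the points shell by shell
(`IsCorrelation.exists_isShellProcess`). Consistency starting from the empty window recovers the
correlation functions (`IsCorrelation.lintegral_encard_tuples`), and the windows then exhaust the
line. -/

open Matrix in
/-- The determinant of a positive semidefinite real matrix with diagonal entries at most `1` is at
most `1`. -/
theorem Matrix.PosSemidef.det_le_one_of_diag_le_one {ι : Type*} [Fintype ι] [DecidableEq ι]
    {M : Matrix ι ι ℝ} (hM : M.PosSemidef) (hd : ∀ i, M i i ≤ 1) : M.det ≤ 1 := by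
  rcases isEmpty_or_nonempty ι with h | h
  · simp
  have hev := hM.eigenvalues_nonneg
  have hdet : M.det = ∏ i, hM.1.eigenvalues i := by
    simpa using hM.1.det_eq_prod_eigenvalues
  have htr : M.trace = ∑ i, hM.1.eigenvalues i := by
    simpa using hM.1.trace_eq_sum_eigenvalues
  have hle : M.trace ≤ Fintype.card ι := by
    simp only [Matrix.trace, Matrix.diag]
    calc ∑ i, M i i ≤ ∑ _i : ι, (1 : ℝ) := Finset.sum_le_sum fun i _ => hd i
      _ = _ := by simp
  have hc : (0 : ℝ) < Fintype.card ι := by exact_mod_cast Fintype.card_pos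
  -- AM–GM for the eigenvalues with unit weights: `det ^ (1 / n) ≤ trace / n ≤ 1`.
  have := Real.geom_mean_le_arith_mean Finset.univ (fun _ : ι => (1 : ℝ)) hM.1.eigenvalues
    (fun _ _ => zero_le_one) (by simpa using hc) (fun i _ => hev i)
  simp only [Real.rpow_one, one_mul, Finset.sum_const, Finset.card_univ, nsmul_eq_mul,
    mul_one] at this
  rw [← hdet, ← htr] at this
  have h1 : M.det ^ ((Fintype.card ι : ℝ)⁻¹) ≤ 1 :=
    this.trans (by rw [div_le_one hc]; exact hle)
  by_contra! hcon
  exact absurd h1 (not_le.2 (Real.one_lt_rpow hcon (by positivity)))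

/-! ### Alternating sums of principal minors of a positive contraction. -/

section FredholmMinor

open Matrix Finset

variable {T α : Type*} [Fintype T] [DecidableEq T] [Fintype α] [DecidableEq α]

/-- Expansion of a bordered determinant along the principal minors of the lower right block. -/
theorem Matrix.det_fromBlocks_neg_one_sub (M : Matrix T T ℝ) (x : α → T) :
    (fromBlocks (M.submatrix x x) (M.submatrix x id) (-M.submatrix id x) (1 - M)).det =
      ∑ R : Finset T, (-1) ^ #R * (M.submatrix (Sum.elim x ((↑) : R → T))
        (Sum.elim x ((↑) : R → T))).det := by
  set N : Matrix (α ⊕ T) (α ⊕ T) ℝ :=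
    fromBlocks (M.submatrix x x) (M.submatrix x id) (-M.submatrix id x) (-M) with hN
  set E : Matrix (α ⊕ T) (α ⊕ T) ℝ := fromBlocks 0 0 0 1 with hE
  have hsum : fromBlocks (M.submatrix x x) (M.submatrix x id) (-M.submatrix id x) (1 - M)
      = (fun i => N i + E i) := by
    ext i j
    rcases i with i | i <;> rcases j with j | j <;> simp [hN, hE, sub_eq_neg_add]
  have key : (fromBlocks (M.submatrix x x) (M.submatrix x id) (-M.submatrix id x) (1 - M)).det
      = ∑ s : Finset (α ⊕ T), (of (s.piecewise N E) : Matrix _ _ ℝ).det := by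
    rw [hsum]
    exact (detRowAlternating : (α ⊕ T → ℝ) [⋀^α ⊕ T]→ₗ[ℝ] ℝ).map_add_univ N E
  rw [key]
  symm
  -- The rows of `E` at border indices vanish, so in the multilinear expansion only the index sets
  -- containing the whole border survive.
  refine Finset.sum_of_injOn (fun R => (univ : Finset α).disjSum R) ?_ (by simp) ?_ ?_
  · intro R _ R' _ h
    exact ((Finset.disjSum_inj).1 h).2
  · intro s _ hs
    have : ∃ a, Sum.inl a ∉ s := by
      by_contra! hcon
      refine hs ⟨s.toRight, by simp, ?_⟩
      ext (i | i)
      · simp [hcon i]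
      · simp
    obtain ⟨a, ha⟩ := this
    refine Matrix.det_eq_zero_of_row_eq_zero (Sum.inl a) fun j => ?_
    rcases j with j | j <;> simp [Finset.piecewise, ha, hE]
  · intro R _
    have h1 : (of (((univ : Finset α).disjSum R).piecewise N E) : Matrix _ _ ℝ)
        = of (((univ : Finset α).disjSum R).piecewise (row N) (row (1 : Matrix _ _ ℝ))) := by
      ext i j
      rcases i with i | i
      · simp [Finset.piecewise, row]
      · by_cases hi : i ∈ R
        · simp [Finset.piecewise, row, hi]
        · rcases j with j | j <;> simp [Finset.piecewise, row, hi, hE, Matrix.one_apply]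
    rw [h1, Matrix.det_piecewise_one_eq_submatrix_det]
    let e : α ⊕ R ≃ ((univ : Finset α).disjSum R) :=
      { toFun := Sum.elim (fun a => ⟨Sum.inl a, by simp⟩) (fun r => ⟨Sum.inr r.1, by simp⟩)
        invFun := fun i => match i with
          | ⟨Sum.inl a, _⟩ => Sum.inl a
          | ⟨Sum.inr r, h⟩ => Sum.inr ⟨r, by simpa using h⟩
        left_inv := by rintro (a | a) <;> rfl
        right_inv := by rintro ⟨a | a, h⟩ <;> rfl }
    rw [← Matrix.det_submatrix_equiv_self e]
    have h2 : ((N.submatrix ((↑) : ((univ : Finset α).disjSum R) → α ⊕ T) (↑)).submatrix e e)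
        = Matrix.diagonal (Sum.elim (fun _ : α => (1 : ℝ)) (fun _ : R => -1)) *
          (M.submatrix (Sum.elim x ((↑) : R → T)) (Sum.elim x ((↑) : R → T))) := by
      ext i j
      rw [Matrix.diagonal_mul]
      rcases i with i | i <;> rcases j with j | j <;> simp [hN, e]
    rw [h2, Matrix.det_mul, Matrix.det_diagonal]
    simp

/-- The sum is a bordered determinant. For `P = t M` with `t < 1` the block `1 - P` is positive
definite, and its Schur complement is a compression of `P + P (1 - P)⁻¹ P`, so both factors of the
determinant are nonnegative. Letting `t → 1` covers the case where `1 - M` is singular. -/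
theorem Matrix.sum_neg_one_pow_det_nonneg {M : Matrix T T ℝ} (hM : M.PosSemidef)
    (hM1 : (1 - M).PosSemidef) (x : α → T) :
    0 ≤ ∑ R : Finset T, (-1) ^ #R * (M.submatrix (Sum.elim x ((↑) : R → T))
        (Sum.elim x ((↑) : R → T))).det := by
  have hlt : ∀ t : ℝ, t ∈ Set.Ioo (0 : ℝ) 1 →
      0 ≤ ∑ R : Finset T, (-1) ^ #R * ((t • M).submatrix (Sum.elim x ((↑) : R → T))
        (Sum.elim x ((↑) : R → T))).det := by
    intro t ht
    set P := t • M with hP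
    have hPs : P.PosSemidef := hM.smul ht.1.le
    have hPd : (1 - P).PosDef := by
      have : 1 - P = (1 - t) • (1 : Matrix T T ℝ) + t • (1 - M) := by
        rw [hP]; ext i j; simp; ring
      rw [this]
      exact (Matrix.PosDef.one.smul (by linarith [ht.2])).add_posSemidef (hM1.smul ht.1.le)
    rw [← Matrix.det_fromBlocks_neg_one_sub]
    have : Invertible (1 - P) := hPd.isUnit.invertible
    rw [Matrix.det_fromBlocks₂₂]
    refine mul_nonneg hPd.det_pos.le (Matrix.PosSemidef.det_nonneg ?_)
    have hinv : ((1 - P)⁻¹).PosSemidef := hPd.inv.posSemidef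
    have h3 : P.submatrix x x - P.submatrix x id * ⅟(1 - P) * -P.submatrix id x
        = (P + Pᴴ * (1 - P)⁻¹ * P).submatrix x x := by
      rw [Matrix.invOf_eq_nonsing_inv, hPs.1.eq, Matrix.mul_neg, sub_neg_eq_add,
        Matrix.submatrix_add]
      rfl
    rw [h3]
    exact (hPs.add (hinv.conjTranspose_mul_mul_same P)).submatrix x
  have hcont : Continuous fun t : ℝ => ∑ R : Finset T, (-1) ^ #R *
      ((t • M).submatrix (Sum.elim x ((↑) : R → T)) (Sum.elim x ((↑) : R → T))).det := by
    refine continuous_finsetSum _ fun R _ => continuous_const.mul (Continuous.matrix_det ?_)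
    exact (continuous_id.smul continuous_const).matrix_submatrix _ _
  have h1 : (1 : ℝ) ∈ closure (Set.Ioo (0 : ℝ) 1) := by
    rw [closure_Ioo (by norm_num)]; simp
  have hsub := closure_minimal (fun t ht => Set.mem_ofPred_eq ▸ hlt t ht)
    (isClosed_le (continuous_const (y := (0 : ℝ))) hcont) h1
  rw [Set.mem_ofPred_eq, one_smul] at hsub
  exact hsub

/-- A sum over all tuples of a function that vanishes on non-injective tuples and depends on
injective ones only through their range. -/
theorem sum_fun_eq_factorial_mul_sum_powersetCard {k : ℕ} (h : (Fin k → T) → ℝ)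
    (g : Finset T → ℝ) (hinj : ∀ i, ¬ Function.Injective i → h i = 0)
    (hg : ∀ i, Function.Injective i → h i = g (univ.image i)) :
    ∑ i, h i = k.factorial * ∑ R ∈ powersetCard k (univ : Finset T), g R := by
  classical
  have h1 : ∑ i, h i = ∑ i with Function.Injective i, h i := by
    rw [Finset.sum_filter]
    refine Finset.sum_congr rfl fun i _ => ?_
    split_ifs with hi
    · rfl
    · exact hinj i hi
  rw [h1, ← Finset.sum_fiberwise_of_maps_to (s := univ.filter Function.Injective)
    (t := powersetCard k univ) (g := fun i : Fin k → T => univ.image i) (f := h), Finset.mul_sum]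
  · refine Finset.sum_congr rfl fun R hR => ?_
    rw [Finset.mem_powersetCard] at hR
    have h2 : ∀ i ∈ (univ.filter Function.Injective).filter
        (fun i : Fin k → T => univ.image i = R), h i = g R := by
      intro i hi
      simp only [Finset.mem_filter, Finset.mem_univ, true_and] at hi
      rw [hg i hi.1, hi.2]
    rw [Finset.sum_congr rfl h2, Finset.sum_const, nsmul_eq_mul]
    congr 2
    -- The injective tuples with range `R` are the bijections of `Fin k` onto `R`.
    have h3 : Fintype.card (Fin k ≃ R) = k.factorial := by
      have e : Fin k ≃ R := Fintype.equivOfCardEq (by simp [hR.2])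
      simpa using Fintype.card_equiv e
    rw [← h3, ← Fintype.card_coe]
    refine Fintype.card_congr
      { toFun := fun i => Equiv.ofBijective (fun a => ⟨i.1 a, ?_⟩) ⟨?_, ?_⟩
        invFun := fun e => ⟨fun a => (e a : T), ?_⟩
        left_inv := ?_
        right_inv := ?_ }
    · have := i.2
      simp only [Finset.mem_filter, Finset.mem_univ, true_and] at this
      exact (Finset.ext_iff.1 this.2 _).1 (Finset.mem_image_of_mem _ (Finset.mem_univ a))
    · have := i.2
      simp only [Finset.mem_filter, Finset.mem_univ, true_and] at this
      intro a b hab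
      exact this.1 (by simpa using hab)
    · have := i.2
      simp only [Finset.mem_filter, Finset.mem_univ, true_and] at this
      rintro ⟨r, hr⟩
      rw [← this.2] at hr
      obtain ⟨a, -, ha⟩ := Finset.mem_image.1 hr
      exact ⟨a, Subtype.ext ha⟩
    · simp only [Finset.mem_filter, Finset.mem_univ, true_and]
      refine ⟨Subtype.val_injective.comp e.injective, ?_⟩
      ext r
      simp only [Finset.mem_image, Finset.mem_univ, true_and]
      exact ⟨fun ⟨a, ha⟩ => ha ▸ (e a).2, fun hr => ⟨e.symm ⟨r, hr⟩, by simp⟩⟩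
    · intro i; rfl
    · intro e; ext a; rfl
  · intro i hi
    simp only [Finset.mem_filter, Finset.mem_univ, true_and] at hi
    simp [Finset.mem_powersetCard, Finset.card_image_of_injective _ hi]

/-- Positivity of the discrete Janossy densities of a positive contraction. -/
theorem Matrix.tsum_neg_one_pow_det_nonneg {M : Matrix T T ℝ} (hM : M.PosSemidef)
    (hM1 : (1 - M).PosSemidef) (x : α → T) :
    0 ≤ ∑' k : ℕ, (-1) ^ k / (k.factorial : ℝ) *
      ∑ i : Fin k → T, (M.submatrix (Sum.elim x i) (Sum.elim x i)).det := by
  have h0 := Matrix.sum_neg_one_pow_det_nonneg hM hM1 x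
  set g : Finset T → ℝ := fun R => (M.submatrix (Sum.elim x ((↑) : R → T))
        (Sum.elim x ((↑) : R → T))).det with hgdef
  have hk : ∀ k : ℕ, ∑ i : Fin k → T, (M.submatrix (Sum.elim x i) (Sum.elim x i)).det
      = k.factorial * ∑ R ∈ powersetCard k (univ : Finset T), g R := by
    intro k
    refine sum_fun_eq_factorial_mul_sum_powersetCard _ g ?_ ?_
    · intro i hi
      simp only [Function.Injective, not_forall] at hi
      obtain ⟨a, b, hab, hne⟩ := hi
      refine Matrix.det_zero_of_row_eq (i := Sum.inr a) (j := Sum.inr b) (by simpa using hne) ?_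
      ext j
      simp [hab]
    · intro i hi
      let e : Fin k ≃ (univ.image i : Finset T) :=
        Equiv.ofBijective (fun a => ⟨i a, Finset.mem_image_of_mem _ (Finset.mem_univ _)⟩)
          ⟨fun a b hab => hi (by simpa using hab), by
            rintro ⟨r, hr⟩
            obtain ⟨a, -, ha⟩ := Finset.mem_image.1 hr
            exact ⟨a, Subtype.ext ha⟩⟩
      simp only [hgdef]
      rw [← Matrix.det_submatrix_equiv_self (Equiv.sumCongr (Equiv.refl α) e)]
      congr 1
      ext a b
      rcases a with a | a <;> rcases b with b | b <;> rfl
  have hfin : ∀ k ∉ Finset.range (Fintype.card T + 1), (-1) ^ k / (k.factorial : ℝ) *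
      ∑ i : Fin k → T, (M.submatrix (Sum.elim x i) (Sum.elim x i)).det = 0 := by
    intro k hk'
    rw [hk, Finset.powersetCard_eq_empty.2]
    · simp
    · simpa using hk'
  rw [tsum_eq_sum hfin]
  refine h0.trans_eq ?_
  rw [← Finset.powerset_univ, Finset.sum_powerset]
  refine Finset.sum_congr rfl fun k _ => ?_
  rw [hk, ← mul_assoc, div_mul_cancel₀ _ (by positivity), Finset.mul_sum]
  refine Finset.sum_congr rfl fun R hR => ?_
  rw [(Finset.mem_powersetCard.1 hR).2]

end FredholmMinor

/-! ### Finite tuples up to permutation. -/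

/-- Finite tuples of real numbers. -/
abbrev Tup := Σ n : ℕ, (Fin n → ℝ)

namespace Tup

open scoped Nat

/-- The empty tuple. -/
def nil : Tup := ⟨0, Fin.elim0⟩

/-- Concatenation of tuples. -/
def append (s t : Tup) : Tup := ⟨s.1 + t.1, Fin.append s.2 t.2⟩

/-- Two tuples are permutations of each other. -/
def Perm (s t : Tup) : Prop := ∃ e : Fin s.1 ≃ Fin t.1, ∀ i, t.2 (e i) = s.2 i

/-- A function of tuples that is invariant under permutations. -/
def Symmetric {β : Type*} (F : Tup → β) : Prop := ∀ s t : Tup, s.Perm t → F s = F t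

theorem Perm.symm {s t : Tup} (h : s.Perm t) : t.Perm s := by
  obtain ⟨e, he⟩ := h
  exact ⟨e.symm, fun i => by rw [← he, Equiv.apply_symm_apply]⟩

theorem Perm.trans {s t u : Tup} (h : s.Perm t) (h' : t.Perm u) : s.Perm u := by
  obtain ⟨e, he⟩ := h
  obtain ⟨e', he'⟩ := h'
  exact ⟨e.trans e', fun i => by rw [← he, ← he']; rfl⟩

/-- The index equivalence of a concatenation. -/
def appendEquiv (s t : Tup) : Fin s.1 ⊕ Fin t.1 ≃ Fin (s.append t).1 := finSumFinEquiv

theorem append_appendEquiv (s t : Tup) (i : Fin s.1 ⊕ Fin t.1) :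
    (s.append t).2 (appendEquiv s t i) = Sum.elim s.2 t.2 i := by
  rcases i with j | j
  · exact Fin.append_left _ _ _
  · exact Fin.append_right _ _ _

/-- A convenient way of recognizing a permutation of a concatenation. -/
theorem perm_of_sum {s t u : Tup} (e : Fin s.1 ⊕ Fin t.1 ≃ Fin u.1)
    (he : ∀ i, u.2 (e i) = Sum.elim s.2 t.2 i) : (s.append t).Perm u := by
  refine ⟨(appendEquiv s t).symm.trans e, fun i => ?_⟩
  obtain ⟨j, rfl⟩ := (appendEquiv s t).surjective i
  rw [Equiv.trans_apply, Equiv.symm_apply_apply, he, append_appendEquiv]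

theorem append_perm_comm (s t : Tup) : (s.append t).Perm (t.append s) := by
  refine perm_of_sum ((Equiv.sumComm _ _).trans (appendEquiv t s)) fun i => ?_
  rw [Equiv.trans_apply, append_appendEquiv]
  rcases i with i | i <;> rfl

theorem Perm.append {s s' t t' : Tup} (h : s.Perm s') (h' : t.Perm t') :
    (s.append t).Perm (s'.append t') := by
  obtain ⟨e, he⟩ := h
  obtain ⟨e', he'⟩ := h'
  refine perm_of_sum ((Equiv.sumCongr e e').trans (appendEquiv s' t')) fun i => ?_
  rw [Equiv.trans_apply, append_appendEquiv]
  rcases i with i | i <;> simp [he, he']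

theorem Perm.refl (s : Tup) : s.Perm s := ⟨Equiv.refl _, fun _ => rfl⟩

theorem append_assoc_perm (s t u : Tup) :
    ((s.append t).append u).Perm (s.append (t.append u)) := by
  refine perm_of_sum (((Equiv.sumCongr (appendEquiv s t).symm (Equiv.refl _)).trans
    (Equiv.sumAssoc _ _ _)).trans ((Equiv.sumCongr (Equiv.refl _) (appendEquiv t u)).trans
    (appendEquiv s (t.append u)))) fun i => ?_
  simp only [Equiv.trans_apply]
  rw [append_appendEquiv]
  rcases i with i | i
  · obtain ⟨j, rfl⟩ := (appendEquiv s t).surjective i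
    rw [Sum.elim_inl, append_appendEquiv]
    rcases j with j | j
    · simp
    · simp [append_appendEquiv]
  · simp [append_appendEquiv]

theorem append_nil_perm (s : Tup) : (s.append nil).Perm s :=
  perm_of_sum (t := nil) (u := s) (Equiv.sumEmpty (Fin s.1) (Fin 0)) fun i => by
    rcases i with i | i
    · rfl
    · exact i.elim0

/-- `s ++ y ++ (w ++ w')` is a permutation of `s ++ w ++ (y ++ w')`. -/
theorem append_append_perm (s y w w' : Tup) :
    ((s.append y).append (w.append w')).Perm ((s.append w).append (y.append w')) := by
  have h1 := append_assoc_perm s y (w.append w')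
  have h2 : (y.append (w.append w')).Perm (w.append (y.append w')) :=
    ((append_assoc_perm y w w').symm.trans ((append_perm_comm y w).append (Perm.refl w'))).trans
      (append_assoc_perm w y w')
  exact (h1.trans ((Perm.refl s).append h2)).trans (append_assoc_perm s w _).symm

/-- The inclusion of the tuples of length `n`. -/
def mk (n : ℕ) (x : Fin n → ℝ) : Tup := ⟨n, x⟩

theorem mk_injective (n : ℕ) : Function.Injective (mk n) :=
  fun _ _ h => eq_of_heq (Sigma.mk.inj h).2

theorem measurable_mk (n : ℕ) : Measurable (mk n) := by
  intro S hS
  exact MeasurableSpace.measurableSet_iInf.1 hS n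

theorem measurable_of_mk {β : Type*} [MeasurableSpace β] {F : Tup → β}
    (h : ∀ n, Measurable fun x : Fin n → ℝ => F ⟨n, x⟩) : Measurable F := by
  intro S hS
  exact MeasurableSpace.measurableSet_iInf.2 fun n => h n hS

theorem measurableEmbedding_mk (n : ℕ) :
    MeasurableEmbedding (mk n) where
  injective := mk_injective n
  measurable := measurable_mk n
  measurableSet_image' := by
    intro S hS
    refine MeasurableSpace.measurableSet_iInf.2 fun m => ?_
    change MeasurableSet (mk m ⁻¹' (mk n '' S))
    by_cases h : n = m
    · subst h
      rwa [Set.preimage_image_eq _ (mk_injective n)]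
    · convert MeasurableSet.empty
      ext x
      simp only [mk, Set.mem_preimage, Set.mem_image, Sigma.mk.injEq, Set.mem_empty_iff_false,
        iff_false, not_exists, not_and]
      exact fun y _ h' => absurd h' h

theorem measurable_of_mk_prod {β : Type*} [MeasurableSpace β] {F : Tup × Tup → β}
    (h : ∀ p q, Measurable fun x : (Fin p → ℝ) × (Fin q → ℝ) => F (⟨p, x.1⟩, ⟨q, x.2⟩)) :
    Measurable F := by
  intro S hS
  have : F ⁻¹' S = ⋃ p : ℕ, ⋃ q : ℕ, Prod.map (mk p) (mk q) ''
      ((fun x : (Fin p → ℝ) × (Fin q → ℝ) => F (⟨p, x.1⟩, ⟨q, x.2⟩)) ⁻¹' S) := by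
    ext ⟨⟨p, x⟩, ⟨q, y⟩⟩
    simp only [Set.mem_preimage, Set.mem_iUnion, Set.mem_image, Prod.exists]
    constructor
    · intro hF
      exact ⟨p, q, x, y, hF, rfl⟩
    · rintro ⟨p', q', x', y', hF, heq⟩
      rw [← heq]; exact hF
  rw [this]
  exact MeasurableSet.iUnion fun p => MeasurableSet.iUnion fun q =>
    ((measurableEmbedding_mk p).prodMap (measurableEmbedding_mk q)).measurableSet_image.2
      (h p q hS)

theorem measurable_append : Measurable fun z : Tup × Tup => z.1.append z.2 := by
  refine measurable_of_mk_prod fun p q => (measurable_mk (p + q)).comp ?_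
  refine measurable_pi_iff.2 fun i => ?_
  refine Fin.addCases (fun i => ?_) (fun i => ?_) i
  · simp only [Fin.append_left]; fun_prop
  · simp only [Fin.append_right]; fun_prop

/-! ### The Lebesgue–Poisson measure and its exponential law. -/

/-- The Lebesgue–Poisson measure on tuples: the sum of `μⁿ / n!`. -/
noncomputable def lp (μ : Measure ℝ) : Measure Tup :=
  Measure.sum fun n : ℕ => (n ! : ℝ≥0∞)⁻¹ • (Measure.pi fun _ : Fin n => μ).map (mk n)

theorem lintegral_lp (μ : Measure ℝ) {F : Tup → ℝ≥0∞} (hF : Measurable F) :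
    ∫⁻ s, F s ∂lp μ = ∑' n : ℕ, (n ! : ℝ≥0∞)⁻¹ * ∫⁻ x, F ⟨n, x⟩ ∂(Measure.pi fun _ : Fin n => μ) := by
  rw [lp, lintegral_sum_measure]
  refine tsum_congr fun n => ?_
  rw [lintegral_smul_measure, lintegral_map hF (measurable_mk n), smul_eq_mul]
  rfl

/-- The mass is the exponential series of `μ univ`. Finiteness makes every bounded measurable
function of tuples integrable, so the alternating series below converge absolutely. -/
instance (μ : Measure ℝ) [IsFiniteMeasure μ] : IsFiniteMeasure (lp μ) := by
  constructor
  rw [← lintegral_one, lintegral_lp μ measurable_const]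
  have h : ∀ n : ℕ, (n ! : ℝ≥0∞)⁻¹ * ∫⁻ _ : Fin n → ℝ, 1 ∂(Measure.pi fun _ : Fin n => μ)
      = ENNReal.ofReal ((μ Set.univ).toReal ^ n / n !) := by
    intro n
    rw [lintegral_one, Measure.pi_univ, Finset.prod_const, Finset.card_univ, Fintype.card_fin,
      ENNReal.ofReal_div_of_pos (by positivity), ENNReal.ofReal_pow ENNReal.toReal_nonneg,
      ENNReal.ofReal_toReal (measure_ne_top _ _), ENNReal.ofReal_natCast, mul_comm]
    rfl
  simp_rw [h]
  rw [← ENNReal.ofReal_tsum_of_nonneg (fun n => by positivity)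
    (Real.summable_pow_div_factorial _)]
  exact ENNReal.ofReal_lt_top

theorem lp_prod (μ ν : Measure ℝ) [IsFiniteMeasure μ] [IsFiniteMeasure ν] :
    (lp μ).prod (lp ν) = Measure.sum fun p : ℕ × ℕ => ((p.1 ! : ℝ≥0∞)⁻¹ * (p.2 ! : ℝ≥0∞)⁻¹) •
      (((Measure.pi fun _ : Fin p.1 => μ).prod (Measure.pi fun _ : Fin p.2 => ν)).map
        (Prod.map (mk p.1) (mk p.2))) := by
  rw [lp, lp, Measure.prod_sum]
  congr 1
  funext p
  rw [Measure.prod_smul_left, Measure.prod_smul_right, smul_smul,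
    Measure.map_prod_map _ _ (measurable_mk _) (measurable_mk _)]

theorem lintegral_lp_prod (μ ν : Measure ℝ) [IsFiniteMeasure μ] [IsFiniteMeasure ν]
    {F : Tup × Tup → ℝ≥0∞} (hF : Measurable F) :
    ∫⁻ z, F z ∂(lp μ).prod (lp ν) = ∑' p : ℕ × ℕ, ((p.1 ! : ℝ≥0∞)⁻¹ * (p.2 ! : ℝ≥0∞)⁻¹) *
      ∫⁻ x, F (⟨p.1, x.1⟩, ⟨p.2, x.2⟩)
        ∂((Measure.pi fun _ : Fin p.1 => μ).prod (Measure.pi fun _ : Fin p.2 => ν)) := by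
  rw [lp_prod, lintegral_sum_measure]
  refine tsum_congr fun n => ?_
  rw [lintegral_smul_measure, lintegral_map hF ((measurable_mk _).prodMap (measurable_mk _)),
    smul_eq_mul]
  rfl

end Tup

/-- Gluing two families of coordinates along an equivalence preserves product measures. -/
theorem measurePreserving_glue {ι κ σ : Type*} [Fintype ι] [Fintype κ] [Fintype σ]
    (e : ι ⊕ κ ≃ σ) (m : σ → Measure ℝ) [∀ i, SigmaFinite (m i)] :
    MeasurePreserving (fun z : (ι → ℝ) × (κ → ℝ) => fun i => Sum.elim z.1 z.2 (e.symm i))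
      ((Measure.pi fun i => m (e (.inl i))).prod (Measure.pi fun i => m (e (.inr i))))
      (Measure.pi m) := by
  have h1 := measurePreserving_sumPiEquivProdPi_symm (X := fun _ : ι ⊕ κ => ℝ) (fun i => m (e i))
  have h2 := measurePreserving_piCongrLeft (α := fun _ : σ => ℝ) m e
  have h3 := h2.comp h1
  convert! h3 using 1
  funext z i
  obtain ⟨j, rfl⟩ := e.surjective i
  have := MeasurableEquiv.piCongrLeft_apply_apply e (β := fun _ => ℝ)
    ((MeasurableEquiv.sumPiEquivProdPi fun _ : ι ⊕ κ => ℝ).symm z) j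
  rw [Function.comp_apply, this, Equiv.symm_apply_apply]
  rcases j with j | j <;> rfl

theorem Measure.pi_add_eq_sum {n : ℕ} (μ ν : Measure ℝ) [IsFiniteMeasure μ] [IsFiniteMeasure ν] :
    (Measure.pi fun _ : Fin n => μ + ν) =
      ∑ s : Finset (Fin n), Measure.pi fun i => if i ∈ s then μ else ν := by
  have : ∀ (s : Finset (Fin n)) i, IsFiniteMeasure (if i ∈ s then μ else ν) := fun s i => by
    split_ifs <;> infer_instance
  refine Measure.pi_eq fun B hB => ?_
  rw [Measure.finsetSum_apply]
  simp_rw [Measure.pi_pi, Measure.add_apply]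
  rw [Finset.prod_add, ← Finset.powerset_univ]
  refine Finset.sum_congr rfl fun s _ => ?_
  rw [← Finset.prod_mul_prod_compl s fun i => (if i ∈ s then μ else ν) (B i), Finset.compl_eq_univ_sdiff]
  congr 1
  · exact Finset.prod_congr rfl fun i hi => by rw [if_pos hi]
  · exact Finset.prod_congr rfl fun i hi => by rw [if_neg (Finset.mem_sdiff.1 hi).2]

theorem ENNReal.inv_factorial_mul_choose (p q : ℕ) :
    ((p + q).factorial : ℝ≥0∞)⁻¹ * ((p + q).choose p : ℝ≥0∞) =
      (p.factorial : ℝ≥0∞)⁻¹ * (q.factorial : ℝ≥0∞)⁻¹ := by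
  have h := Nat.add_choose_mul_factorial_mul_factorial p q
  have hp : (p.factorial : ℝ≥0∞) ≠ 0 := by exact_mod_cast p.factorial_ne_zero
  have hq : (q.factorial : ℝ≥0∞) ≠ 0 := by exact_mod_cast q.factorial_ne_zero
  have hc : ((p + q).choose p : ℝ≥0∞) ≠ 0 := by
    exact_mod_cast (Nat.choose_pos (Nat.le_add_right p q)).ne'
  rw [show (p + q).choose q = (p + q).choose p from Nat.choose_symm_add.symm] at h
  rw [← h]
  push_cast
  rw [ENNReal.mul_inv (Or.inr (by simp)) (Or.inr hq),
    ENNReal.mul_inv (Or.inr (by simp)) (Or.inr hp)]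
  rw [mul_comm, ← mul_assoc, ← mul_assoc, ENNReal.mul_inv_cancel hc (by simp), one_mul]

namespace Tup

open scoped Nat

/-- The sum of the lengths in a fixed splitting of coordinates. -/
theorem lintegral_pi_eq_lintegral_append {F : Tup → ℝ≥0∞} (hF : Measurable F) (hs : Symmetric F)
    {μ ν : Measure ℝ} [IsFiniteMeasure μ] [IsFiniteMeasure ν] {n p q : ℕ}
    (e : Fin p ⊕ Fin q ≃ Fin n) (m : Fin n → Measure ℝ) [∀ i, SigmaFinite (m i)]
    (hμ : ∀ i, m (e (.inl i)) = μ) (hν : ∀ i, m (e (.inr i)) = ν) :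
    ∫⁻ x, F (mk n x) ∂Measure.pi m = ∫⁻ z, F ((mk p z.1).append (mk q z.2))
      ∂((Measure.pi fun _ : Fin p => μ).prod (Measure.pi fun _ : Fin q => ν)) := by
  have h := measurePreserving_glue e m
  simp_rw [hμ, hν] at h
  rw [← h.lintegral_comp (show Measurable fun x => F (mk n x) from hF.comp (measurable_mk n))]
  refine lintegral_congr fun z => (hs _ _ ?_).symm
  exact perm_of_sum (s := mk p z.1) (t := mk q z.2) (u := mk n _) e fun i => by
    exact congrArg (Sum.elim z.1 z.2) (e.symm_apply_apply i)

/-- The law `exp (μ + ν) = exp μ * exp ν`. Expanding `(μ + ν)ⁿ` over subsets of the coordinates,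
symmetry makes all subsets of size `p` contribute equally, and `(n choose p) / n! = 1 / (p! q!)`. -/
theorem lintegral_append_lp {F : Tup → ℝ≥0∞} (hF : Measurable F) (hs : Symmetric F)
    (μ ν : Measure ℝ) [IsFiniteMeasure μ] [IsFiniteMeasure ν] :
    ∫⁻ z, F (z.1.append z.2) ∂(lp μ).prod (lp ν) = ∫⁻ s, F s ∂lp (μ + ν) := by
  rw [lintegral_lp_prod _ _ (show Measurable fun z : Tup × Tup => F (z.1.append z.2) from hF.comp measurable_append), lintegral_lp _ hF]
  set a : ℕ → ℕ → ℝ≥0∞ := fun p q => ∫⁻ z, F ((mk p z.1).append (mk q z.2))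
      ∂((Measure.pi fun _ : Fin p => μ).prod (Measure.pi fun _ : Fin q => ν)) with ha
  have h1 : ∀ n, ∫⁻ x, F (mk n x) ∂(Measure.pi fun _ : Fin n => μ + ν)
      = ∑ p ∈ Finset.HasAntidiagonal.antidiagonal n, (n.choose p.1) * a p.1 p.2 := by
    intro n
    rw [Measure.pi_add_eq_sum, lintegral_finsetSum_measure]
    have h2 : ∀ s : Finset (Fin n),
        ∫⁻ x, F (mk n x) ∂(Measure.pi fun i => if i ∈ s then μ else ν)
          = a s.card (n - s.card) := by
      intro s
      have : ∀ i, IsFiniteMeasure (if i ∈ s then μ else ν) := fun i => by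
        split_ifs <;> infer_instance
      let e1 : Fin s.card ≃ {i // i ∈ s} := Fintype.equivOfCardEq (by simp)
      let e2 : Fin (n - s.card) ≃ {i // ¬ i ∈ s} :=
        Fintype.equivOfCardEq (by rw [Fintype.card_subtype_compl]; simp)
      refine lintegral_pi_eq_lintegral_append hF hs
        ((Equiv.sumCongr e1 e2).trans (Equiv.sumCompl (· ∈ s))) _ (fun i => ?_) (fun i => ?_)
      · exact if_pos (e1 i).2
      · exact if_neg (e2 i).2
    simp_rw [h2]
    rw [← Finset.powerset_univ, Finset.sum_powerset_apply_card fun k => a k (n - k),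
      Finset.Nat.sum_antidiagonal_eq_sum_range_succ_mk]
    simp
  change _ = ∑' n : ℕ, (n ! : ℝ≥0∞)⁻¹ * ∫⁻ x, F (mk n x) ∂(Measure.pi fun _ : Fin n => μ + ν)
  simp_rw [h1]
  rw [← (Finset.HasAntidiagonal.sigmaAntidiagonalEquivProd (A := ℕ)).tsum_eq, ENNReal.tsum_sigma']
  refine tsum_congr fun n => ?_
  rw [tsum_fintype, Finset.mul_sum, ← Finset.sum_coe_sort (Finset.HasAntidiagonal.antidiagonal n)]
  refine Finset.sum_congr rfl fun p _ => ?_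
  obtain ⟨⟨p, q⟩, hpq⟩ := p
  obtain rfl := Finset.HasAntidiagonal.mem_antidiagonal.1 hpq
  simp only [Finset.HasAntidiagonal.sigmaAntidiagonalEquivProd_apply]
  rw [← mul_assoc, ENNReal.inv_factorial_mul_choose]
  rfl

theorem integrable_of_bound {α : Type*} [MeasurableSpace α] {m : Measure α} [IsFiniteMeasure m]
    {f : α → ℝ} (hf : Measurable f) {C : ℝ} (hC : ∀ x, |f x| ≤ C) : Integrable f m :=
  Integrable.of_bound hf.aestronglyMeasurable C (.of_forall hC)

theorem integral_append_lp {F : Tup → ℝ} (hF : Measurable F) (hs : Symmetric F)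
    {C : ℝ} (hC : ∀ s, |F s| ≤ C) (μ ν : Measure ℝ) [IsFiniteMeasure μ] [IsFiniteMeasure ν] :
    ∫ z, F (z.1.append z.2) ∂(lp μ).prod (lp ν) = ∫ s, F s ∂lp (μ + ν) := by
  rw [integral_eq_lintegral_pos_part_sub_lintegral_neg_part
      (integrable_of_bound (show Measurable fun z : Tup × Tup => F (z.1.append z.2) from hF.comp measurable_append) fun _ => hC _),
    integral_eq_lintegral_pos_part_sub_lintegral_neg_part (integrable_of_bound hF hC)]
  congr 2
  · exact lintegral_append_lp (F := fun s => ENNReal.ofReal (F s)) hF.ennreal_ofReal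
      (fun s t h => by simp only [hs s t h]) μ ν
  · exact lintegral_append_lp (F := fun s => ENNReal.ofReal (-F s)) hF.neg.ennreal_ofReal
      (fun s t h => by simp only [hs s t h]) μ ν

theorem measurable_length : Measurable fun s : Tup => s.1 :=
  measurable_of_mk fun _ => measurable_const

theorem sum_antidiagonal_neg_one_pow (n : ℕ) :
    ∑ p ∈ Finset.HasAntidiagonal.antidiagonal n, ((p.1 ! : ℝ)⁻¹ * (p.2 ! : ℝ)⁻¹) * (-1) ^ p.2 =
      if n = 0 then 1 else 0 := by
  have h := (Commute.all (1 : ℝ) (-1)).add_pow' n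
  rw [add_neg_cancel, zero_pow_eq] at h
  have h2 : ∑ p ∈ Finset.HasAntidiagonal.antidiagonal n, ((p.1 ! : ℝ)⁻¹ * (p.2 ! : ℝ)⁻¹) * (-1) ^ p.2 =
      (n ! : ℝ)⁻¹ * ∑ p ∈ Finset.HasAntidiagonal.antidiagonal n, n.choose p.1 • ((1 : ℝ) ^ p.1 * (-1) ^ p.2) := by
    rw [Finset.mul_sum]
    refine Finset.sum_congr rfl fun p hp => ?_
    obtain ⟨p, q⟩ := p
    obtain rfl := Finset.HasAntidiagonal.mem_antidiagonal.1 hp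
    have h3 := Nat.add_choose_mul_factorial_mul_factorial p q
    rw [show (p + q).choose q = (p + q).choose p from Nat.choose_symm_add.symm] at h3
    have h4 : (((p + q).choose p : ℕ) : ℝ) * p ! * q ! = (p + q)! := by exact_mod_cast h3
    have hp : (p ! : ℝ) ≠ 0 := by positivity
    have hq : (q ! : ℝ) ≠ 0 := by positivity
    have hpq : ((p + q)! : ℝ) ≠ 0 := by positivity
    simp only [one_pow, one_mul, nsmul_eq_mul]
    field_simp
    linear_combination (-h4)
  rw [h2, ← h]
  split_ifs with h0
  · simp [h0]
  · simp

/-- The law `exp μ * exp (-μ) = 1`. Concatenated tuples of total length `n` all give the same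
integral, with total weight `(1 - 1)ⁿ / n!`, so only the empty tuple remains. Symmetry of `G` plays
no role because both factors carry the same measure. -/
theorem integral_neg_one_pow_append_lp {G : Tup → ℝ} (hG : Measurable G)
    {C : ℝ} (hC : ∀ s, |G s| ≤ C) (μ : Measure ℝ) [IsFiniteMeasure μ] :
    ∫ z, (-1) ^ z.2.1 * G (z.1.append z.2) ∂(lp μ).prod (lp μ) = G nil := by
  set g : ℕ → ℝ := fun n => ∫ x, G (mk n x) ∂(Measure.pi fun _ : Fin n => μ) with hg
  have hmeas : Measurable fun z : Tup × Tup => (-1 : ℝ) ^ z.2.1 * G (z.1.append z.2) :=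
    ((measurable_of_countable fun n : ℕ => (-1 : ℝ) ^ n).comp
      (measurable_length.comp measurable_snd)).mul (hG.comp measurable_append)
  have hint : Integrable (fun z : Tup × Tup => (-1 : ℝ) ^ z.2.1 * G (z.1.append z.2))
      ((lp μ).prod (lp μ)) := integrable_of_bound hmeas (C := C) fun z => by
    rw [abs_mul, abs_pow, abs_neg, abs_one, one_pow, one_mul]; exact hC _
  have hterm : ∀ p : ℕ × ℕ, ∫ z, (-1 : ℝ) ^ z.2.1 * G (z.1.append z.2)
      ∂(((p.1 ! : ℝ≥0∞)⁻¹ * (p.2 ! : ℝ≥0∞)⁻¹) •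
      (((Measure.pi fun _ : Fin p.1 => μ).prod (Measure.pi fun _ : Fin p.2 => μ)).map
        (Prod.map (mk p.1) (mk p.2)))) =
      ((p.1 ! : ℝ)⁻¹ * (p.2 ! : ℝ)⁻¹) * (-1) ^ p.2 * g (p.1 + p.2) := by
    intro p
    rw [integral_smul_measure, integral_map
      ((measurable_mk _).prodMap (measurable_mk _)).aemeasurable hmeas.aestronglyMeasurable]
    have h1 : ∀ z : (Fin p.1 → ℝ) × (Fin p.2 → ℝ),
        (-1 : ℝ) ^ (Prod.map (mk p.1) (mk p.2) z).2.1 *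
          G ((Prod.map (mk p.1) (mk p.2) z).1.append (Prod.map (mk p.1) (mk p.2) z).2) =
        (-1 : ℝ) ^ p.2 * G (mk (p.1 + p.2) fun i => Sum.elim z.1 z.2 (finSumFinEquiv.symm i)) := by
      intro z
      have : (Prod.map (mk p.1) (mk p.2) z).1.append (Prod.map (mk p.1) (mk p.2) z).2 =
          mk (p.1 + p.2) fun i => Sum.elim z.1 z.2 (finSumFinEquiv.symm i) := by
        simp only [Prod.map, mk, append]
        congr 1
        funext i
        obtain ⟨j, rfl⟩ := finSumFinEquiv.surjective i
        rw [Equiv.symm_apply_apply]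
        rcases j with j | j
        · exact Fin.append_left _ _ _
        · exact Fin.append_right _ _ _
      rw [this]; rfl
    simp_rw [h1]
    rw [integral_const_mul]
    have h2 := measurePreserving_glue (finSumFinEquiv : Fin p.1 ⊕ Fin p.2 ≃ _) (fun _ => μ)
    rw [← integral_map (f := fun x => G (mk (p.1 + p.2) x)) h2.measurable.aemeasurable
      (hG.comp (measurable_mk _)).aestronglyMeasurable, h2.map_eq]
    simp [hg, mul_assoc]
  rw [lp_prod] at hint ⊢
  have hsum := hasSum_integral_measure hint
  simp_rw [hterm] at hsum
  rw [← (Finset.HasAntidiagonal.sigmaAntidiagonalEquivProd (A := ℕ)).hasSum_iff] at hsum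
  have hsum2 := hsum.sigma fun n => hasSum_fintype _
  have hsum3 : HasSum (fun n : ℕ => if n = 0 then g 0 else 0)
      (∫ z, (-1) ^ z.2.1 * G (z.1.append z.2) ∂(Measure.sum fun p : ℕ × ℕ =>
        ((p.1 ! : ℝ≥0∞)⁻¹ * (p.2 ! : ℝ≥0∞)⁻¹) •
      (((Measure.pi fun _ : Fin p.1 => μ).prod (Measure.pi fun _ : Fin p.2 => μ)).map
        (Prod.map (mk p.1) (mk p.2))))) := by
    refine Eq.mp (congrArg (fun f => HasSum f _) (funext fun n => ?_)) hsum2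
    have h5 : ∀ p : Finset.HasAntidiagonal.antidiagonal n,
        ((fun p : ℕ × ℕ => ((p.1 ! : ℝ)⁻¹ * (p.2 ! : ℝ)⁻¹) * (-1) ^ p.2 * g (p.1 + p.2)) ∘
          Finset.HasAntidiagonal.sigmaAntidiagonalEquivProd) ⟨n, p⟩ =
          (fun p : ℕ × ℕ => ((p.1 ! : ℝ)⁻¹ * (p.2 ! : ℝ)⁻¹) * (-1) ^ p.2 * g n) p := by
      rintro ⟨⟨p, q⟩, hpq⟩
      obtain rfl := Finset.HasAntidiagonal.mem_antidiagonal.1 hpq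
      rfl
    simp_rw [h5]
    rw [Finset.sum_coe_sort (Finset.HasAntidiagonal.antidiagonal n)
      fun p : ℕ × ℕ => ((p.1 ! : ℝ)⁻¹ * (p.2 ! : ℝ)⁻¹) * (-1) ^ p.2 * g n,
      ← Finset.sum_mul, sum_antidiagonal_neg_one_pow]
    split_ifs with h0
    · rw [h0, one_mul]
    · rw [zero_mul]
  rw [hsum3.unique (hasSum_ite_eq 0 (g 0))]
  simp only [hg]
  rw [Measure.pi_of_empty, integral_dirac]
  exact congrArg (fun x => G (mk 0 x)) (Subsingleton.elim _ _)

end Tup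

/-! ### Janossy densities and their consistency. -/

namespace Tup

/-- A measurable symmetric function of tuples bounded by `1`. -/
structure IsCorrelation (D : Tup → ℝ) : Prop where
  measurable : Measurable D
  symmetric : Symmetric D
  abs_le : ∀ s, |D s| ≤ 1

/-- The Janossy densities associated to the correlation functions `D` and the window with
reference measure `μ`. -/
noncomputable def janossy (D : Tup → ℝ) (μ : Measure ℝ) (s : Tup) : ℝ :=
  ∫ z, (-1) ^ z.1 * D (s.append z) ∂lp μ

theorem measurable_neg_one_pow : Measurable fun s : Tup => (-1 : ℝ) ^ s.1 :=
  (measurable_of_countable fun n : ℕ => (-1 : ℝ) ^ n).comp measurable_length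

theorem measurable_append_comp {α : Type*} [MeasurableSpace α] {f g : α → Tup} (hf : Measurable f)
    (hg : Measurable g) : Measurable fun x => (f x).append (g x) :=
  measurable_append.comp (hf.prodMk hg)

theorem abs_neg_one_pow_mul (n : ℕ) (a : ℝ) : |(-1) ^ n * a| = |a| := by
  rw [abs_mul, abs_pow, abs_neg, abs_one, one_pow, one_mul]

namespace IsCorrelation

variable {D : Tup → ℝ} (hD : IsCorrelation D) {μ ν : Measure ℝ} [IsFiniteMeasure μ]
  [IsFiniteMeasure ν]
include hD

theorem measurable_janossy : Measurable (janossy D μ) := by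
  have : Measurable fun p : Tup × Tup => (-1) ^ p.2.1 * D (p.1.append p.2) :=
    (measurable_neg_one_pow.comp measurable_snd).mul (hD.measurable.comp measurable_append)
  exact (this.stronglyMeasurable.integral_prod_right' (ν := lp μ)).measurable

omit [IsFiniteMeasure μ] in
theorem symmetric_janossy : Symmetric (janossy D μ) := by
  intro s t h
  refine integral_congr_ae (.of_forall fun z => ?_)
  simp only [hD.symmetric _ _ (h.append (Perm.refl z))]

theorem integrable_janossy (s : Tup) : Integrable (fun z => (-1) ^ z.1 * D (s.append z)) (lp μ) :=
  integrable_of_bound (measurable_neg_one_pow.mul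
    (hD.measurable.comp (measurable_append_comp measurable_const measurable_id))) (C := 1)
    fun z => by rw [abs_neg_one_pow_mul]; exact hD.abs_le _

theorem abs_janossy_le (s : Tup) : |janossy D μ s| ≤ (lp μ).real Set.univ := by
  have h : ∀ᵐ z ∂lp μ, ‖(-1) ^ z.1 * D (s.append z)‖ ≤ 1 := .of_forall fun z => by
    rw [Real.norm_eq_abs, abs_neg_one_pow_mul]; exact hD.abs_le _
  exact (norm_integral_le_of_norm_le_const h).trans_eq (one_mul _)

/-- A tuple `z` for `μ + ν` splits into `w` for `μ` and `w'` for `ν`. The integrated tuple `y` and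
`w'` then range over the same measure `ν`, with a sign on `w'` only, and cancel unless both are
empty. What is left is the series over `w`. -/
theorem integral_janossy_append (s : Tup) :
    ∫ y, janossy D (μ + ν) (s.append y) ∂lp ν = janossy D μ s := by
  set H : (Tup × Tup) × Tup → ℝ := fun p =>
    (-1) ^ p.1.2.1 * ((-1) ^ p.2.1 * D ((s.append p.1.2).append (p.1.1.append p.2))) with hH
  have hHm : Measurable H := by
    refine (measurable_neg_one_pow.comp (measurable_snd.comp measurable_fst)).mul
      ((measurable_neg_one_pow.comp measurable_snd).mul (hD.measurable.comp ?_))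
    exact measurable_append_comp
      (measurable_append_comp measurable_const (measurable_snd.comp measurable_fst))
      (measurable_append_comp (measurable_fst.comp measurable_fst) measurable_snd)
  have hHb : ∀ p, |H p| ≤ 1 := fun p => by
    simp only [hH]; rw [abs_neg_one_pow_mul, abs_neg_one_pow_mul]; exact hD.abs_le _
  have hHi : Integrable H (((lp ν).prod (lp μ)).prod (lp ν)) := integrable_of_bound hHm hHb
  have h1 : ∀ y, janossy D (μ + ν) (s.append y) = ∫ w, ∫ w', H ((y, w), w') ∂lp ν ∂lp μ := by
    intro y
    have h2 := integral_append_lp (F := fun z => (-1) ^ z.1 * D ((s.append y).append z))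
      (measurable_neg_one_pow.mul
        (hD.measurable.comp (measurable_append_comp measurable_const measurable_id)))
      (fun a b h => by
        simp only [hD.symmetric _ _ ((Perm.refl (s.append y)).append h)]
        obtain ⟨e, -⟩ := h
        rw [show a.1 = b.1 by simpa using Fintype.card_congr e])
      (C := 1) (fun z => by rw [abs_neg_one_pow_mul]; exact hD.abs_le _) μ ν
    rw [janossy, ← h2, integral_prod]
    · refine integral_congr_ae (.of_forall fun w => integral_congr_ae (.of_forall fun w' => ?_))
      simp only [hH]
      rw [hD.symmetric _ _ (append_append_perm s y w w'), ← mul_assoc, ← pow_add]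
      rfl
    · refine integrable_of_bound (C := 1) ?_ fun z => by
        rw [abs_neg_one_pow_mul]; exact hD.abs_le _
      exact (measurable_neg_one_pow.comp measurable_append).mul
        (hD.measurable.comp (measurable_append_comp measurable_const measurable_append))
  simp_rw [h1]
  -- With `w` outermost, the integrals over `y` and `w'` become adjacent and the cancellation
  -- applies for each fixed `w`.
  rw [integral_integral_swap (f := fun y w => ∫ w', H ((y, w), w') ∂lp ν) hHi.integral_prod_left]
  refine integral_congr_ae (.of_forall fun w => ?_)
  simp only [hH]
  simp_rw [integral_const_mul]
  congr 1
  have h3 := integral_neg_one_pow_append_lp (G := fun z => D ((s.append w).append z))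
    (hD.measurable.comp (measurable_append_comp measurable_const measurable_id))
    (fun z => hD.abs_le _) ν
  rw [integral_prod] at h3
  · rw [h3]
    exact hD.symmetric _ _ (append_nil_perm _)
  · refine integrable_of_bound (C := 1) ?_ fun z => by
      rw [abs_neg_one_pow_mul]; exact hD.abs_le _
    exact (measurable_neg_one_pow.comp measurable_snd).mul
        (hD.measurable.comp (measurable_append_comp measurable_const measurable_append))

omit hD in
theorem lp_zero : lp (0 : Measure ℝ) = Measure.dirac nil := by
  refine Measure.ext_of_lintegral _ fun F hF => ?_
  rw [lintegral_lp _ hF, lintegral_dirac' _ hF, tsum_eq_single 0]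
  · rw [Measure.pi_of_empty, lintegral_dirac' _ (show Measurable fun x => F ⟨0, x⟩ from hF.comp (measurable_mk 0))]
    simp only [Nat.factorial_zero, Nat.cast_one, inv_one]
    rw [one_mul]
    exact congrArg (fun x => F (Tup.mk 0 x)) (Subsingleton.elim _ _)
  · intro n hn
    have : Measure.pi (fun _ : Fin n => (0 : Measure ℝ)) = 0 := by
      rw [← Measure.measure_univ_eq_zero, Measure.pi_univ]
      simp [hn]
    rw [this]; simp

/-- The Lebesgue–Poisson measure of `0` is the unit mass at the empty tuple. Hence consistency with
`μ = 0` recovers the correlation functions from the Janossy densities. -/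
theorem janossy_zero (s : Tup) : janossy D 0 s = D s := by
  have h : Measurable fun z => (-1 : ℝ) ^ z.1 * D (s.append z) := measurable_neg_one_pow.mul
    (hD.measurable.comp (measurable_append_comp measurable_const measurable_id))
  rw [janossy, lp_zero, integral_dirac' _ _ h.stronglyMeasurable]
  simp only [nil, pow_zero, one_mul]
  exact hD.symmetric _ _ (append_nil_perm s)

end IsCorrelation

end Tup

/-! ### Construction of the process shell by shell. -/

namespace Tup

open ProbabilityTheory Finset

/-- The window `[-m, m)`. -/
def window (m : ℕ) : Set ℝ := Set.Ico (-(m : ℝ)) m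

/-- The part of the window `[-(m+1), m+1)` outside `[-m, m)`. -/
def shell (m : ℕ) : Set ℝ := window (m + 1) \ window m

/-- Lebesgue measure on a window. -/
noncomputable def windowMeasure (m : ℕ) : Measure ℝ := volume.restrict (window m)

/-- Lebesgue measure on a shell. -/
noncomputable def shellMeasure (m : ℕ) : Measure ℝ := volume.restrict (shell m)

theorem measurableSet_window (m : ℕ) : MeasurableSet (window m) := measurableSet_Ico

theorem measurableSet_shell (m : ℕ) : MeasurableSet (shell m) :=
  (measurableSet_window _).diff (measurableSet_window _)

theorem window_mono : Monotone window := fun m n h =>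
  Set.Ico_subset_Ico (neg_le_neg (by exact_mod_cast h)) (by exact_mod_cast h)

instance (m : ℕ) : IsFiniteMeasure (windowMeasure m) := by
  unfold windowMeasure window; infer_instance

instance (m : ℕ) : IsFiniteMeasure (shellMeasure m) := by
  refine ⟨?_⟩
  rw [shellMeasure, Measure.restrict_apply_univ]
  refine (measure_mono Set.sdiff_subset).trans_lt ?_
  rw [window, Real.volume_Ico]; exact ENNReal.ofReal_lt_top

/-- The empty window is the start of the construction: its only configuration is the empty tuple. -/
theorem windowMeasure_zero : windowMeasure 0 = 0 := by
  simp [windowMeasure, window]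

theorem windowMeasure_succ (m : ℕ) : windowMeasure (m + 1) = windowMeasure m + shellMeasure m := by
  rw [windowMeasure, windowMeasure, shellMeasure, shell,
    ← Measure.restrict_union Set.disjoint_sdiff_right
      ((measurableSet_window _).diff (measurableSet_window _)),
    Set.union_sdiff_cancel (window_mono (Nat.le_succ m))]

/-- The conditional density of the points in the shell given the points in the window. -/
noncomputable def stepDensity (D : Tup → ℝ) (m : ℕ) (s y : Tup) : ℝ≥0∞ :=
  -- Where the denominator vanishes, the default is the density of the unit mass at the empty tuple.
  -- It keeps the total mass equal to `1`, so the kernel is Markov at every `s`.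
  if janossy D (windowMeasure m) s = 0 then (if y.1 = 0 then 1 else 0)
  else ENNReal.ofReal (janossy D (windowMeasure (m + 1)) (s.append y) /
    janossy D (windowMeasure m) s)

theorem lintegral_append_eq_one_of_nil (μ : Measure ℝ) :
    ∫⁻ y, (if y.1 = 0 then 1 else 0 : ℝ≥0∞) ∂lp μ = 1 := by
  have hm : Measurable fun y : Tup => (if y.1 = 0 then 1 else 0 : ℝ≥0∞) :=
    (measurable_of_countable fun n : ℕ => (if n = 0 then 1 else 0 : ℝ≥0∞)).comp measurable_length
  rw [lintegral_lp _ hm, tsum_eq_single 0]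
  · simp
  · intro n hn
    simp [hn]

theorem measurableSet_of_mk {S : Set Tup} (h : ∀ n, MeasurableSet (mk n ⁻¹' S)) :
    MeasurableSet S :=
  MeasurableSpace.measurableSet_iInf.2 h

theorem measurableSet_forall_mem {C : Set ℝ} (hC : MeasurableSet C) :
    MeasurableSet {y : Tup | ∀ i, y.2 i ∈ C} := by
  refine measurableSet_of_mk fun n => ?_
  change MeasurableSet {x : Fin n → ℝ | ∀ i : Fin n, x i ∈ C}
  rw [Set.ofPred_forall]
  exact MeasurableSet.iInter fun i => measurable_pi_apply i hC

theorem ae_lp_mem {C : Set ℝ} (hC : MeasurableSet C) :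
    ∀ᵐ y ∂lp (volume.restrict C), ∀ i, y.2 i ∈ C := by
  rw [lp, Measure.ae_sum_iff]
  intro n
  refine Measure.ae_smul_measure ?_ _
  refine (measurableEmbedding_mk n).ae_map_iff.2 ?_
  change ∀ᵐ x ∂Measure.pi fun _ : Fin n => volume.restrict C, ∀ i : Fin n, x i ∈ C
  rw [ae_all_iff]
  intro i
  have h := (Measure.quasiMeasurePreserving_eval (fun _ : Fin n => volume.restrict C) i).ae
    (ae_restrict_mem hC)
  exact h

namespace IsCorrelation

variable {D : Tup → ℝ} (hD : IsCorrelation D)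
include hD

theorem measurable_stepDensity (m : ℕ) :
    Measurable (Function.uncurry (stepDensity D m)) := by
  unfold stepDensity Function.uncurry
  refine Measurable.ite ?_ ?_ ?_
  · exact (hD.measurable_janossy.comp measurable_fst) (measurableSet_singleton 0)
  · exact (measurable_of_countable fun n : ℕ => (if n = 0 then 1 else 0 : ℝ≥0∞)).comp
      (measurable_length.comp measurable_snd)
  · exact ((hD.measurable_janossy.comp measurable_append).div
      (hD.measurable_janossy.comp measurable_fst)).ennreal_ofReal

theorem integrable_janossy_append {μ ν : Measure ℝ} [IsFiniteMeasure μ] [IsFiniteMeasure ν]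
    (s : Tup) : Integrable (fun y => janossy D μ (s.append y)) (lp ν) :=
  integrable_of_bound (hD.measurable_janossy.comp
    (measurable_append_comp measurable_const measurable_id)) fun _ => hD.abs_janossy_le _

theorem lintegral_ofReal_janossy_append (m : ℕ) (s : Tup)
    (hpos : ∀ m s, 0 ≤ janossy D (windowMeasure m) s) :
    ∫⁻ y, ENNReal.ofReal (janossy D (windowMeasure (m + 1)) (s.append y)) ∂lp (shellMeasure m) =
      ENNReal.ofReal (janossy D (windowMeasure m) s) := by
  rw [← ofReal_integral_eq_lintegral_ofReal (hD.integrable_janossy_append s)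
    (.of_forall fun _ => hpos _ _), windowMeasure_succ, hD.integral_janossy_append]

/-- Consistency says that the numerators integrate over the shell to the denominator. -/
theorem lintegral_stepDensity (hpos : ∀ m s, 0 ≤ janossy D (windowMeasure m) s) (m : ℕ) (s : Tup) :
    ∫⁻ y, stepDensity D m s y ∂lp (shellMeasure m) = 1 := by
  unfold stepDensity
  split_ifs with h
  · exact lintegral_append_eq_one_of_nil _
  · have h0 : 0 < janossy D (windowMeasure m) s := lt_of_le_of_ne (hpos m s) (Ne.symm h)
    simp_rw [div_eq_mul_inv, ENNReal.ofReal_mul (hpos _ _)]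
    have hm : Measurable fun y =>
        ENNReal.ofReal (janossy D (windowMeasure (m + 1)) (s.append y)) :=
      (hD.measurable_janossy.comp
        (measurable_append_comp measurable_const measurable_id)).ennreal_ofReal
    rw [lintegral_mul_const _ hm,
      hD.lintegral_ofReal_janossy_append m s hpos, ← ENNReal.ofReal_mul (hpos _ _),
      mul_inv_cancel₀ h, ENNReal.ofReal_one]

end IsCorrelation

/-- The conditional law of the points in the shell given the points in the window. -/
noncomputable def stepKernel (D : Tup → ℝ) (m : ℕ) : Kernel Tup Tup :=
  (Kernel.const Tup (lp (shellMeasure m))).withDensity (stepDensity D m)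

/-- The points of the first `n` shells along a trajectory. -/
def concat : ℕ → (ℕ → Tup) → Tup
  -- Coordinate `0` of a trajectory is skipped: the initial law is the point mass at `nil`, and
  -- shell `m` is coordinate `m + 1`.
  | 0, _ => nil
  | n + 1, ω => (concat n ω).append (ω (n + 1))

theorem measurable_concat (n : ℕ) : Measurable (concat n) := by
  induction n with
  | zero => exact measurable_const
  | succ n ih => exact measurable_append_comp ih (measurable_pi_apply _)

theorem concat_congr {n : ℕ} {ω ω' : ℕ → Tup} (h : ∀ i ≤ n, ω i = ω' i) :
    concat n ω = concat n ω' := by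
  induction n with
  | zero => rfl
  | succ n ih =>
    rw [concat, concat, ih fun i hi => h i (hi.trans (Nat.le_succ n)), h _ le_rfl]

/-- Extension of a finite trajectory by empty tuples. -/
def extend (n : ℕ) (x : (i : Iic n) → Tup) : ℕ → Tup :=
  fun i => if h : i ≤ n then x ⟨i, Finset.mem_Iic.2 h⟩ else nil

theorem measurable_extend (n : ℕ) : Measurable (extend n) := by
  refine measurable_pi_iff.2 fun i => ?_
  unfold extend
  split_ifs with h
  · exact measurable_pi_apply _
  · exact measurable_const

theorem concat_extend (n : ℕ) (ω : ℕ → Tup) :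
    concat n (extend n (Preorder.frestrictLe n ω)) = concat n ω :=
  concat_congr fun i hi => by simp [extend, hi]

/-- The transition kernels of the process of points in the shells. -/
noncomputable def transition (D : Tup → ℝ) (n : ℕ) : Kernel ((i : Iic n) → Tup) Tup :=
  (stepKernel D n).comap (fun x => concat n (extend n x))
    ((measurable_concat n).comp (measurable_extend n))

namespace IsCorrelation

variable {D : Tup → ℝ} (hD : IsCorrelation D)
include hD

theorem isMarkovKernel_stepKernel (hpos : ∀ m s, 0 ≤ janossy D (windowMeasure m) s) (m : ℕ) :
    IsMarkovKernel (stepKernel D m) := by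
  refine ⟨fun s => ⟨?_⟩⟩
  rw [stepKernel, Kernel.withDensity_apply' _ (hD.measurable_stepDensity m),
    Measure.restrict_univ, Kernel.const_apply, hD.lintegral_stepDensity hpos]

theorem lintegral_stepKernel (m : ℕ) (s : Tup) {g : Tup → ℝ≥0∞} (hg : Measurable g) :
    ∫⁻ y, g y ∂stepKernel D m s = ∫⁻ y, stepDensity D m s y * g y ∂lp (shellMeasure m) := by
  rw [stepKernel, Kernel.lintegral_withDensity _ (hD.measurable_stepDensity m) _ hg,
    Kernel.const_apply]

theorem isMarkovKernel_transition (hpos : ∀ m s, 0 ≤ janossy D (windowMeasure m) s) (m : ℕ) :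
    IsMarkovKernel (transition D m) := by
  have := hD.isMarkovKernel_stepKernel hpos m
  unfold transition
  infer_instance

end IsCorrelation

/-- The conclusions about a random sequence of tuples, the `m+1`-st of which describes the points
in the shell `m`. -/
structure IsShellProcess (D : Tup → ℝ) (P : Measure (ℕ → Tup)) : Prop where
  isProbabilityMeasure : IsProbabilityMeasure P
  mem_shell : ∀ᵐ ω ∂P, ∀ m i, (ω (m + 1)).2 i ∈ shell m
  -- Symmetry of `F` matters here: `concat` lists the points shell by shell, whereas the
  -- Lebesgue–Poisson measure on the window allows every order.
  lintegral_concat : ∀ m (F : Tup → ℝ≥0∞), Measurable F → Symmetric F →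
    ∫⁻ ω, F (concat m ω) ∂P =
      ∫⁻ s, F s * ENNReal.ofReal (janossy D (windowMeasure m) s) ∂lp (windowMeasure m)

/-- The Ionescu-Tulcea measure of the step kernels. The law of the points in the window follows by
induction: multiplying the conditional density by the Janossy density of the window leaves the
Janossy density of the next window. -/
theorem IsCorrelation.exists_isShellProcess {D : Tup → ℝ} (hD : IsCorrelation D)
    (hnil : D nil = 1) (hpos : ∀ m s, 0 ≤ janossy D (windowMeasure m) s) :
    ∃ P, IsShellProcess D P := by
  have hM := hD.isMarkovKernel_transition hpos
  have hMs := hD.isMarkovKernel_stepKernel hpos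
  have hdirac : IsProbabilityMeasure (Measure.dirac nil) := inferInstance
  set P : Measure (ℕ → Tup) := Kernel.trajMeasure (X := fun _ => Tup) (Measure.dirac nil) (transition D)
    with hP
  have hPp : IsProbabilityMeasure P := by rw [hP]; infer_instance
  -- The transition depends on the past only through the points found so far, so the trajectory
  -- identity can be stated in terms of `concat n ω`.
  have hstep : ∀ n (g : Tup × Tup → ℝ≥0∞), Measurable g →
      ∫⁻ ω, g (concat n ω, ω (n + 1)) ∂P =
        ∫⁻ ω, ∫⁻ y, g (concat n ω, y) ∂stepKernel D n (concat n ω) ∂P := by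
    intro n g hg
    have h := Kernel.map_frestrictLe_trajMeasure_compProd_eq_map_trajMeasure
      (X := fun _ => Tup) (κ := transition D) (μ₀ := Measure.dirac nil) (a := n)
    have hg' : Measurable fun p : ((i : Iic n) → Tup) × Tup => g (concat n (extend n p.1), p.2) :=
      hg.comp ((((measurable_concat n).comp (measurable_extend n)).comp measurable_fst).prodMk
        measurable_snd)
    have h1 := congrArg (fun m => ∫⁻ p, g (concat n (extend n p.1), p.2) ∂m) h
    rw [Measure.lintegral_compProd hg', lintegral_map (hg'.lintegral_kernel_prod_right') (by fun_prop),
      lintegral_map hg' (by fun_prop)] at h1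
    simp only [concat_extend] at h1
    rw [← hP] at h1
    rw [← h1]
    refine lintegral_congr fun ω => ?_
    simp only [transition, Kernel.comap_apply, concat_extend]
  refine ⟨P, hPp, ?_, ?_⟩
  · rw [ae_all_iff]
    intro m
    have hS := (measurableSet_forall_mem (measurableSet_shell m)).compl
    have hg : Measurable (Set.indicator {y : Tup | ∀ i, y.2 i ∈ shell m}ᶜ (1 : Tup → ℝ≥0∞)) :=
      measurable_one.indicator hS
    have h := hstep m (fun p => Set.indicator {y : Tup | ∀ i, y.2 i ∈ shell m}ᶜ 1 p.2)
      (hg.comp measurable_snd)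
    have h0 : ∀ s, ∫⁻ y, Set.indicator {y : Tup | ∀ i, y.2 i ∈ shell m}ᶜ 1 y ∂stepKernel D m s
        = 0 := by
      intro s
      rw [hD.lintegral_stepKernel m s hg]
      refine (lintegral_congr_ae (g := fun _ => 0) ?_).trans lintegral_zero
      filter_upwards [ae_lp_mem (measurableSet_shell m)] with y hy
      have hy' : y ∉ {y : Tup | ∀ i, y.2 i ∈ shell m}ᶜ := fun h => h hy
      simp [Set.indicator_of_notMem hy']
    simp only [h0, lintegral_zero] at h
    have hgm : Measurable fun ω : ℕ → Tup =>
        Set.indicator {y : Tup | ∀ i, y.2 i ∈ shell m}ᶜ (1 : Tup → ℝ≥0∞) (ω (m + 1)) :=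
      hg.comp (measurable_pi_apply (m + 1))
    rw [lintegral_eq_zero_iff hgm] at h
    filter_upwards [h] with ω hω
    by_contra hcon
    have : ω (m + 1) ∈ {y : Tup | ∀ i, y.2 i ∈ shell m}ᶜ := hcon
    simp [Set.indicator_of_mem this] at hω
  · intro m
    induction m with
    | zero =>
      intro F hF hs
      rw [windowMeasure_zero, IsCorrelation.lp_zero, lintegral_dirac' _ (show Measurable fun s =>
        F s * ENNReal.ofReal (janossy D 0 s) from hF.mul hD.measurable_janossy.ennreal_ofReal), hD.janossy_zero, hnil]
      simp [concat]
    | succ m ih =>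
      intro F hF hs
      have hFa : Measurable fun p : Tup × Tup => F (p.1.append p.2) := hF.comp measurable_append
      have h := hstep m (fun p => F (p.1.append p.2)) hFa
      have hG : ∀ s, ∫⁻ y, F (s.append y) ∂stepKernel D m s =
          ∫⁻ y, stepDensity D m s y * F (s.append y) ∂lp (shellMeasure m) := fun s =>
        hD.lintegral_stepKernel m s (hFa.comp measurable_prodMk_left)
      simp only [hG] at h
      change ∫⁻ ω, F ((concat m ω).append (ω (m + 1))) ∂P = _
      rw [h, ih (fun s => ∫⁻ y, stepDensity D m s y * F (s.append y) ∂lp (shellMeasure m))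
        (((hD.measurable_stepDensity m).mul hFa).lintegral_prod_right')]
      · have hJm : Measurable fun s : Tup =>
            ENNReal.ofReal (janossy D (windowMeasure (m + 1)) s) :=
          hD.measurable_janossy.ennreal_ofReal
        have h1 : ∀ s, (∫⁻ y, stepDensity D m s y * F (s.append y) ∂lp (shellMeasure m)) *
            ENNReal.ofReal (janossy D (windowMeasure m) s) =
            ∫⁻ y, F (s.append y) *
              ENNReal.ofReal (janossy D (windowMeasure (m + 1)) (s.append y))
                ∂lp (shellMeasure m) := by
          intro s
          have hm : Measurable fun y => stepDensity D m s y * F (s.append y) :=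
            ((hD.measurable_stepDensity m).mul hFa).comp measurable_prodMk_left
          rw [← lintegral_mul_const _ hm]
          have h2 := hD.lintegral_ofReal_janossy_append m s hpos
          -- If the density of `s` is zero, consistency and positivity force the next densities to
          -- vanish for almost every `y`, so the default value in `stepDensity` does not affect the
          -- integral.
          by_cases h0 : janossy D (windowMeasure m) s = 0
          · rw [h0, ENNReal.ofReal_zero, lintegral_eq_zero_iff (show Measurable fun y =>
              ENNReal.ofReal (janossy D (windowMeasure (m + 1)) (s.append y)) from hJm.comp
              (measurable_append_comp measurable_const measurable_id))] at h2
            refine lintegral_congr_ae ?_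
            filter_upwards [h2] with y hy
            simp only [Pi.zero_apply] at hy
            rw [h0, hy]; simp
          · refine lintegral_congr fun y => ?_
            rw [stepDensity, if_neg h0, mul_right_comm,
              ← ENNReal.ofReal_mul (div_nonneg (hpos _ _) (hpos _ _)), div_mul_cancel₀ _ h0,
              mul_comm]
        simp_rw [h1]
        -- The exponential law merges the integrals over the window and the shell into one over the
        -- larger window.
        rw [windowMeasure_succ, ← lintegral_append_lp (F := fun s => F s * ENNReal.ofReal
          (janossy D (windowMeasure m + shellMeasure m) s)) (hF.mul
            hD.measurable_janossy.ennreal_ofReal), lintegral_prod]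
        · refine Measurable.aemeasurable ?_
          exact (hF.mul hD.measurable_janossy.ennreal_ofReal).comp measurable_append
        · intro s t hst
          simp only [hs _ _ hst, hD.symmetric_janossy _ _ hst]
      · intro s t hst
        refine lintegral_congr fun y => ?_
        rw [hs _ _ (hst.append (Perm.refl y)), stepDensity, stepDensity,
          hD.symmetric_janossy _ _ hst, hD.symmetric_janossy _ _ (hst.append (Perm.refl y))]

end Tup

/-! ### Measurability of tuple counts on configurations. -/

theorem Set.encard_pi_of_finite {n : ℕ} {A : Fin n → Set ℝ} (h : ∀ i, (A i).Finite) :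
    (Set.pi Set.univ A).encard = ∏ i, (A i).encard := by
  have h1 : Set.pi Set.univ A = (Fintype.piFinset fun i => (h i).toFinset : Set (Fin n → ℝ)) := by
    ext x; simp
  rw [h1, Set.encard_coe_eq_coe_finsetCard, Fintype.card_piFinset, Nat.cast_prod]
  refine Finset.prod_congr rfl fun i _ => ?_
  rw [(h i).encard_eq_coe_toFinset_card]

theorem measurable_toENNReal : Measurable fun n : ℕ∞ => (n : ℝ≥0∞) := measurable_of_countable _

theorem measurable_of_toENNReal {α : Type*} [MeasurableSpace α] {f : α → ℕ∞}
    (h : Measurable fun a => (f a : ℝ≥0∞)) : Measurable f := by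
  refine measurable_to_countable' fun n => ?_
  have : f ⁻¹' {n} = (fun a => (f a : ℝ≥0∞)) ⁻¹' {(n : ℝ≥0∞)} := by
    ext a; simp
  rw [this]
  exact h (measurableSet_singleton _)

namespace Configuration

theorem measurable_count {B : Set ℝ} (hB : MeasurableSet B) :
    Measurable fun s : Configuration => s.count B := by
  refine measurable_iff_comap_le.2 ?_
  exact le_iSup₂ (f := fun (B : Set ℝ) (_ : MeasurableSet B) =>
    MeasurableSpace.comap (fun s : Configuration => s.count B) inferInstance) B hB

theorem measurable_of_count {α : Type*} [MeasurableSpace α] {f : α → Configuration}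
    (h : ∀ B, MeasurableSet B → Measurable fun a => (f a).count B) : Measurable f := by
  refine measurable_iff_le_map.2 (iSup₂_le fun B hB => ?_)
  rw [MeasurableSpace.comap_le_iff_le_map, MeasurableSpace.map_comp]
  exact measurable_iff_le_map.1 (h B hB)

theorem finite_inter_window (s : Configuration) (m : ℕ) : (s.points ∩ Tup.window m).Finite :=
  (s.locallyFinite (-m) m).subset (Set.inter_subset_inter_right _ Set.Ico_subset_Icc_self)

/-- The tuples of points in a window. -/
def windowTuples (s : Configuration) (n m : ℕ) : Set (Fin n → ℝ) :=
  Set.pi Set.univ fun _ => s.points ∩ Tup.window m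

theorem finite_windowTuples (s : Configuration) (n m : ℕ) : (s.windowTuples n m).Finite :=
  Set.Finite.pi fun _ => s.finite_inter_window m

/-- On a box the mass is a product of point counts of Borel sets, measurable by the choice of the
`σ`-algebra. Boxes form a generating `π`-system and the measures are finite, which extends
measurability to all Borel sets of tuples. -/
theorem measurable_restrict_windowTuples (n m : ℕ) :
    Measurable fun s : Configuration => Measure.count.restrict (s.windowTuples n m) := by
  have hfin : ∀ s : Configuration, IsFiniteMeasure (Measure.count.restrict (s.windowTuples n m)) :=
    fun s => ⟨by
      rw [Measure.restrict_apply_univ]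
      exact Measure.count_apply_lt_top.2 (s.finite_windowTuples n m)⟩
  have key : ∀ t : Fin n → Set ℝ, (∀ i, MeasurableSet (t i)) → Measurable fun s : Configuration =>
      Measure.count.restrict (s.windowTuples n m) (Set.pi Set.univ t) := by
    intro t ht
    have h1 : ∀ s : Configuration, Measure.count.restrict (s.windowTuples n m) (Set.pi Set.univ t)
        = ((∏ i, s.count (Tup.window m ∩ t i) : ℕ∞) : ℝ≥0∞) := by
      intro s
      have h2 : Set.pi Set.univ t ∩ s.windowTuples n m =
          Set.pi Set.univ fun i => s.points ∩ (Tup.window m ∩ t i) := by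
        rw [windowTuples, ← Set.pi_inter_distrib]
        congr 1
        funext i
        rw [Set.inter_comm, Set.inter_assoc]
      have h3 : ∀ i, (s.points ∩ (Tup.window m ∩ t i)).Finite := fun i =>
        (s.finite_inter_window m).subset (by rw [← Set.inter_assoc]; exact Set.inter_subset_left)
      rw [Measure.restrict_apply (MeasurableSet.univ_pi ht), h2,
        Measure.count_apply (Set.Finite.pi h3).measurableSet, Set.encard_pi_of_finite h3]
      rfl
    simp_rw [h1]
    refine measurable_toENNReal.comp ?_
    exact Finset.measurable_fun_prod _ fun i _ =>
      measurable_count ((Tup.measurableSet_window m).inter (ht i))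
  refine Measurable.measure_of_isPiSystem generateFrom_pi.symm isPiSystem_pi ?_ ?_
  · rintro _ ⟨t, ht, rfl⟩
    exact key t fun i => ht i (Set.mem_univ i)
  · simpa using key (fun _ => Set.univ) fun _ => MeasurableSet.univ

theorem measurableSet_injective (n : ℕ) : MeasurableSet {x : Fin n → ℝ | Function.Injective x} := by
  have : {x : Fin n → ℝ | Function.Injective x} = ⋂ i, ⋂ j, {x | x i = x j → i = j} := by
    ext x; simp [Function.Injective]
  rw [this]
  refine MeasurableSet.iInter fun i => MeasurableSet.iInter fun j => ?_
  by_cases h : i = j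
  · simp [h]
  · simp only [h, imp_false]
    exact (measurableSet_eq_fun (measurable_pi_apply i) (measurable_pi_apply j)).compl

theorem exists_mem_window {n : ℕ} (x : Fin n → ℝ) : ∃ m, ∀ i, x i ∈ Tup.window m := by
  obtain ⟨m, hm⟩ := exists_nat_gt (∑ i, |x i|)
  refine ⟨m, fun i => ?_⟩
  have h1 : |x i| ≤ ∑ i, |x i| :=
    Finset.single_le_sum (f := fun i => |x i|) (fun i _ => abs_nonneg _) (Finset.mem_univ i)
  have h2 := abs_lt.1 (h1.trans_lt hm)
  exact ⟨h2.1.le, h2.2⟩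

theorem tuples_inter_eq_iUnion (s : Configuration) {n : ℕ} (B : Set (Fin n → ℝ)) :
    s.tuples n ∩ B = ⋃ m, (B ∩ {x | Function.Injective x}) ∩ s.windowTuples n m := by
  ext x
  simp only [tuples, windowTuples, Set.mem_inter_iff, Set.mem_iUnion, Set.mem_pi, Set.mem_univ,
    true_implies, Set.mem_ofPred_eq]
  constructor
  · rintro ⟨⟨h1, h2⟩, h3⟩
    obtain ⟨m, hm⟩ := exists_mem_window x
    exact ⟨m, ⟨h3, h1⟩, fun i => ⟨h2 i, hm i⟩⟩
  · rintro ⟨m, ⟨h3, h1⟩, h⟩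
    exact ⟨⟨h1, fun i => (h i).1⟩, h3⟩

theorem windowTuples_mono (s : Configuration) (n : ℕ) : Monotone (s.windowTuples n) :=
  fun _ _ h => Set.pi_mono fun _ _ => Set.inter_subset_inter_right _ (Tup.window_mono h)

theorem encard_tuples_inter_eq_iSup (s : Configuration) {n : ℕ} (B : Set (Fin n → ℝ)) :
    ((s.tuples n ∩ B).encard : ℝ≥0∞) =
      ⨆ m, (((B ∩ {x | Function.Injective x}) ∩ s.windowTuples n m).encard : ℝ≥0∞) := by
  have hf : ∀ m, ((B ∩ {x | Function.Injective x}) ∩ s.windowTuples n m).Finite := fun m =>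
    (s.finite_windowTuples n m).subset Set.inter_subset_right
  have h : (s.tuples n ∩ B) = ⋃ m, (B ∩ {x | Function.Injective x}) ∩ s.windowTuples n m :=
    s.tuples_inter_eq_iUnion B
  rw [h, ← Measure.count_apply (MeasurableSet.iUnion fun m => (hf m).measurableSet),
    Monotone.measure_iUnion fun i j hij => Set.inter_subset_inter_right _
      (s.windowTuples_mono n hij)]
  exact iSup_congr fun m => Measure.count_apply (hf m).measurableSet

theorem measurable_encard_windowTuples {n : ℕ} {B : Set (Fin n → ℝ)} (hB : MeasurableSet B)
    (m : ℕ) : Measurable fun s : Configuration =>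
      (((B ∩ {x | Function.Injective x}) ∩ s.windowTuples n m).encard : ℝ≥0∞) := by
  have h := (Measure.measurable_coe (hB.inter (measurableSet_injective n))).comp
    (measurable_restrict_windowTuples n m)
  convert h using 1
  funext s
  rw [Function.comp_apply, Measure.restrict_apply (hB.inter (measurableSet_injective n)),
    Measure.count_apply]
  exact ((s.finite_windowTuples n m).subset Set.inter_subset_right).measurableSet

theorem measurable_encard_tuples {n : ℕ} {B : Set (Fin n → ℝ)} (hB : MeasurableSet B) :
    Measurable fun s : Configuration => ((s.tuples n ∩ B).encard : ℝ≥0∞) := by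
  simp_rw [encard_tuples_inter_eq_iSup]
  exact Measurable.iSup fun m => measurable_encard_windowTuples hB m

end Configuration

/-! ### From trajectories of tuples to configurations. -/

namespace Tup

theorem measurable_encard_range_inter {E : Set ℝ} (hE : MeasurableSet E) :
    Measurable fun t : Tup => (Set.range t.2 ∩ E).encard := by
  refine measurable_of_mk fun n => ?_
  -- Distinct values are counted by the indices of their first occurrence, a measurable random set
  -- of indices.
  have h1 : ∀ x : Fin n → ℝ, (Set.range x ∩ E).encard =
      {i : Fin n | x i ∈ E ∧ ∀ j < i, x j ≠ x i}.encard := by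
    intro x
    have h2 : Set.range x ∩ E = x '' {i : Fin n | x i ∈ E ∧ ∀ j < i, x j ≠ x i} := by
      ext r
      constructor
      · rintro ⟨⟨i, rfl⟩, hi⟩
        obtain ⟨j, hj, hmin⟩ := WellFounded.has_min (wellFounded_lt (α := Fin n))
          {j | x j = x i} ⟨i, rfl⟩
        have hj' : x j = x i := hj
        refine ⟨j, ⟨hj' ▸ hi, fun k hk hkj => hmin k (hkj.trans hj') hk⟩, hj'⟩
      · rintro ⟨i, hi, rfl⟩
        exact ⟨⟨i, rfl⟩, hi.1⟩
    rw [h2]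
    refine Set.InjOn.encard_image fun i hi j hj hij => ?_
    rcases lt_trichotomy i j with h | h | h
    · exact absurd hij (hj.2 i h)
    · exact h
    · exact absurd hij.symm (hi.2 j h)
  change Measurable fun x : Fin n → ℝ => (Set.range x ∩ E).encard
  simp_rw [h1]
  refine measurable_encard.comp (measurable_set_iff.2 fun i => ?_)
  refine Measurable.and ?_ ?_
  · exact measurable_mem.2 hE |>.comp (measurable_pi_apply i)
  · refine Measurable.forall fun j => ?_
    by_cases h : j < i
    · simp only [h, true_implies]
      exact (measurableSet_setOfPred.1
        (measurableSet_eq_fun (measurable_pi_apply j) (measurable_pi_apply i))).not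
    · simp only [h, false_implies]; exact measurable_const

/-- The configuration of the points of a tuple. -/
def toConfiguration (s : Tup) : Configuration where
  points := Set.range s.2
  locallyFinite _ _ := (Set.finite_range s.2).subset Set.inter_subset_left

theorem measurable_toConfiguration : Measurable toConfiguration :=
  Configuration.measurable_of_count fun _ hB => measurable_encard_range_inter hB

theorem disjoint_shell_window {m n : ℕ} (h : n ≤ m) : Disjoint (shell m) (window n) :=
  Set.disjoint_sdiff_left.mono_right (window_mono h)

theorem shell_subset_window (m : ℕ) : shell m ⊆ window (m + 1) := Set.sdiff_subset

theorem pairwise_disjoint_shell : Pairwise (Function.onFun Disjoint shell) := by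
  have h : ∀ m n, m < n → Disjoint (shell m) (shell n) := fun m n hmn =>
    ((disjoint_shell_window (m := n) (n := m + 1) hmn).mono_right (shell_subset_window m)).symm
  intro m n hmn
  rcases hmn.lt_or_gt with h' | h'
  · exact h m n h'
  · exact (h n m h').symm

/-- The configuration of the points of a sequence of tuples, the `m+1`-st of which is restricted to
the shell `m`. -/
def shellConfiguration (ω : ℕ → Tup) : Configuration where
  -- Cutting with the shells makes the set locally finite for every trajectory, not only for almost
  -- every one.
  points := ⋃ m, Set.range (ω (m + 1)).2 ∩ shell m
  locallyFinite a b := by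
    obtain ⟨M, hM⟩ := Configuration.exists_mem_window ![a, b]
    have ha := hM 0
    have hb := hM 1
    simp only [Matrix.cons_val_zero, Matrix.cons_val_one] at ha hb
    have hsub : Set.Icc a b ⊆ window M := fun x hx => ⟨ha.1.trans hx.1, hx.2.trans_lt hb.2⟩
    refine Set.Finite.subset (Set.finite_iUnion (ι := Fin M) fun m =>
      Set.finite_range (ω (m + 1)).2) ?_
    rintro x ⟨hx, hab⟩
    obtain ⟨m, hm⟩ := Set.mem_iUnion.1 hx
    have hmM : m < M := by
      by_contra! hcon
      exact Set.disjoint_left.1 (disjoint_shell_window hcon) hm.2 (hsub hab)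
    exact Set.mem_iUnion.2 ⟨⟨m, hmM⟩, hm.1⟩

theorem measurable_shellConfiguration : Measurable shellConfiguration := by
  refine Configuration.measurable_of_count fun B hB => measurable_of_toENNReal ?_
  have h1 : ∀ ω : ℕ → Tup, ((shellConfiguration ω).count B : ℝ≥0∞) =
      ∑' m, ((Set.range (ω (m + 1)).2 ∩ (shell m ∩ B)).encard : ℝ≥0∞) := by
    intro ω
    have hfin : ∀ m, (Set.range (ω (m + 1)).2 ∩ (shell m ∩ B)).Finite := fun m =>
      (Set.finite_range _).subset Set.inter_subset_left
    have h2 : (shellConfiguration ω).points ∩ B =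
        ⋃ m, Set.range (ω (m + 1)).2 ∩ (shell m ∩ B) := by
      simp only [shellConfiguration, Set.iUnion_inter, Set.inter_assoc]
    rw [Configuration.count, h2,
      ← Measure.count_apply (MeasurableSet.iUnion fun m => (hfin m).measurableSet),
      measure_iUnion _ fun m => (hfin m).measurableSet]
    · exact tsum_congr fun m => Measure.count_apply (hfin m).measurableSet
    · intro m n hmn
      exact (pairwise_disjoint_shell hmn).mono
        (Set.inter_subset_right.trans Set.inter_subset_left)
        (Set.inter_subset_right.trans Set.inter_subset_left)
  simp_rw [h1]
  exact Measurable.tsum fun m => measurable_toENNReal.comp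
    ((measurable_encard_range_inter ((measurableSet_shell m).inter hB)).comp
      (measurable_pi_apply (m + 1)))

theorem range_append (s t : Tup) : Set.range (s.append t).2 = Set.range s.2 ∪ Set.range t.2 := by
  ext r
  constructor
  · rintro ⟨i, rfl⟩
    obtain ⟨j, rfl⟩ := (appendEquiv s t).surjective i
    rw [append_appendEquiv]
    rcases j with j | j
    · exact Or.inl ⟨j, rfl⟩
    · exact Or.inr ⟨j, rfl⟩
  · rintro (⟨i, rfl⟩ | ⟨i, rfl⟩)
    · exact ⟨appendEquiv s t (.inl i), append_appendEquiv s t _⟩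
    · exact ⟨appendEquiv s t (.inr i), append_appendEquiv s t _⟩

/-- Later shells are disjoint from the window, so only the first `n` tuples can contribute. The
hypothesis, which holds almost surely, ensures that the cut with the shells removes nothing. -/
theorem points_inter_window {ω : ℕ → Tup} (h : ∀ m i, (ω (m + 1)).2 i ∈ shell m) (n : ℕ) :
    (shellConfiguration ω).points ∩ window n = (concat n ω).toConfiguration.points ∩ window n := by
  have h1 : ∀ n, Set.range (concat n ω).2 = ⋃ m : Fin n, Set.range (ω (m + 1)).2 := by
    intro n
    induction n with
    | zero => ext r; simp [concat, nil]
    | succ n ih =>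
      rw [concat, range_append, ih]
      ext r
      simp only [Set.mem_union, Set.mem_iUnion]
      rw [Fin.exists_fin_succ']
      rfl
  ext r
  simp only [shellConfiguration, toConfiguration, h1, Set.mem_inter_iff, Set.mem_iUnion]
  constructor
  · rintro ⟨⟨m, hm, hms⟩, hr⟩
    have hmn : m < n := by
      by_contra! hcon
      exact Set.disjoint_left.1 (disjoint_shell_window hcon) hms hr
    exact ⟨⟨⟨m, hmn⟩, hm⟩, hr⟩
  · rintro ⟨⟨m, hm⟩, hr⟩
    refine ⟨⟨m, hm, ?_⟩, hr⟩
    obtain ⟨i, rfl⟩ := hm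
    exact h m i

end Tup

/-! ### Correlation functions of the constructed process. -/

namespace Tup

open scoped Nat

theorem encard_tuples_toConfiguration {s : Tup} (hs : Function.Injective s.2) {k : ℕ}
    (E : Set (Fin k → ℝ)) :
    ((s.toConfiguration.tuples k ∩ E).encard : ℝ≥0∞) =
      ∑ σ : Fin k ↪ Fin s.1, E.indicator 1 (s.2 ∘ σ) := by
  classical
  have h1 : s.toConfiguration.tuples k ∩ E =
      (fun σ : Fin k ↪ Fin s.1 => s.2 ∘ σ) '' {σ | s.2 ∘ σ ∈ E} := by
    ext x
    constructor
    · rintro ⟨⟨hx, hxs⟩, hE⟩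
      choose σ hσ using hxs
      have h2 : s.2 ∘ σ = x := funext hσ
      refine ⟨⟨σ, fun a b hab => hx ?_⟩, ?_, h2⟩
      · rw [← hσ a, ← hσ b, hab]
      · change s.2 ∘ σ ∈ E
        rwa [h2]
    · rintro ⟨σ, hσ, rfl⟩
      exact ⟨⟨hs.comp σ.injective, fun i => ⟨σ i, rfl⟩⟩, hσ⟩
  have hinj : Function.Injective fun σ : Fin k ↪ Fin s.1 => s.2 ∘ σ := fun σ τ h =>
    DFunLike.ext _ _ fun i => hs (congrFun h i)
  rw [h1, hinj.injOn.encard_image, ← Set.coe_toFinset {σ : Fin k ↪ Fin s.1 | s.2 ∘ σ ∈ E},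
    Set.encard_coe_eq_coe_finsetCard, Set.toFinset_ofPred, Finset.card_filter]
  simp [Set.indicator_apply]

theorem tuples_toConfiguration_perm {s t : Tup} (h : s.Perm t) (k : ℕ) :
    s.toConfiguration.tuples k = t.toConfiguration.tuples k := by
  obtain ⟨e, he⟩ := h
  have h1 : Set.range s.2 = Set.range t.2 := by
    rw [show s.2 = t.2 ∘ e from funext fun i => (he i).symm, e.surjective.range_comp]
  ext x
  simp [Configuration.tuples, toConfiguration, h1]

/-- An injection of `Fin k` into `Fin (k + l)` extends to an equivalence. -/
theorem exists_equiv_extending {k l : ℕ} (σ : Fin k ↪ Fin (k + l)) :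
    ∃ e : Fin k ⊕ Fin l ≃ Fin (k + l), ∀ i, e (.inl i) = σ i := by
  classical
  have e2 : Fin l ≃ {i // ¬ i ∈ Set.range σ} := Fintype.equivOfCardEq (by
    rw [Fintype.card_subtype_compl, ← Fintype.card_congr (Equiv.ofInjective σ σ.injective)]
    simp)
  exact ⟨(Equiv.sumCongr (Equiv.ofInjective σ σ.injective) e2).trans
    (Equiv.sumCompl (· ∈ Set.range σ)), fun i => rfl⟩

variable {D : Tup → ℝ}

theorem IsCorrelation.janossy_eq_zero (hinj : ∀ s : Tup, ¬ Function.Injective s.2 → D s = 0)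
    {s : Tup} (hs : ¬ Function.Injective s.2) (μ : Measure ℝ) : janossy D μ s = 0 := by
  have h : ∀ z, D (s.append z) = 0 := fun z => hinj _ fun hcon => hs fun a b hab => by
    have h1 := append_appendEquiv s z (.inl a)
    have h2 := append_appendEquiv s z (.inl b)
    simp only [Sum.elim_inl] at h1 h2
    have h3 := hcon (h1.trans (hab.trans h2.symm))
    simpa using h3
  simp [janossy, h]

/-- Ordered `k`-tuples chosen from `n = k + l` points correspond to injections of `Fin k` into `Fin
n`. By symmetry they all contribute the same integral, in which the other `l` points are integrated
out. Consistency from the empty window turns the sum over `l` into `D`. -/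
theorem IsCorrelation.lintegral_encard_tuples (hD : IsCorrelation D)
    (hinj : ∀ s : Tup, ¬ Function.Injective s.2 → D s = 0)
    (hpos : ∀ m s, 0 ≤ janossy D (windowMeasure m) s) {k m : ℕ} {E : Set (Fin k → ℝ)}
    (hE : MeasurableSet E) :
    ∫⁻ s, ((s.toConfiguration.tuples k ∩ E).encard : ℝ≥0∞) *
        ENNReal.ofReal (janossy D (windowMeasure m) s) ∂lp (windowMeasure m) =
      ∫⁻ x, E.indicator 1 x * ENNReal.ofReal (D (Tup.mk k x))
        ∂(Measure.pi fun _ : Fin k => windowMeasure m) := by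
  set J : Tup → ℝ≥0∞ := fun s => ENNReal.ofReal (janossy D (windowMeasure m) s) with hJ
  have hJm : Measurable J := hD.measurable_janossy.ennreal_ofReal
  have hJs : Symmetric J := fun s t h => by simp only [hJ, hD.symmetric_janossy _ _ h]
  have hIE : Measurable (E.indicator (1 : (Fin k → ℝ) → ℝ≥0∞)) := measurable_one.indicator hE
  have h1 : ∀ s : Tup, ((s.toConfiguration.tuples k ∩ E).encard : ℝ≥0∞) * J s =
      ∑ σ : Fin k ↪ Fin s.1, E.indicator 1 (s.2 ∘ σ) * J s := by
    intro s
    -- For a tuple with repeated entries the count over injections would be wrong, but there the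
    -- Janossy density vanishes.
    by_cases hs : Function.Injective s.2
    · rw [encard_tuples_toConfiguration hs, Finset.sum_mul]
    · simp [hJ, IsCorrelation.janossy_eq_zero hinj hs]
  have hmeas : Measurable fun s : Tup => ((s.toConfiguration.tuples k ∩ E).encard : ℝ≥0∞) * J s :=
    ((Configuration.measurable_encard_tuples hE).comp measurable_toConfiguration).mul hJm
  rw [lintegral_lp _ hmeas]
  set c : ℕ → ℝ≥0∞ := fun l => ∫⁻ z, E.indicator 1 z.1 * J ((Tup.mk k z.1).append (Tup.mk l z.2))
    ∂((Measure.pi fun _ : Fin k => windowMeasure m).prod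
      (Measure.pi fun _ : Fin l => windowMeasure m)) with hc
  have hsigma : ∀ n (σ : Fin k ↪ Fin n), Measurable fun x : Fin n → ℝ =>
      E.indicator (1 : (Fin k → ℝ) → ℝ≥0∞) (x ∘ σ) * J (Tup.mk n x) := fun n σ =>
    (hIE.comp (measurable_pi_iff.2 fun i => measurable_pi_apply (σ i))).mul
      (hJm.comp (measurable_mk n))
  have h2 : ∀ n, ∫⁻ x, (((Tup.mk n x).toConfiguration.tuples k ∩ E).encard : ℝ≥0∞) * J (Tup.mk n x)
      ∂(Measure.pi fun _ : Fin n => windowMeasure m) =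
      ∑ σ : Fin k ↪ Fin n, ∫⁻ x, E.indicator 1 (x ∘ σ) * J (Tup.mk n x)
        ∂(Measure.pi fun _ : Fin n => windowMeasure m) := by
    intro n
    rw [← lintegral_finsetSum _ fun σ _ => hsigma n σ]
    exact lintegral_congr fun x => h1 (Tup.mk n x)
  have h3 : ∀ l (σ : Fin k ↪ Fin (k + l)), ∫⁻ x, E.indicator 1 (x ∘ σ) * J (Tup.mk (k + l) x)
        ∂(Measure.pi fun _ : Fin (k + l) => windowMeasure m) = c l := by
    intro l σ
    obtain ⟨e, he⟩ := exists_equiv_extending σ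
    have hp := measurePreserving_glue e fun _ => windowMeasure m
    rw [← hp.lintegral_comp (hsigma _ σ)]
    refine lintegral_congr fun z => ?_
    congr 1
    · congr 1
      funext i
      simp [← he i]
    · refine (hJs _ _ ?_).symm
      exact perm_of_sum (s := Tup.mk k z.1) (t := Tup.mk l z.2) (u := Tup.mk (k + l) _) e fun i =>
        congrArg (Sum.elim z.1 z.2) (e.symm_apply_apply i)
  have h4 : ∑' n : ℕ, (n ! : ℝ≥0∞)⁻¹ * ∫⁻ x, (((toConfiguration ⟨n, x⟩).tuples k ∩ E).encard : ℝ≥0∞)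
      * J ⟨n, x⟩ ∂(Measure.pi fun _ : Fin n => windowMeasure m) =
      ∑' l : ℕ, (l ! : ℝ≥0∞)⁻¹ * c l := by
    have h5 : ∀ n < k, (n ! : ℝ≥0∞)⁻¹ * ∫⁻ x, (((Tup.mk n x).toConfiguration.tuples k ∩ E).encard : ℝ≥0∞)
      * J (Tup.mk n x) ∂(Measure.pi fun _ : Fin n => windowMeasure m) = 0 := by
      intro n hn
      have : IsEmpty (Fin k ↪ Fin n) := Function.Embedding.isEmpty_of_card_lt (by simpa using hn)
      rw [h2]; simp
    change ∑' n : ℕ, (n ! : ℝ≥0∞)⁻¹ * ∫⁻ x, (((Tup.mk n x).toConfiguration.tuples k ∩ E).encard : ℝ≥0∞)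
      * J (Tup.mk n x) ∂(Measure.pi fun _ : Fin n => windowMeasure m) = _
    rw [← ENNReal.summable.sum_add_tsum_nat_add' (k := k), Finset.sum_eq_zero fun n hn =>
      h5 n (Finset.mem_range.1 hn), zero_add]
    refine tsum_congr fun l => ?_
    rw [add_comm l k, h2]
    simp_rw [h3]
    -- There are `(k + l)! / l!` injections, which turns the weight `1 / (k + l)!` into `1 / l!`.
    rw [Finset.sum_const, Finset.card_univ, Fintype.card_embedding_eq, Fintype.card_fin,
      Fintype.card_fin, nsmul_eq_mul, ← mul_assoc]
    congr 1
    have h6 := Nat.factorial_mul_descFactorial (Nat.le_add_right k l)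
    rw [Nat.add_sub_cancel_left] at h6
    have hl : (l ! : ℝ≥0∞) ≠ 0 := by exact_mod_cast l.factorial_ne_zero
    have hd : ((k + l).descFactorial k : ℝ≥0∞) ≠ 0 := by
      have := Nat.descFactorial_eq_zero_iff_lt.not.2 (not_lt.2 (Nat.le_add_right k l))
      exact_mod_cast this
    rw [← h6, Nat.cast_mul, ENNReal.mul_inv (Or.inl hl) (Or.inl (by simp)), mul_assoc,
      ENNReal.inv_mul_cancel hd (by simp), mul_one]
  rw [h4]
  have hcm : ∀ l, Measurable fun z : (Fin k → ℝ) × (Fin l → ℝ) =>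
      E.indicator (1 : (Fin k → ℝ) → ℝ≥0∞) z.1 * J ((Tup.mk k z.1).append (Tup.mk l z.2)) := fun l =>
    (hIE.comp measurable_fst).mul (hJm.comp (measurable_append_comp
      ((measurable_mk k).comp measurable_fst) ((measurable_mk l).comp measurable_snd)))
  have h7 : ∀ l, (l ! : ℝ≥0∞)⁻¹ * c l = ∫⁻ x, (l ! : ℝ≥0∞)⁻¹ * (E.indicator 1 x *
      ∫⁻ y, J ((Tup.mk k x).append (Tup.mk l y)) ∂(Measure.pi fun _ : Fin l => windowMeasure m))
      ∂(Measure.pi fun _ : Fin k => windowMeasure m) := by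
    intro l
    rw [hc, lintegral_const_mul']
    · congr 1
      simp only
      rw [lintegral_prod _ (hcm l).aemeasurable]
      refine lintegral_congr fun x => ?_
      exact lintegral_const_mul (μ := Measure.pi fun _ : Fin l => windowMeasure m)
        (E.indicator 1 x) (show Measurable fun y => J ((Tup.mk k x).append (Tup.mk l y)) from
        hJm.comp (measurable_append_comp measurable_const (measurable_mk l)))
    · exact ENNReal.inv_ne_top.2 (by exact_mod_cast l.factorial_ne_zero)
  simp_rw [h7]
  rw [← lintegral_tsum]
  · refine lintegral_congr fun x => ?_
    simp_rw [mul_left_comm _ (E.indicator 1 x)]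
    rw [ENNReal.tsum_mul_left]
    congr 1
    have h8 := lintegral_lp (windowMeasure m) (F := fun y => J ((Tup.mk k x).append y))
      (hJm.comp (measurable_append_comp measurable_const measurable_id))
    change ∑' l : ℕ, (l ! : ℝ≥0∞)⁻¹ * ∫⁻ y, J ((Tup.mk k x).append ⟨l, y⟩)
      ∂(Measure.pi fun _ : Fin l => windowMeasure m) = _
    rw [← h8, hJ, ← ofReal_integral_eq_lintegral_ofReal (hD.integrable_janossy_append _)
      (.of_forall fun _ => hpos _ _)]
    congr 1
    have h9 := hD.integral_janossy_append (μ := 0) (ν := windowMeasure m) (Tup.mk k x)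
    rwa [zero_add, hD.janossy_zero] at h9
  · intro l
    have h10 : Measurable fun z : (Fin k → ℝ) × (Fin l → ℝ) => J ((Tup.mk k z.1).append (Tup.mk l z.2)) :=
      hJm.comp (measurable_append_comp
      ((measurable_mk k).comp measurable_fst) ((measurable_mk l).comp measurable_snd))
    exact ((hIE.mul h10.lintegral_prod_right').const_mul _).aemeasurable

/-- Correlation functions with nonnegative Janossy densities are those of a point process. -/
theorem IsCorrelation.exists_process (hD : IsCorrelation D) (hnil : D nil = 1)
    (hinj : ∀ s : Tup, ¬ Function.Injective s.2 → D s = 0)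
    (hpos : ∀ m s, 0 ≤ janossy D (windowMeasure m) s) :
    ∃ P : Measure Configuration, IsProbabilityMeasure P ∧
      ∀ n (B : Set (Fin n → ℝ)), MeasurableSet B →
        ∫⁻ s, ((s.tuples n ∩ B).encard : ℝ≥0∞) ∂P = ∫⁻ x in B, ENNReal.ofReal (D ⟨n, x⟩) := by
  obtain ⟨P, hP⟩ := hD.exists_isShellProcess hnil hpos
  have hPp := hP.isProbabilityMeasure
  refine ⟨P.map shellConfiguration,
    Measure.isProbabilityMeasure_map measurable_shellConfiguration.aemeasurable, fun n B hB => ?_⟩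
  set W : ℕ → Set (Fin n → ℝ) := fun m => Set.pi Set.univ fun _ => window m with hW
  have hWm : ∀ m, MeasurableSet (W m) := fun m =>
    MeasurableSet.univ_pi fun _ => measurableSet_window m
  have hWmono : Monotone W := fun a b h => Set.pi_mono fun _ _ => window_mono h
  have hWU : ⋃ m, B ∩ W m = B := by
    ext x
    simp only [hW, Set.mem_iUnion, Set.mem_inter_iff, Set.mem_pi, Set.mem_univ, true_implies]
    exact ⟨fun ⟨_, h, _⟩ => h, fun h => (Configuration.exists_mem_window x).imp fun m hm => ⟨h, hm⟩⟩
  rw [lintegral_map (Configuration.measurable_encard_tuples hB) measurable_shellConfiguration]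
  have h1 : ∀ m, ∫⁻ ω, (((shellConfiguration ω).tuples n ∩ (B ∩ W m)).encard : ℝ≥0∞) ∂P =
      ∫⁻ x in B ∩ W m, ENNReal.ofReal (D ⟨n, x⟩) := by
    intro m
    have hBW := hB.inter (hWm m)
    have h2 : ∫⁻ ω, (((shellConfiguration ω).tuples n ∩ (B ∩ W m)).encard : ℝ≥0∞) ∂P =
        ∫⁻ ω, (((concat m ω).toConfiguration.tuples n ∩ (B ∩ W m)).encard : ℝ≥0∞) ∂P := by
      refine lintegral_congr_ae ?_
      filter_upwards [hP.mem_shell] with ω hω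
      have h3 := points_inter_window hω m
      have h4 : (shellConfiguration ω).tuples n ∩ (B ∩ W m) =
          (concat m ω).toConfiguration.tuples n ∩ (B ∩ W m) := by
        ext x
        simp only [Configuration.tuples, hW, Set.mem_inter_iff, Set.mem_pi, Set.mem_univ,
          true_implies, Set.mem_ofPred_eq]
        refine and_congr_left fun hx => and_congr_right fun _ => forall_congr' fun i => ?_
        have h5 := Set.ext_iff.1 h3 (x i)
        simp only [Set.mem_inter_iff, hx.2 i, and_true] at h5
        exact h5
      rw [h4]
    rw [h2, hP.lintegral_concat m
      (fun s => ((s.toConfiguration.tuples n ∩ (B ∩ W m)).encard : ℝ≥0∞))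
      ((Configuration.measurable_encard_tuples hBW).comp measurable_toConfiguration)
      (fun s t h => by simp only [tuples_toConfiguration_perm h]),
      hD.lintegral_encard_tuples hinj hpos hBW]
    have h6 : (Measure.pi fun _ : Fin n => windowMeasure m) = volume.restrict (W m) := by
      rw [volume_pi, hW, Measure.restrict_pi_pi]; rfl
    rw [h6, ← lintegral_indicator hBW, ← lintegral_indicator (hWm m)]
    refine lintegral_congr fun x => ?_
    by_cases hx : x ∈ W m
    · by_cases hx' : x ∈ B
      · simp [Set.indicator, hx, hx', Tup.mk]
      · simp [Set.indicator, hx, hx']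
    · simp [Set.indicator, hx]
  have hmonoB : Monotone fun m => B ∩ W m := fun a b h => Set.inter_subset_inter_right _ (hWmono h)
  have hR : ∫⁻ x in B, ENNReal.ofReal (D ⟨n, x⟩) =
      ⨆ m, ∫⁻ x in B ∩ W m, ENNReal.ofReal (D ⟨n, x⟩) := by
    have hDm : Measurable fun x : Fin n → ℝ => ENNReal.ofReal (D ⟨n, x⟩) :=
      (hD.measurable.comp (measurable_mk n)).ennreal_ofReal
    have h7 := Monotone.measure_iUnion
      (μ := (volume : Measure (Fin n → ℝ)).withDensity fun x => ENNReal.ofReal (D ⟨n, x⟩)) hmonoB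
    rw [hWU, withDensity_apply _ hB] at h7
    rw [h7]
    exact iSup_congr fun m => withDensity_apply _ (hB.inter (hWm m))
  -- Monotone convergence along the windows removes the restriction to bounded sets.
  rw [hR, ← iSup_congr h1, ← lintegral_iSup]
  · refine lintegral_congr fun ω => ?_
    have hcount : ((shellConfiguration ω).points).Countable := by
      rw [shellConfiguration]
      exact Set.countable_iUnion fun m => ((Set.finite_range _).subset Set.inter_subset_left).countable
    have hmeas : ∀ S : Set (Fin n → ℝ), MeasurableSet ((shellConfiguration ω).tuples n ∩ S) :=
      fun S => by
        refine Set.Countable.measurableSet (Set.Countable.mono ?_ (Set.countable_univ_pi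
          fun _ : Fin n => hcount))
        exact fun x hx i _ => hx.1.2 i
    rw [← Measure.count_apply (hmeas B)]
    conv_lhs => rw [← hWU, Set.inter_iUnion]
    rw [Monotone.measure_iUnion fun a b h => Set.inter_subset_inter_right _ (hmonoB h)]
    exact iSup_congr fun m => Measure.count_apply (hmeas _)
  · intro m
    exact (Configuration.measurable_encard_tuples (hB.inter (hWm m))).comp
      measurable_shellConfiguration
  · intro a b h ω
    exact ENat.toENNReal_le.2 (Set.encard_le_encard (Set.inter_subset_inter_right _ (hmonoB h)))

end Tup

/-! ### Contraction kernels and their discretization by cells. -/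

/-- A bounded continuous symmetric kernel whose quadratic form lies between `0` and the square of
the `L²` norm. -/
structure IsContractionKernel (K : ℝ → ℝ → ℝ) : Prop where
  continuous : Continuous (Function.uncurry K)
  symm : ∀ x y, K x y = K y x
  abs_le : ∀ x y, |K x y| ≤ 1
  form_nonneg : ∀ f : ℝ → ℝ, Integrable f → Integrable (fun x => f x ^ 2) →
    0 ≤ ∫ x, f x * ∫ y, f y * K x y
  form_le : ∀ f : ℝ → ℝ, Integrable f → Integrable (fun x => f x ^ 2) →
    ∫ x, f x * ∫ y, f y * K x y ≤ ∫ x, f x ^ 2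

/-- The number of cells of the partition of the line in a unit interval. -/
def resolution (N : ℕ) : ℝ := N + 1

theorem resolution_pos (N : ℕ) : 0 < resolution N := by unfold resolution; positivity

/-- The cells of a partition of the line into intervals of length `1 / resolution N`. -/
def cell (N : ℕ) (i : ℤ) : Set ℝ := Set.Ico (i / resolution N) ((i + 1) / resolution N)

/-- The index of the cell containing a point. -/
noncomputable def cellIndex (N : ℕ) (x : ℝ) : ℤ := ⌊x * resolution N⌋

theorem mem_cell_iff {N : ℕ} {i : ℤ} {x : ℝ} : x ∈ cell N i ↔ cellIndex N x = i := by
  rw [cell, cellIndex, Int.floor_eq_iff, Set.mem_Ico, div_le_iff₀ (resolution_pos N),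
    lt_div_iff₀ (resolution_pos N)]

theorem measurableSet_cell (N : ℕ) (i : ℤ) : MeasurableSet (cell N i) := measurableSet_Ico

theorem volume_cell (N : ℕ) (i : ℤ) : volume (cell N i) = ENNReal.ofReal (resolution N)⁻¹ := by
  rw [cell, Real.volume_Ico]
  congr 1
  ring

theorem volume_real_cell (N : ℕ) (i : ℤ) : volume.real (cell N i) = (resolution N)⁻¹ := by
  rw [Measure.real, volume_cell, ENNReal.toReal_ofReal (inv_nonneg.2 (resolution_pos N).le)]

instance (N : ℕ) (i : ℤ) : IsFiniteMeasure (volume.restrict (cell N i)) := by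
  unfold cell; infer_instance

theorem measurable_cellIndex (N : ℕ) : Measurable (cellIndex N) :=
  Int.measurable_floor.comp (measurable_id.mul_const _)

/-- The compression of a kernel to functions that are constant on cells. -/
noncomputable def cellMatrix (K : ℝ → ℝ → ℝ) (N : ℕ) : Matrix ℤ ℤ ℝ :=
  Matrix.of fun i j => resolution N * ∫ x in cell N i, ∫ y in cell N j, K x y

/-- The kernel of averages over cells. -/
noncomputable def cellKernel (K : ℝ → ℝ → ℝ) (N : ℕ) (x y : ℝ) : ℝ :=
  resolution N * cellMatrix K N (cellIndex N x) (cellIndex N y)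

namespace IsContractionKernel

variable {K : ℝ → ℝ → ℝ} (hK : IsContractionKernel K)
include hK

theorem measurable : Measurable (Function.uncurry K) := hK.continuous.measurable

theorem integrable_right (x : ℝ) (N : ℕ) (j : ℤ) : Integrable (K x) (volume.restrict (cell N j)) :=
  Tup.integrable_of_bound (hK.measurable.comp measurable_prodMk_left) fun y => hK.abs_le x y

theorem measurable_integral_cell (N : ℕ) (j : ℤ) : Measurable fun x => ∫ y in cell N j, K x y :=
  (hK.measurable.stronglyMeasurable.integral_prod_right' (ν := volume.restrict (cell N j))).measurable

theorem abs_integral_cell_le (N : ℕ) (j : ℤ) (x : ℝ) :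
    |∫ y in cell N j, K x y| ≤ (resolution N)⁻¹ := by
  have h : ∀ᵐ y ∂volume.restrict (cell N j), ‖K x y‖ ≤ 1 := .of_forall fun y => hK.abs_le x y
  have := norm_integral_le_of_norm_le_const h
  rwa [one_mul, Measure.real, Measure.restrict_apply_univ, volume_cell,
    ENNReal.toReal_ofReal (inv_nonneg.2 (resolution_pos N).le)] at this

theorem integrable_integral_cell (N : ℕ) (i j : ℤ) :
    Integrable (fun x => ∫ y in cell N j, K x y) (volume.restrict (cell N i)) :=
  Tup.integrable_of_bound (hK.measurable_integral_cell N j) fun x => hK.abs_integral_cell_le N j x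

theorem integral_step (c : ℤ →₀ ℝ) (N : ℕ) :
    ∫ x, (∑ i ∈ c.support, c i * (cell N i).indicator 1 x) *
      ∫ y, (∑ j ∈ c.support, c j * (cell N j).indicator 1 y) * K x y =
    ∑ i ∈ c.support, ∑ j ∈ c.support, c i * c j * ∫ x in cell N i, ∫ y in cell N j, K x y := by
  have h1 : ∀ (i : ℤ) (g : ℝ → ℝ) (x : ℝ),
      (cell N i).indicator (1 : ℝ → ℝ) x * g x = (cell N i).indicator g x := by
    intro i g x
    by_cases h : x ∈ cell N i <;> simp [h]
  have h2 : ∀ x, ∫ y, (∑ j ∈ c.support, c j * (cell N j).indicator 1 y) * K x y =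
      ∑ j ∈ c.support, c j * ∫ y in cell N j, K x y := by
    intro x
    simp_rw [Finset.sum_mul, mul_assoc, h1 _ (K x)]
    rw [integral_finsetSum]
    · refine Finset.sum_congr rfl fun j _ => ?_
      rw [integral_const_mul, integral_indicator (measurableSet_cell N j)]
    · intro j _
      exact ((integrable_indicator_iff (measurableSet_cell N j)).2 (hK.integrable_right x N j)).const_mul _
  simp_rw [h2, Finset.sum_mul, mul_assoc]
  have hint : ∀ i, Integrable (fun x => ∑ j ∈ c.support, c j * ∫ y in cell N j, K x y)
      (volume.restrict (cell N i)) := fun i =>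
    integrable_finsetSum _ fun j _ => (hK.integrable_integral_cell N i j).const_mul _
  rw [integral_finsetSum]
  · refine Finset.sum_congr rfl fun i _ => ?_
    simp_rw [h1 i fun x => ∑ j ∈ c.support, c j * ∫ y in cell N j, K x y]
    rw [integral_const_mul, integral_indicator (measurableSet_cell N i), integral_finsetSum _
      fun j _ => (hK.integrable_integral_cell N i j).const_mul _, Finset.mul_sum]
    exact Finset.sum_congr rfl fun j _ => by rw [integral_const_mul]
  · intro i _
    simp_rw [h1 i fun x => ∑ j ∈ c.support, c j * ∫ y in cell N j, K x y]
    exact ((integrable_indicator_iff (measurableSet_cell N i)).2 (hint i)).const_mul _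

omit hK in
theorem integrable_step (c : ℤ →₀ ℝ) (N : ℕ) :
    Integrable (fun x => ∑ i ∈ c.support, c i * (cell N i).indicator (1 : ℝ → ℝ) x) := by
  refine integrable_finsetSum _ fun i _ => Integrable.const_mul ?_ _
  exact (integrable_indicator_iff (measurableSet_cell N i)).2
    (integrable_const (μ := volume.restrict (cell N i)) (1 : ℝ))

omit hK in
theorem step_sq (c : ℤ →₀ ℝ) (N : ℕ) (x : ℝ) :
    (∑ i ∈ c.support, c i * (cell N i).indicator (1 : ℝ → ℝ) x) ^ 2 =
      ∑ i ∈ c.support, c i ^ 2 * (cell N i).indicator (1 : ℝ → ℝ) x := by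
  have h : ∀ g : ℤ → ℝ, ∑ i ∈ c.support, g i * (cell N i).indicator (1 : ℝ → ℝ) x =
      if cellIndex N x ∈ c.support then g (cellIndex N x) else 0 := by
    intro g
    have h1 : ∀ i, g i * (cell N i).indicator (1 : ℝ → ℝ) x =
        if cellIndex N x = i then g i else 0 := by
      intro i
      by_cases hi : cellIndex N x = i
      · rw [Set.indicator_of_mem (mem_cell_iff.2 hi), if_pos hi, Pi.one_apply, mul_one]
      · rw [Set.indicator_of_notMem (mt mem_cell_iff.1 hi), if_neg hi, mul_zero]
    simp_rw [h1]
    rw [Finset.sum_ite_eq]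
  rw [h c, h fun i => c i ^ 2]
  split_ifs <;> simp

omit hK in
theorem integral_step_sq (c : ℤ →₀ ℝ) (N : ℕ) :
    Integrable (fun x => (∑ i ∈ c.support, c i * (cell N i).indicator (1 : ℝ → ℝ) x) ^ 2) ∧
    ∫ x, (∑ i ∈ c.support, c i * (cell N i).indicator (1 : ℝ → ℝ) x) ^ 2 =
      (resolution N)⁻¹ * ∑ i ∈ c.support, c i ^ 2 := by
  simp_rw [step_sq]
  have h : ∀ i, Integrable ((cell N i).indicator (1 : ℝ → ℝ)) := fun i =>
    (integrable_indicator_iff (measurableSet_cell N i)).2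
      (integrable_const (μ := volume.restrict (cell N i)) (1 : ℝ))
  refine ⟨integrable_finsetSum _ fun i _ => (h i).const_mul _, ?_⟩
  rw [integral_finsetSum _ fun i _ => (h i).const_mul _, Finset.mul_sum]
  refine Finset.sum_congr rfl fun i _ => ?_
  rw [integral_const_mul, integral_indicator_one (measurableSet_cell N i), volume_real_cell,
    mul_comm]

theorem isHermitian_cellMatrix (N : ℕ) : (cellMatrix K N).IsHermitian := by
  ext i j
  simp only [cellMatrix, Matrix.conjTranspose_apply, Matrix.of_apply, star_trivial]
  congr 1
  rw [integral_integral_swap]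
  · simp_rw [hK.symm]
  · exact Tup.integrable_of_bound hK.measurable fun p => hK.abs_le _ _

theorem posSemidef_cellMatrix (N : ℕ) : (cellMatrix K N).PosSemidef := by
  refine ⟨hK.isHermitian_cellMatrix N, fun c => ?_⟩
  have h := hK.form_nonneg _ (integrable_step c N) (integral_step_sq c N).1
  rw [hK.integral_step c N] at h
  simp only [Finsupp.sum, star_trivial, cellMatrix, Matrix.of_apply]
  have h2 := mul_nonneg (resolution_pos N).le h
  rw [Finset.mul_sum] at h2
  refine h2.trans_eq (Finset.sum_congr rfl fun i _ => ?_)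
  rw [Finset.mul_sum]
  exact Finset.sum_congr rfl fun j _ => by ring

/-- A step function with values `c` has squared norm `(∑ c²) / resolution N`. The factor `resolution
N` in `cellMatrix` compensates for this, so the bound on the form becomes `M ≤ 1`. -/
theorem posSemidef_one_sub_cellMatrix (N : ℕ) : (1 - cellMatrix K N).PosSemidef := by
  refine ⟨Matrix.isHermitian_one.sub (hK.isHermitian_cellMatrix N), fun c => ?_⟩
  have h := hK.form_le _ (integrable_step c N) (integral_step_sq c N).1
  rw [hK.integral_step c N, (integral_step_sq c N).2] at h
  have h2 := mul_le_mul_of_nonneg_left h (resolution_pos N).le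
  rw [← mul_assoc, mul_inv_cancel₀ (resolution_pos N).ne', one_mul] at h2
  simp only [Finsupp.sum, star_trivial, Matrix.sub_apply, cellMatrix, Matrix.of_apply, mul_sub,
    sub_mul, Finset.sum_sub_distrib, Matrix.one_apply, mul_ite, mul_one, mul_zero, ite_mul, zero_mul]
  rw [sub_nonneg]
  refine le_trans (le_of_eq ?_) (h2.trans (le_of_eq ?_))
  · rw [Finset.mul_sum]
    refine Finset.sum_congr rfl fun i _ => ?_
    rw [Finset.mul_sum]
    exact Finset.sum_congr rfl fun j _ => by ring
  · refine Finset.sum_congr rfl fun i hi => ?_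
    rw [Finset.sum_ite_eq, if_pos hi, sq]

/-- The diagonal entries of the averaged kernel are cell averages of `K`, hence at most `1`. This
bounds all its determinants by `1` uniformly in `N`, as dominated convergence requires. -/
theorem cellMatrix_diag_le (N : ℕ) (i : ℤ) : resolution N * cellMatrix K N i i ≤ 1 := by
  have h : ∀ᵐ x ∂volume.restrict (cell N i), ‖∫ y in cell N i, K x y‖ ≤ (resolution N)⁻¹ :=
    .of_forall fun x => hK.abs_integral_cell_le N i x
  have h2 := norm_integral_le_of_norm_le_const h
  rw [Measure.real, Measure.restrict_apply_univ, volume_cell,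
    ENNReal.toReal_ofReal (inv_nonneg.2 (resolution_pos N).le), Real.norm_eq_abs] at h2
  have h3 := (le_abs_self _).trans h2
  rw [cellMatrix, Matrix.of_apply]
  calc _ ≤ resolution N * (resolution N * ((resolution N)⁻¹ * (resolution N)⁻¹)) := by
        have := (resolution_pos N).le
        gcongr
    _ = 1 := by field_simp [(resolution_pos N).ne']

theorem tendsto_cellKernel (x y : ℝ) :
    Filter.Tendsto (fun N => cellKernel K N x y) Filter.atTop (nhds (K x y)) := by
  rw [Metric.tendsto_atTop]
  intro ε hε
  obtain ⟨δ, hδ, hδK⟩ := Metric.continuousAt_iff.1 (hK.continuous.continuousAt (x := (x, y)))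
    (ε / 2) (by positivity)
  obtain ⟨N₀, hN₀⟩ := exists_nat_gt δ⁻¹
  refine ⟨N₀, fun N hN => ?_⟩
  have hr := resolution_pos N
  have hrδ : (resolution N)⁻¹ < δ := by
    rw [inv_lt_comm₀ hr hδ]
    have : (N₀ : ℝ) ≤ N := by exact_mod_cast hN
    unfold resolution; linarith
  have hclose : ∀ z u, u ∈ cell N (cellIndex N z) → |u - z| < δ := by
    intro z u hu
    have hz : z ∈ cell N (cellIndex N z) := mem_cell_iff.2 rfl
    rw [cell, Set.mem_Ico] at hu hz
    have h1 : ((cellIndex N z : ℝ) + 1) / resolution N =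
      cellIndex N z / resolution N + (resolution N)⁻¹ := by ring
    rw [h1] at hu hz
    rw [abs_lt]; constructor <;> linarith
  have h1 : ∀ u ∈ cell N (cellIndex N x), ∀ v ∈ cell N (cellIndex N y),
      ‖K u v - K x y‖ ≤ ε / 2 := by
    intro u hu v hv
    have h2 : dist (u, v) (x, y) < δ := by
      rw [Prod.dist_eq]; exact max_lt (hclose x u hu) (hclose y v hv)
    exact (hδK h2).le
  have h2 : ∀ u ∈ cell N (cellIndex N x),
      ‖(∫ v in cell N (cellIndex N y), K u v) - K x y * (resolution N)⁻¹‖ ≤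
        ε / 2 * (resolution N)⁻¹ := by
    intro u hu
    have h3 : (∫ v in cell N (cellIndex N y), K u v) - K x y * (resolution N)⁻¹ =
        ∫ v in cell N (cellIndex N y), (K u v - K x y) := by
      rw [integral_sub (hK.integrable_right u N _) (integrable_const _), setIntegral_const,
        volume_real_cell, smul_eq_mul, mul_comm]
    rw [h3, ← volume_real_cell N (cellIndex N y)]
    exact norm_setIntegral_le_of_norm_le_const (by rw [volume_cell]; exact ENNReal.ofReal_lt_top)
      (h1 u hu)
  have h4 : cellKernel K N x y - K x y = resolution N * resolution N *
      ∫ u in cell N (cellIndex N x),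
        ((∫ v in cell N (cellIndex N y), K u v) - K x y * (resolution N)⁻¹) := by
    rw [integral_sub (hK.integrable_integral_cell N _ _) (integrable_const _), setIntegral_const,
      volume_real_cell, smul_eq_mul, cellKernel, cellMatrix, Matrix.of_apply]
    field_simp
  have h5 := norm_setIntegral_le_of_norm_le_const (μ := volume)
    (by rw [volume_cell]; exact ENNReal.ofReal_lt_top) h2
  rw [volume_real_cell] at h5
  rw [Real.dist_eq, h4, abs_mul, abs_of_pos (mul_pos hr hr)]
  calc _ ≤ resolution N * resolution N * (ε / 2 * (resolution N)⁻¹ * (resolution N)⁻¹) := by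
        gcongr; exact h5
    _ = ε / 2 := by field_simp
    _ < ε := by linarith

end IsContractionKernel

/-! ### Kernel determinants and positivity of their Janossy densities. -/

namespace Tup

open scoped Nat

theorem integral_lp {μ : Measure ℝ} {F : Tup → ℝ} (hF : Measurable F) (hint : Integrable F (lp μ)) :
    ∫ s, F s ∂lp μ = ∑' n : ℕ, (n ! : ℝ)⁻¹ * ∫ x, F (mk n x) ∂(Measure.pi fun _ : Fin n => μ) := by
  rw [lp] at hint ⊢
  rw [integral_sum_measure hint]
  refine tsum_congr fun n => ?_
  rw [integral_smul_measure, integral_map (measurable_mk n).aemeasurable hF.aestronglyMeasurable]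
  simp

/-- The determinant of a kernel at the points of a tuple. -/
noncomputable def kernelDet (K : ℝ → ℝ → ℝ) (s : Tup) : ℝ :=
  (Matrix.of fun a b => K (s.2 a) (s.2 b)).det

variable {K : ℝ → ℝ → ℝ}

theorem symmetric_kernelDet : Symmetric (kernelDet K) := by
  rintro s t ⟨e, he⟩
  rw [kernelDet, kernelDet, ← Matrix.det_submatrix_equiv_self e]
  congr 1
  ext a b
  simp [he]

theorem kernelDet_nil : kernelDet K nil = 1 := by
  rw [kernelDet]
  exact Matrix.det_isEmpty (n := Fin 0)

theorem kernelDet_of_not_injective {s : Tup} (h : ¬ Function.Injective s.2) :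
    kernelDet K s = 0 := by
  simp only [Function.Injective, not_forall] at h
  obtain ⟨a, b, hab, hne⟩ := h
  refine Matrix.det_zero_of_row_eq hne ?_
  ext j
  simp [hab]

theorem kernelDet_append (s t : Tup) : kernelDet K (s.append t) =
    (Matrix.of fun a b => K (Sum.elim s.2 t.2 a) (Sum.elim s.2 t.2 b)).det := by
  rw [kernelDet, ← Matrix.det_submatrix_equiv_self (appendEquiv s t)]
  congr 1
  ext a b
  simp [append_appendEquiv]

end Tup

open Tup

theorem measurable_kernelDet_cellKernel (K : ℝ → ℝ → ℝ) (N : ℕ) :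
    Measurable (kernelDet (cellKernel K N)) := by
  refine measurable_of_mk fun n => ?_
  have h : Measurable fun i : Fin n → ℤ => (Matrix.of fun a b =>
      resolution N * cellMatrix K N (i a) (i b)).det := measurable_of_countable _
  exact h.comp (measurable_pi_iff.2 fun a => (measurable_cellIndex N).comp (measurable_pi_apply a))

namespace IsContractionKernel

variable {K : ℝ → ℝ → ℝ} (hK : IsContractionKernel K)
include hK

theorem posSemidef_cellKernel (N : ℕ) {ι : Type*} (x : ι → ℝ) :
    (Matrix.of fun a b => cellKernel K N (x a) (x b)).PosSemidef :=
  ((hK.posSemidef_cellMatrix N).smul (resolution_pos N).le).submatrix fun a => cellIndex N (x a)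

theorem kernelDet_cellKernel_mem (N : ℕ) (s : Tup) :
    0 ≤ kernelDet (cellKernel K N) s ∧ kernelDet (cellKernel K N) s ≤ 1 :=
  ⟨(hK.posSemidef_cellKernel N s.2).det_nonneg,
    (hK.posSemidef_cellKernel N s.2).det_le_one_of_diag_le_one fun _ => hK.cellMatrix_diag_le N _⟩

theorem tendsto_kernelDet (s : Tup) : Filter.Tendsto (fun N => kernelDet (cellKernel K N) s)
    Filter.atTop (nhds (kernelDet K s)) := by
  have h : Continuous fun M : Matrix (Fin s.1) (Fin s.1) ℝ => M.det := by fun_prop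
  refine (h.tendsto _).comp ?_
  refine tendsto_pi_nhds.2 fun a => tendsto_pi_nhds.2 fun b => ?_
  exact hK.tendsto_cellKernel _ _

theorem kernelDet_mem (s : Tup) : 0 ≤ kernelDet K s ∧ kernelDet K s ≤ 1 :=
  ⟨ge_of_tendsto' (hK.tendsto_kernelDet s) fun N => (hK.kernelDet_cellKernel_mem N s).1,
    le_of_tendsto' (hK.tendsto_kernelDet s) fun N => (hK.kernelDet_cellKernel_mem N s).2⟩

theorem continuous_kernelDet (n : ℕ) : Continuous fun x : Fin n → ℝ => kernelDet K ⟨n, x⟩ := by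
  have h : Continuous fun x : Fin n → ℝ => (Matrix.of fun a b => K (x a) (x b)) :=
    continuous_matrix fun a b => by
      have h2 : Continuous fun x : Fin n → ℝ => (x a, x b) := by fun_prop
      exact hK.continuous.comp h2
  exact h.matrix_det

theorem isCorrelation : IsCorrelation (kernelDet K) where
  measurable := measurable_of_mk fun n => (hK.continuous_kernelDet n).measurable
  symmetric := symmetric_kernelDet
  abs_le s := by
    rw [abs_of_nonneg (hK.kernelDet_mem s).1]; exact (hK.kernelDet_mem s).2

theorem isCorrelation_cellKernel (N : ℕ) : IsCorrelation (kernelDet (cellKernel K N)) where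
  measurable := measurable_kernelDet_cellKernel K N
  symmetric := symmetric_kernelDet
  abs_le s := by
    rw [abs_of_nonneg (hK.kernelDet_cellKernel_mem N s).1]; exact (hK.kernelDet_cellKernel_mem N s).2

end IsContractionKernel

/-- The cells that make up a window. -/
noncomputable def windowCells (N m : ℕ) : Finset ℤ := Finset.Ico (-(m * (N + 1) : ℤ)) (m * (N + 1))

/-- The resolution is an integer, so the endpoints of a window are endpoints of cells and every
window is an exact union of cells. -/
theorem cellIndex_mem_windowCells {N m : ℕ} {x : ℝ} :
    cellIndex N x ∈ windowCells N m ↔ x ∈ window m := by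
  have hr := resolution_pos N
  rw [windowCells, Finset.mem_Ico, cellIndex, Int.le_floor, Int.floor_lt, window, Set.mem_Ico]
  have h1 : ((m * (N + 1) : ℤ) : ℝ) = m * resolution N := by
    rw [resolution]; push_cast; ring
  rw [Int.cast_neg, h1, ← neg_mul, mul_le_mul_iff_left₀ hr, mul_lt_mul_iff_left₀ hr]

/-- The image of Lebesgue measure on the window under the cell index is counting measure on the
cells of the window, scaled by the cell length. -/
theorem integral_pi_cellIndex (N m k : ℕ) (g : (Fin k → ℤ) → ℝ) :
    ∫ x, g (fun a => cellIndex N (x a)) ∂(Measure.pi fun _ : Fin k => windowMeasure m) =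
      ((resolution N)⁻¹) ^ k * ∑ i ∈ Fintype.piFinset fun _ : Fin k => windowCells N m, g i := by
  have hmeas : Measurable fun x : Fin k → ℝ => fun a => cellIndex N (x a) :=
    measurable_pi_iff.2 fun a => (measurable_cellIndex N).comp (measurable_pi_apply a)
  set m' := (Measure.pi fun _ : Fin k => windowMeasure m).map fun x => fun a => cellIndex N (x a)
    with hm'
  rw [← integral_map (φ := fun x : Fin k → ℝ => fun a => cellIndex N (x a)) (f := g)
    hmeas.aemeasurable (measurable_of_countable g).aestronglyMeasurable, ← hm']
  have hfin : IsFiniteMeasure m' := by rw [hm']; infer_instance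
  have h1 : m'.restrict (Fintype.piFinset fun _ : Fin k => windowCells N m) = m' := by
    refine Measure.restrict_eq_self_of_ae_mem ?_
    rw [hm', ae_map_iff hmeas.aemeasurable (Set.to_countable _).measurableSet]
    have h2 : ∀ᵐ x ∂(Measure.pi fun _ : Fin k => windowMeasure m), ∀ a, x a ∈ window m := by
      rw [ae_all_iff]
      intro a
      exact (Measure.quasiMeasurePreserving_eval (fun _ : Fin k => windowMeasure m) a).ae
        (ae_restrict_mem (measurableSet_window m))
    filter_upwards [h2] with x hx
    rw [Finset.mem_coe, Fintype.mem_piFinset]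
    exact fun a => cellIndex_mem_windowCells.2 (hx a)
  rw [← h1, setIntegral_finset _ (IntegrableOn.finset), Finset.mul_sum]
  refine Finset.sum_congr rfl fun i hi => ?_
  rw [Fintype.mem_piFinset] at hi
  have h3 : m' {i} = ENNReal.ofReal (resolution N)⁻¹ ^ k := by
    rw [hm', Measure.map_apply hmeas (measurableSet_singleton i)]
    have h4 : (fun x : Fin k → ℝ => fun a => cellIndex N (x a)) ⁻¹' {i} =
        Set.pi Set.univ fun a => cell N (i a) := by
      ext x
      simp [funext_iff, mem_cell_iff]
    rw [h4, Measure.pi_pi]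
    have h5 : ∀ a, windowMeasure m (cell N (i a)) = ENNReal.ofReal (resolution N)⁻¹ := by
      intro a
      rw [windowMeasure, Measure.restrict_apply (measurableSet_cell N _), Set.inter_eq_left.2,
        volume_cell]
      intro x hx
      exact cellIndex_mem_windowCells.1 (mem_cell_iff.1 hx ▸ hi a)
    simp [h5]
  rw [Measure.real, h3, ENNReal.toReal_pow, ENNReal.toReal_ofReal
    (inv_nonneg.2 (resolution_pos N).le), smul_eq_mul]

open Classical in
/-- The sum of the bordered minors of `M` over words in `Z` is a sum over words in any finite set
that contains `Z`, provided that the new letters are border indices. -/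
theorem Matrix.sum_det_submatrix_attach {n : ℕ} (M : Matrix ℤ ℤ ℝ) (σ : Fin n → ℤ) (Z : Finset ℤ)
    (k : ℕ) :
    ∑ i : Fin k → (Finset.univ.image σ ∪ Z : Finset ℤ),
      (M.submatrix (Sum.elim σ fun a => (i a : ℤ)) (Sum.elim σ fun a => (i a : ℤ))).det =
      ∑ i ∈ Fintype.piFinset fun _ : Fin k => Z,
        (M.submatrix (Sum.elim σ i) (Sum.elim σ i)).det := by
  set T : Finset ℤ := Finset.univ.image σ ∪ Z with hT
  refine (Finset.sum_of_injOn (t := Fintype.piFinset fun _ : Fin k => T)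
    (g := fun i => (M.submatrix (Sum.elim σ i) (Sum.elim σ i)).det)
    (fun i : Fin k → T => fun a => (i a : ℤ)) ?_ ?_ ?_ ?_).trans ?_
  · intro i _ j _ hij
    funext a
    exact Subtype.ext (congrFun hij a)
  · intro i _
    simp only [Finset.mem_coe, Fintype.mem_piFinset]
    exact fun a => (i a).2
  · intro i hi hi'
    rw [Fintype.mem_piFinset] at hi
    exact absurd ⟨fun a => ⟨i a, hi a⟩, by simp, rfl⟩ hi'
  · exact fun i _ => rfl
  · symm
    refine Finset.sum_subset (Fintype.piFinset_subset _ _ fun _ => Finset.subset_union_right) ?_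
    intro i hi hi'
    rw [Fintype.mem_piFinset] at hi hi'
    push Not at hi'
    obtain ⟨a, ha⟩ := hi'
    have h1 : i a ∈ Finset.univ.image σ := (Finset.mem_union.1 (hi a)).resolve_right ha
    obtain ⟨b, -, hb⟩ := Finset.mem_image.1 h1
    refine Matrix.det_zero_of_row_eq (i := Sum.inl b) (j := Sum.inr a) (by simp) ?_
    ext c
    simp [hb]

/-- The points behind `σ` may lie outside the window, so the matrix is restricted to the finite set
of indices in `σ` or `Z`. The letters added to `Z` in this way repeat a border row and give zero
minors. -/
theorem Matrix.tsum_neg_one_pow_piFinset_nonneg {n : ℕ} {M : Matrix ℤ ℤ ℝ} (hM : M.PosSemidef)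
    (hM1 : (1 - M).PosSemidef) (σ : Fin n → ℤ) (Z : Finset ℤ) :
    0 ≤ ∑' k : ℕ, (-1) ^ k / (k.factorial : ℝ) * ∑ i ∈ Fintype.piFinset fun _ : Fin k => Z,
      (M.submatrix (Sum.elim σ i) (Sum.elim σ i)).det := by
  simp_rw [← Matrix.sum_det_submatrix_attach M σ Z]
  let x : Fin n → (Finset.univ.image σ ∪ Z : Finset ℤ) := fun a =>
    ⟨σ a, Finset.mem_union_left _ (Finset.mem_image_of_mem _ (Finset.mem_univ a))⟩
  have h1 := hM1.submatrix (Subtype.val : (Finset.univ.image σ ∪ Z : Finset ℤ) → ℤ)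
  rw [Matrix.submatrix_sub, Pi.sub_apply, Pi.sub_apply,
    Matrix.submatrix_one _ Subtype.val_injective] at h1
  refine (Matrix.tsum_neg_one_pow_det_nonneg (hM.submatrix _) h1 x).trans_eq ?_
  refine tsum_congr fun k => ?_
  congr 1
  refine Finset.sum_congr rfl fun i _ => ?_
  congr 1
  ext a b
  rcases a with a | a <;> rcases b with b | b <;> rfl

theorem kernelDet_cellKernel_append (K : ℝ → ℝ → ℝ) (N : ℕ) (s : Tup) (k : ℕ) (z : Fin k → ℝ) :
    kernelDet (cellKernel K N) (s.append (Tup.mk k z)) =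
      resolution N ^ (s.1 + k) * ((cellMatrix K N).submatrix
        (Sum.elim (fun a => cellIndex N (s.2 a)) fun a => cellIndex N (z a))
        (Sum.elim (fun a => cellIndex N (s.2 a)) fun a => cellIndex N (z a))).det := by
  rw [kernelDet_append]
  have h : (Matrix.of fun a b => cellKernel K N (Sum.elim s.2 (Tup.mk k z).2 a)
      (Sum.elim s.2 (Tup.mk k z).2 b)) = resolution N • ((cellMatrix K N).submatrix
        (Sum.elim (fun a => cellIndex N (s.2 a)) fun a => cellIndex N (z a))
        (Sum.elim (fun a => cellIndex N (s.2 a)) fun a => cellIndex N (z a))) := by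
    ext a b
    rcases a with a | a <;> rcases b with b | b <;> rfl
  have hc : Fintype.card (Fin s.1 ⊕ Fin k) = s.1 + k := by simp
  rw [h, ← hc]
  exact Matrix.det_smul _ _

namespace IsContractionKernel

variable {K : ℝ → ℝ → ℝ} (hK : IsContractionKernel K)
include hK

/-- Each determinant scales as `r ^ (s.1 + k)` and each integral over `k` cells as `r⁻¹ ^ k`. What
remains is `r ^ s.1` times the discrete alternating sum of minors. -/
theorem janossy_cellKernel_nonneg (N m : ℕ) (s : Tup) :
    0 ≤ janossy (kernelDet (cellKernel K N)) (windowMeasure m) s := by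
  set r := resolution N with hr
  have hrpos : 0 < r := resolution_pos N
  set M := cellMatrix K N with hM
  have hD := hK.isCorrelation_cellKernel N
  set σ : Fin s.1 → ℤ := fun a => cellIndex N (s.2 a) with hσ
  set Z := windowCells N m with hZ
  have hpos := Matrix.tsum_neg_one_pow_piFinset_nonneg (hK.posSemidef_cellMatrix N)
    (hK.posSemidef_one_sub_cellMatrix N) σ Z
  have hterm : ∀ k : ℕ, ∫ z, (-1) ^ k * kernelDet (cellKernel K N) (s.append (Tup.mk k z))
      ∂(Measure.pi fun _ : Fin k => windowMeasure m) =
      r ^ s.1 * ((-1) ^ k * ∑ i ∈ Fintype.piFinset fun _ : Fin k => Z,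
        (M.submatrix (Sum.elim σ i) (Sum.elim σ i)).det) := by
    intro k
    have h1 := fun z => kernelDet_cellKernel_append K N s k z
    simp_rw [h1]
    rw [integral_const_mul, integral_const_mul]
    rw [integral_pi_cellIndex N m k fun i => (M.submatrix (Sum.elim σ i) (Sum.elim σ i)).det,
      pow_add]
    have h3 : r ^ k * ((resolution N)⁻¹) ^ k = 1 := by
      rw [← hr, ← mul_pow, mul_inv_cancel₀ hrpos.ne', one_pow]
    linear_combination ((-1) ^ k * r ^ s.1 * ∑ i ∈ Fintype.piFinset fun _ : Fin k => Z,
        (M.submatrix (Sum.elim σ i) (Sum.elim σ i)).det) * h3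
  rw [janossy, integral_lp (show Measurable fun z : Tup => (-1 : ℝ) ^ z.1 *
    kernelDet (cellKernel K N) (s.append z) from measurable_neg_one_pow.mul (hD.measurable.comp
    (measurable_append_comp measurable_const measurable_id))) (hD.integrable_janossy s)]
  have h4 : ∀ k : ℕ, ((k.factorial : ℝ))⁻¹ * ∫ z, (-1) ^ (Tup.mk k z).1 *
      kernelDet (cellKernel K N) (s.append (Tup.mk k z))
      ∂(Measure.pi fun _ : Fin k => windowMeasure m) =
      r ^ s.1 * ((-1) ^ k / (k.factorial : ℝ) * ∑ i ∈ Fintype.piFinset fun _ : Fin k => Z,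
        (M.submatrix (Sum.elim σ i) (Sum.elim σ i)).det) := by
    intro k
    have h5 := hterm k
    change (k.factorial : ℝ)⁻¹ * ∫ z, (-1) ^ k * _ ∂_ = _
    rw [h5]
    ring
  refine (mul_nonneg (pow_nonneg hrpos.le s.1) hpos).trans_eq ?_
  rw [← tsum_mul_left]
  exact tsum_congr fun k => (h4 k).symm

theorem janossy_nonneg (m : ℕ) (s : Tup) : 0 ≤ janossy (kernelDet K) (windowMeasure m) s := by
  have h : Filter.Tendsto (fun N => janossy (kernelDet (cellKernel K N)) (windowMeasure m) s)
      Filter.atTop (nhds (janossy (kernelDet K) (windowMeasure m) s)) := by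
    refine tendsto_integral_of_dominated_convergence (fun _ => 1) (fun N => ?_)
      (integrable_const _) (fun N => .of_forall fun z => ?_) (.of_forall fun z => ?_)
    · exact ((hK.isCorrelation_cellKernel N).integrable_janossy s).aestronglyMeasurable
    · rw [Real.norm_eq_abs, abs_neg_one_pow_mul]
      exact (hK.isCorrelation_cellKernel N).abs_le _
    · exact (hK.tendsto_kernelDet _).const_mul _
  exact ge_of_tendsto' h fun N => hK.janossy_cellKernel_nonneg N m s

theorem generates : GeneratesFermionProcess K := by
  obtain ⟨P, hP, h⟩ := hK.isCorrelation.exists_process kernelDet_nil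
    (fun s hs => kernelDet_of_not_injective hs) hK.janossy_nonneg
  refine ⟨P, hP, fun n => ⟨(hK.continuous_kernelDet n).measurable, fun x => ?_, fun B hB => h n B hB⟩⟩
  exact (hK.kernelDet_mem ⟨n, x⟩).1

end IsContractionKernel

/-! ### Cosine and sine transforms, quadratic forms and Plancherel's inequality. -/

/-- The cosine transform. -/
noncomputable def cosTransform (f : ℝ → ℝ) (t : ℝ) : ℝ := ∫ x, f x * Real.cos (t * x)

/-- The sine transform. -/
noncomputable def sinTransform (f : ℝ → ℝ) (t : ℝ) : ℝ := ∫ x, f x * Real.sin (t * x)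

section

variable {f : ℝ → ℝ} (hf : Integrable f)
include hf

theorem integrable_mul_cos (t : ℝ) : Integrable fun x => f x * Real.cos (t * x) :=
  hf.mul_bdd (c := 1) (by fun_prop) (.of_forall fun x => Real.abs_cos_le_one _)

theorem integrable_mul_sin (t : ℝ) : Integrable fun x => f x * Real.sin (t * x) :=
  hf.mul_bdd (c := 1) (by fun_prop) (.of_forall fun x => Real.abs_sin_le_one _)

theorem continuous_cosTransform : Continuous (cosTransform f) := by
  refine continuous_of_dominated (bound := fun x => ‖f x‖)
    (fun t => (integrable_mul_cos hf t).aestronglyMeasurable) (fun t => .of_forall fun x => ?_)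
    hf.norm (.of_forall fun x => by fun_prop)
  rw [norm_mul]
  exact mul_le_of_le_one_right (norm_nonneg _) (Real.abs_cos_le_one _)

theorem continuous_sinTransform : Continuous (sinTransform f) := by
  refine continuous_of_dominated (bound := fun x => ‖f x‖)
    (fun t => (integrable_mul_sin hf t).aestronglyMeasurable) (fun t => .of_forall fun x => ?_)
    hf.norm (.of_forall fun x => by fun_prop)
  rw [norm_mul]
  exact mul_le_of_le_one_right (norm_nonneg _) (Real.abs_sin_le_one _)

theorem abs_cosTransform_le (t : ℝ) : |cosTransform f t| ≤ ∫ x, |f x| := by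
  rw [← Real.norm_eq_abs]
  refine norm_integral_le_of_norm_le hf.norm (.of_forall fun x => ?_)
  rw [norm_mul]
  exact mul_le_of_le_one_right (norm_nonneg _) (Real.abs_cos_le_one _)

theorem abs_sinTransform_le (t : ℝ) : |sinTransform f t| ≤ ∫ x, |f x| := by
  rw [← Real.norm_eq_abs]
  refine norm_integral_le_of_norm_le hf.norm (.of_forall fun x => ?_)
  rw [norm_mul]
  exact mul_le_of_le_one_right (norm_nonneg _) (Real.abs_sin_le_one _)

theorem integrable_mul_cosTransform_sq_add {φ : ℝ → ℝ} (hφ : Integrable φ) :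
    Integrable fun t => φ t * (cosTransform f t ^ 2 + sinTransform f t ^ 2) := by
  refine hφ.mul_bdd (c := (∫ x, |f x|) ^ 2 + (∫ x, |f x|) ^ 2) ?_ (.of_forall fun t => ?_)
  · have := continuous_cosTransform hf
    have := continuous_sinTransform hf
    exact (by fun_prop : Continuous _).aestronglyMeasurable
  · rw [Real.norm_of_nonneg (by positivity), ← sq_abs (cosTransform f t),
      ← sq_abs (sinTransform f t)]
    gcongr
    · exact abs_cosTransform_le hf t
    · exact abs_sinTransform_le hf t

theorem integral_mul_cosTransform_sub {φ : ℝ → ℝ} (hφ : Integrable φ) (x : ℝ) :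
    ∫ y, f y * cosTransform φ (x - y) = ∫ t, φ t *
      (Real.cos (t * x) * cosTransform f t + Real.sin (t * x) * sinTransform f t) := by
  have h1 : ∀ y, f y * cosTransform φ (x - y) = ∫ t, f y * φ t * Real.cos ((x - y) * t) := by
    intro y
    rw [cosTransform, ← integral_const_mul]
    simp only [mul_assoc]
  simp_rw [h1]
  rw [integral_integral_swap]
  · refine integral_congr_ae (.of_forall fun t => ?_)
    have h2 : ∀ y, f y * φ t * Real.cos ((x - y) * t) = φ t * Real.cos (t * x) *
        (f y * Real.cos (t * y)) + φ t * Real.sin (t * x) * (f y * Real.sin (t * y)) := by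
      intro y
      rw [sub_mul, Real.cos_sub, mul_comm x, mul_comm y]
      ring
    simp only [h2]
    rw [integral_add ((integrable_mul_cos hf t).const_mul _) ((integrable_mul_sin hf t).const_mul _),
      integral_const_mul, integral_const_mul, cosTransform, sinTransform]
    ring
  · refine (hf.mul_prod hφ).mul_bdd (c := 1) ?_ (.of_forall fun p => Real.abs_cos_le_one _)
    exact (by fun_prop : Continuous fun p : ℝ × ℝ => Real.cos ((x - p.1) * p.2)).aestronglyMeasurable

/-- The quadratic form of a convolution kernel in terms of the transform of the kernel. -/
theorem integral_mul_integral_mul_cosTransform_sub {φ : ℝ → ℝ} (hφ : Integrable φ) :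
    ∫ x, f x * ∫ y, f y * cosTransform φ (x - y) =
      ∫ t, φ t * (cosTransform f t ^ 2 + sinTransform f t ^ 2) := by
  have hC := continuous_cosTransform hf
  have hS := continuous_sinTransform hf
  have h1 : ∀ x, f x * ∫ y, f y * cosTransform φ (x - y) = ∫ t, f x * φ t *
      (Real.cos (t * x) * cosTransform f t + Real.sin (t * x) * sinTransform f t) := by
    intro x
    rw [integral_mul_cosTransform_sub hf hφ, ← integral_const_mul]
    simp only [mul_assoc]
  simp_rw [h1]
  rw [integral_integral_swap]
  · refine integral_congr_ae (.of_forall fun t => ?_)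
    have h2 : ∀ x, f x * φ t *
        (Real.cos (t * x) * cosTransform f t + Real.sin (t * x) * sinTransform f t) =
        φ t * cosTransform f t * (f x * Real.cos (t * x)) +
          φ t * sinTransform f t * (f x * Real.sin (t * x)) := fun x => by ring
    simp only [h2]
    rw [integral_add ((integrable_mul_cos hf t).const_mul _) ((integrable_mul_sin hf t).const_mul _),
      integral_const_mul, integral_const_mul, ← cosTransform, ← sinTransform]
    ring
  · refine (hf.mul_prod hφ).mul_bdd (c := (∫ x, |f x|) + ∫ x, |f x|) ?_ (.of_forall fun p => ?_)
    · exact (by fun_prop : Continuous fun p : ℝ × ℝ => Real.cos (p.2 * p.1) * cosTransform f p.2 +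
        Real.sin (p.2 * p.1) * sinTransform f p.2).aestronglyMeasurable
    · refine (norm_add_le _ _).trans (add_le_add ?_ ?_)
      · rw [norm_mul]
        exact (mul_le_of_le_one_left (norm_nonneg _) (Real.abs_cos_le_one _)).trans
          (abs_cosTransform_le hf _)
      · rw [norm_mul]
        exact (mul_le_of_le_one_left (norm_nonneg _) (Real.abs_sin_le_one _)).trans
          (abs_sinTransform_le hf _)

/-- Schur's test for a convolution kernel. -/
theorem integral_mul_integral_mul_sub_le (hf2 : Integrable fun x => f x ^ 2) {g : ℝ → ℝ}
    (hg : Integrable g) (hg0 : ∀ x, 0 ≤ g x) (heven : ∀ x, g (-x) = g x) :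
    ∫ x, f x * ∫ y, f y * g (x - y) ≤ (∫ x, g x) * ∫ x, f x ^ 2 := by
  have hmp := measurePreserving_sub_prod (volume : Measure ℝ) (volume : Measure ℝ)
  have hI0 : Integrable (fun p : ℝ × ℝ => g p.1 * f p.2 ^ 2) (volume.prod volume) :=
    hg.mul_prod hf2
  have hI1 : Integrable (fun p : ℝ × ℝ => g (p.1 - p.2) * f p.2 ^ 2) (volume.prod volume) :=
    (hmp.integrable_comp hI0.aestronglyMeasurable).2 hI0
  have hsymm : ∀ x y, g (y - x) = g (x - y) := fun x y => by rw [← heven, neg_sub]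
  have hI2 : Integrable (fun p : ℝ × ℝ => g (p.1 - p.2) * f p.1 ^ 2) (volume.prod volume) := by
    have h := hI1.swap
    refine h.congr (.of_forall fun p => ?_)
    simp [hsymm p.1 p.2]
  have hv1 : ∫ p : ℝ × ℝ, g (p.1 - p.2) * f p.2 ^ 2 ∂(volume.prod volume) =
      (∫ x, g x) * ∫ x, f x ^ 2 := by
    have h := integral_map (μ := volume.prod volume) hmp.aemeasurable
      (f := fun p : ℝ × ℝ => g p.1 * f p.2 ^ 2) (by rw [hmp.map_eq]; exact hI0.aestronglyMeasurable)
    rw [← integral_prod_mul, ← h, hmp.map_eq]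
  have hv2 : ∫ p : ℝ × ℝ, g (p.1 - p.2) * f p.1 ^ 2 ∂(volume.prod volume) =
      (∫ x, g x) * ∫ x, f x ^ 2 := by
    rw [← hv1, ← integral_prod_swap]
    refine integral_congr_ae (.of_forall fun p => ?_)
    simp [hsymm p.1 p.2]
  -- From `2 |f x| |f y| ≤ f x ^ 2 + f y ^ 2`.
  have hle : ∀ p : ℝ × ℝ, |f p.1 * (f p.2 * g (p.1 - p.2))| ≤
      (g (p.1 - p.2) * f p.2 ^ 2 + g (p.1 - p.2) * f p.1 ^ 2) / 2 := by
    intro p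
    rw [← mul_assoc, abs_mul, abs_of_nonneg (hg0 _), abs_mul]
    rw [← sq_abs (f p.1), ← sq_abs (f p.2)]
    linarith [mul_nonneg (hg0 (p.1 - p.2)) (sq_nonneg (|f p.1| - |f p.2|))]
  have hI : Integrable (fun p : ℝ × ℝ => f p.1 * (f p.2 * g (p.1 - p.2)))
      (volume.prod volume) := by
    refine ((hI1.add hI2).div_const 2).mono' ?_ (.of_forall hle)
    have h1 : AEStronglyMeasurable (fun p : ℝ × ℝ => g (p.1 - p.2)) (volume.prod volume) :=
      hg.aestronglyMeasurable.comp_quasiMeasurePreserving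
        (Measure.quasiMeasurePreserving_fst.comp hmp.quasiMeasurePreserving)
    exact hf.aestronglyMeasurable.comp_fst.mul (hf.aestronglyMeasurable.comp_snd.mul h1)
  have hv : ∫ x, f x * ∫ y, f y * g (x - y) =
      ∫ p : ℝ × ℝ, f p.1 * (f p.2 * g (p.1 - p.2)) ∂(volume.prod volume) := by
    rw [integral_prod _ hI]
    simp only [integral_const_mul]
  rw [hv]
  refine (integral_mono hI ((hI1.add hI2).div_const 2) fun p =>
    (le_abs_self _).trans (hle p)).trans_eq ?_
  rw [integral_div]
  simp only [Pi.add_apply]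
  rw [integral_add hI1 hI2, hv1, hv2, add_self_div_two]

end

theorem cosTransform_gaussian {δ : ℝ} (hδ : 0 < δ) (x : ℝ) :
    cosTransform (fun t => Real.exp (-δ * t ^ 2)) x =
      √(Real.pi / δ) * Real.exp (-(4 * δ)⁻¹ * x ^ 2) := by
  have h := fourierIntegral_gaussian (b := (δ : ℂ)) (by simpa using hδ) (x : ℂ)
  have h1 : (∫ t : ℝ, Complex.exp (Complex.I * x * t) * Complex.exp (-δ * t ^ 2)).re =
      cosTransform (fun t => Real.exp (-δ * t ^ 2)) x := by
    have hint : Integrable fun t : ℝ => Complex.exp (Complex.I * x * t) *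
        Complex.exp (-δ * t ^ 2) := by
      have h2 := (integrable_exp_neg_mul_sq hδ).ofReal (𝕜 := ℂ)
      refine (h2.bdd_mul (c := 1) (f := fun t : ℝ => Complex.exp (Complex.I * x * t))
        (by fun_prop) (.of_forall fun t => ?_)).congr (.of_forall fun t => ?_)
      · rw [Complex.norm_exp]; simp
      · simp
    have h3 := (integral_re hint).symm
    refine h3.trans (integral_congr_ae (.of_forall fun t => ?_))
    have h4 : Complex.exp (-δ * t ^ 2) = (Real.exp (-δ * t ^ 2) : ℝ) := by push_cast; rfl
    have h5 : Complex.I * x * t = ((x * t : ℝ) : ℂ) * Complex.I := by push_cast; ring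
    simp only [h4, h5]
    rw [RCLike.re_eq_complex_re, Complex.re_mul_ofReal, Complex.exp_ofReal_mul_I_re, mul_comm]
  rw [← h1, h]
  have h6 : ((Real.pi : ℂ) / δ) ^ (1 / 2 : ℂ) = (√(Real.pi / δ) : ℝ) := by
    rw [Real.sqrt_eq_rpow, Complex.ofReal_cpow (by positivity)]
    push_cast; rfl
  have h7 : Complex.exp (-(x : ℂ) ^ 2 / (4 * δ)) = (Real.exp (-(4 * δ)⁻¹ * x ^ 2) : ℝ) := by
    push_cast; congr 1; ring
  rw [h6, h7, ← Complex.ofReal_mul, Complex.ofReal_re]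

/-- The Gaussian regularization of Plancherel's inequality. -/
theorem integral_gaussian_mul_cosTransform_sq_add_le {f : ℝ → ℝ} (hf : Integrable f)
    (hf2 : Integrable fun x => f x ^ 2) {δ : ℝ} (hδ : 0 < δ) :
    ∫ t, Real.exp (-δ * t ^ 2) * (cosTransform f t ^ 2 + sinTransform f t ^ 2) ≤
      2 * Real.pi * ∫ x, f x ^ 2 := by
  rw [← integral_mul_integral_mul_cosTransform_sub hf (integrable_exp_neg_mul_sq hδ)]
  simp_rw [cosTransform_gaussian hδ]
  have hδ4 : 0 < (4 * δ)⁻¹ := by positivity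
  refine (integral_mul_integral_mul_sub_le hf hf2 ((integrable_exp_neg_mul_sq hδ4).const_mul _)
    (fun x => by positivity) (fun x => by simp)).trans_eq ?_
  -- The transformed Gaussian has mass `√(π / δ) * √(4 π δ) = 2 π` for every `δ`, so Schur's test
  -- gives a bound free of `δ`.
  rw [integral_const_mul, integral_gaussian, ← Real.sqrt_mul (by positivity)]
  have h : Real.pi / δ * (Real.pi / (4 * δ)⁻¹) = (2 * Real.pi) ^ 2 := by field_simp; ring
  rw [h, Real.sqrt_sq (by positivity)]

/-- A Gaussian weight makes the transform of `f` square integrable, so that `φ` can be replaced by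
its upper bound and the regularized inequality applied. The weight is removed by dominated
convergence, using the integrability of `φ`. -/
theorem integral_mul_cosTransform_sq_add_le {f : ℝ → ℝ} (hf : Integrable f)
    (hf2 : Integrable fun x => f x ^ 2) {φ : ℝ → ℝ} (hφ : Integrable φ) {c : ℝ} (hc : 0 ≤ c)
    (hφc : ∀ t, φ t ≤ c / (2 * Real.pi)) :
    ∫ t, φ t * (cosTransform f t ^ 2 + sinTransform f t ^ 2) ≤ c * ∫ x, f x ^ 2 := by
  have hlim : Filter.Tendsto (fun n : ℕ => ∫ t, Real.exp (-(1 / ((n : ℝ) + 1)) * t ^ 2) * (φ t *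
      (cosTransform f t ^ 2 + sinTransform f t ^ 2))) Filter.atTop
      (nhds (∫ t, φ t * (cosTransform f t ^ 2 + sinTransform f t ^ 2))) := by
    have hI := integrable_mul_cosTransform_sq_add hf hφ
    refine tendsto_integral_of_dominated_convergence _ (fun n => ?_) hI.norm
      (fun n => .of_forall fun t => ?_) (.of_forall fun t => ?_)
    · exact (by fun_prop : Continuous fun t : ℝ =>
        Real.exp (-(1 / ((n : ℝ) + 1)) * t ^ 2)).aestronglyMeasurable.mul hI.aestronglyMeasurable
    · rw [norm_mul, Real.norm_of_nonneg (Real.exp_nonneg _)]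
      refine mul_le_of_le_one_left (norm_nonneg _) (Real.exp_le_one_iff.2 ?_)
      rw [neg_mul]
      exact neg_nonpos.2 (by positivity)
    · have h1 : Filter.Tendsto (fun n : ℕ => Real.exp (-(1 / ((n : ℝ) + 1)) * t ^ 2))
          Filter.atTop (nhds (Real.exp (-0 * t ^ 2))) :=
        (Real.continuous_exp.tendsto _).comp
          ((tendsto_one_div_add_atTop_nhds_zero_nat.neg).mul_const _)
      simpa using h1.mul_const (φ t * (cosTransform f t ^ 2 + sinTransform f t ^ 2))
  refine le_of_tendsto' hlim fun n => ?_
  have hn : (0 : ℝ) < 1 / ((n : ℝ) + 1) := by positivity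
  have h2 := integral_gaussian_mul_cosTransform_sq_add_le hf hf2 hn
  have h3 : ∫ t, Real.exp (-(1 / ((n : ℝ) + 1)) * t ^ 2) * (φ t *
      (cosTransform f t ^ 2 + sinTransform f t ^ 2)) ≤
      ∫ t, c / (2 * Real.pi) * (Real.exp (-(1 / ((n : ℝ) + 1)) * t ^ 2) *
        (cosTransform f t ^ 2 + sinTransform f t ^ 2)) := by
    refine integral_mono ?_ ((integrable_mul_cosTransform_sq_add hf
      (integrable_exp_neg_mul_sq hn)).const_mul _) fun t => ?_
    · refine (integrable_mul_cosTransform_sq_add hf hφ).bdd_mul (c := 1) (by fun_prop)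
        (.of_forall fun t => ?_)
      rw [Real.norm_of_nonneg (Real.exp_nonneg _), Real.exp_le_one_iff, neg_mul]
      exact neg_nonpos.2 (by positivity)
    · have h4 : 0 ≤ Real.exp (-(1 / ((n : ℝ) + 1)) * t ^ 2) *
        (cosTransform f t ^ 2 + sinTransform f t ^ 2) := by positivity
      calc _ = φ t * (Real.exp (-(1 / ((n : ℝ) + 1)) * t ^ 2) *
            (cosTransform f t ^ 2 + sinTransform f t ^ 2)) := by ring
        _ ≤ _ := mul_le_mul_of_nonneg_right (hφc t) h4
  refine h3.trans ?_
  rw [integral_const_mul]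
  refine (mul_le_mul_of_nonneg_left h2 (by positivity)).trans_eq ?_
  field_simp

/-- Convolution with the cosine transform of `φ` is an operator between `0` and `1` if
`0 ≤ φ ≤ 1 / (2 π)`. -/
theorem isContractionKernel_of_cosTransform {K : ℝ → ℝ → ℝ} {φ : ℝ → ℝ} (hφ : Integrable φ)
    (hφ0 : ∀ t, 0 ≤ φ t) (hφ1 : ∀ t, φ t ≤ 1 / (2 * Real.pi))
    (hK : ∀ x y, K x y = cosTransform φ (x - y)) (hone : ∀ x, K x x ≤ 1) :
    IsContractionKernel K where
  continuous := by
    have h : Function.uncurry K = fun p : ℝ × ℝ => cosTransform φ (p.1 - p.2) := by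
      ext p; exact hK p.1 p.2
    rw [h]
    exact (continuous_cosTransform hφ).comp (by fun_prop)
  symm x y := by
    rw [hK, hK, ← neg_sub, cosTransform, cosTransform]
    simp only [neg_mul, Real.cos_neg]
  abs_le x y := by
    rw [hK]
    refine (abs_cosTransform_le hφ _).trans ?_
    -- The value of `K` on the diagonal is the total mass of `φ`, which bounds the transform
    -- everywhere.
    have h := hone 0
    rw [hK, cosTransform] at h
    simpa [abs_of_nonneg (hφ0 _)] using h
  form_nonneg f hf hf2 := by
    simp_rw [hK]
    rw [integral_mul_integral_mul_cosTransform_sub hf hφ]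
    exact integral_nonneg fun t => mul_nonneg (hφ0 t) (by positivity)
  form_le f hf hf2 := by
    simp_rw [hK]
    rw [integral_mul_integral_mul_cosTransform_sub hf hφ]
    simpa using integral_mul_cosTransform_sq_add_le hf hf2 hφ zero_le_one hφ1

/-! ### Limits of contraction kernels, and Fourier inversion for even functions. -/

/-- Contraction kernels are closed under bounded pointwise limits with a continuous limit. -/
theorem IsContractionKernel.of_tendsto {K : ℝ → ℝ → ℝ} {L : ℕ → ℝ → ℝ → ℝ}
    (hL : ∀ᶠ n in Filter.atTop, IsContractionKernel (L n)) (hK : Continuous (Function.uncurry K))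
    (hlim : ∀ x y, Filter.Tendsto (fun n => L n x y) Filter.atTop (nhds (K x y))) :
    IsContractionKernel K := by
  have hform : ∀ f : ℝ → ℝ, Integrable f →
      Filter.Tendsto (fun n => ∫ x, f x * ∫ y, f y * L n x y) Filter.atTop
        (nhds (∫ x, f x * ∫ y, f y * K x y)) := by
    intro f hf
    have hm : ∀ n, IsContractionKernel (L n) → ∀ x,
        Integrable fun y => f y * L n x y := fun n hn x =>
      hf.mul_bdd (c := 1) (hn.measurable.comp measurable_prodMk_left).aestronglyMeasurable
        (.of_forall fun y => hn.abs_le x y)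
    have hle : ∀ n, IsContractionKernel (L n) → ∀ x y, ‖f y * L n x y‖ ≤ ‖f y‖ := by
      intro n hn x y
      rw [norm_mul]
      exact mul_le_of_le_one_right (norm_nonneg _) (hn.abs_le x y)
    refine tendsto_integral_filter_of_dominated_convergence (fun x => ‖f x‖ * ∫ y, ‖f y‖) ?_ ?_
      (hf.norm.mul_const _) (.of_forall fun x => ?_)
    · filter_upwards [hL] with n hn
      refine hf.aestronglyMeasurable.mul ?_
      have h : AEStronglyMeasurable (fun p : ℝ × ℝ => f p.2 * L n p.1 p.2)
          ((volume : Measure ℝ).prod volume) :=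
        hf.aestronglyMeasurable.comp_snd.mul hn.measurable.aestronglyMeasurable
      exact h.integral_prod_right'
    · filter_upwards [hL] with n hn
      refine .of_forall fun x => ?_
      rw [norm_mul]
      exact mul_le_mul_of_nonneg_left (norm_integral_le_of_norm_le hf.norm
        (.of_forall fun y => hle n hn x y)) (norm_nonneg _)
    · refine Filter.Tendsto.const_mul _ ?_
      refine tendsto_integral_filter_of_dominated_convergence (fun y => ‖f y‖) ?_ ?_ hf.norm
        (.of_forall fun y => (hlim x y).const_mul _)
      · filter_upwards [hL] with n hn using (hm n hn x).aestronglyMeasurable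
      · filter_upwards [hL] with n hn using .of_forall fun y => hle n hn x y
  exact
    { continuous := hK
      symm := fun x y => tendsto_nhds_unique (hlim x y) ((hlim y x).congr'
        (by filter_upwards [hL] with n hn using hn.symm y x))
      abs_le := fun x y => le_of_tendsto (hlim x y).abs
        (by filter_upwards [hL] with n hn using hn.abs_le x y)
      form_nonneg := fun f hf hf2 => ge_of_tendsto (hform f hf)
        (by filter_upwards [hL] with n hn using hn.form_nonneg f hf hf2)
      form_le := fun f hf hf2 => le_of_tendsto (hform f hf)
        (by filter_upwards [hL] with n hn using hn.form_le f hf hf2) }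

theorem integrable_exp_neg_mul_abs {c : ℝ} (hc : 0 < c) :
    Integrable fun x : ℝ => Real.exp (-c * |x|) := by
  rw [← integrableOn_univ, ← Set.Iic_union_Ioi (a := (0 : ℝ))]
  refine IntegrableOn.union ?_ ?_
  · refine (integrableOn_exp_mul_Iic hc 0).congr_fun (fun x hx => ?_) measurableSet_Iic
    simp only [abs_of_nonpos (Set.mem_Iic.1 hx)]
    ring_nf
  · refine (integrableOn_exp_mul_Ioi (neg_lt_zero.2 hc) 0).congr_fun (fun x hx => ?_)
      measurableSet_Ioi
    simp only [abs_of_pos (Set.mem_Ioi.1 hx)]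

section

open scoped FourierTransform

theorem sinTransform_eq_zero {f : ℝ → ℝ} (heven : ∀ x, f (-x) = f x) (t : ℝ) :
    sinTransform f t = 0 := by
  have h : sinTransform f t = -sinTransform f t := by
    conv_lhs => rw [sinTransform, ← integral_neg_eq_self]
    rw [sinTransform, ← integral_neg]
    simp [heven]
  linarith

theorem cosTransform_neg (f : ℝ → ℝ) (t : ℝ) : cosTransform f (-t) = cosTransform f t := by
  simp [cosTransform]

theorem fourier_ofReal_of_even {f : ℝ → ℝ} (hf : Integrable f) (heven : ∀ x, f (-x) = f x)
    (w : ℝ) : 𝓕 (fun x => (f x : ℂ)) w = cosTransform f (2 * Real.pi * w) := by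
  rw [Real.fourier_real_eq_integral_exp_smul]
  have h1 : ∀ v : ℝ, Complex.exp (((-2 * Real.pi * v * w : ℝ) : ℂ) * Complex.I) • (f v : ℂ) =
      ((f v * Real.cos (2 * Real.pi * w * v) : ℝ) : ℂ) -
        Complex.I * ((f v * Real.sin (2 * Real.pi * w * v) : ℝ) : ℂ) := by
    intro v
    have h2 : -2 * Real.pi * v * w = -(2 * Real.pi * w * v) := by ring
    rw [Complex.exp_mul_I, ← Complex.ofReal_cos, ← Complex.ofReal_sin, h2, Real.cos_neg,
      Real.sin_neg, smul_eq_mul]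
    push_cast
    ring
  simp_rw [h1]
  rw [integral_sub (integrable_mul_cos hf _).ofReal
    ((integrable_mul_sin hf _).ofReal.const_mul _), integral_const_mul, integral_complex_ofReal,
    integral_complex_ofReal]
  have h3 := sinTransform_eq_zero heven (2 * Real.pi * w)
  rw [sinTransform] at h3
  rw [h3, cosTransform]
  simp

/-- Fourier inversion for the cosine transform. -/
theorem cosTransform_cosTransform_div {f : ℝ → ℝ} (hc : Continuous f) (hf : Integrable f)
    (heven : ∀ x, f (-x) = f x) (hg : Integrable (cosTransform f)) (x : ℝ) :
    cosTransform (fun t => cosTransform f t / (2 * Real.pi)) x = f x := by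
  have h2π : (0 : ℝ) < 2 * Real.pi := by positivity
  have hH : Integrable fun v => cosTransform f (2 * Real.pi * v) := hg.comp_mul_left' h2π.ne'
  have hF : 𝓕 (fun x => (f x : ℂ)) = fun w => ((cosTransform f (2 * Real.pi * w) : ℝ) : ℂ) :=
    funext (fourier_ofReal_of_even hf heven)
  have h := Continuous.fourierInv_fourier_eq (f := fun x => (f x : ℂ))
    (Complex.continuous_ofReal.comp hc) hf.ofReal (by rw [hF]; exact hH.ofReal)
  have hx := congrFun h x
  rw [Real.fourierInv_eq_fourier_neg, hF, fourier_ofReal_of_even hH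
    (fun v => by rw [mul_neg, cosTransform_neg])] at hx
  rw [← Complex.ofReal_inj, ← hx, Complex.ofReal_inj]
  have h3 := Measure.integral_comp_mul_left
    (fun t => cosTransform f t * Real.cos (x * t)) (2 * Real.pi)
  rw [mul_neg, cosTransform_neg]
  have h4 : cosTransform (fun v => cosTransform f (2 * Real.pi * v)) (2 * Real.pi * x) =
      ∫ v, cosTransform f (2 * Real.pi * v) * Real.cos (x * (2 * Real.pi * v)) := by
    rw [cosTransform]
    congr 1 with v
    congr 2
    ring
  rw [h4, h3, abs_of_pos (inv_pos.2 h2π), smul_eq_mul, cosTransform, ← integral_const_mul]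
  congr 1 with v
  ring

end

/-! ### The integral of `sinh (z x) / sinh (B x)`. -/

theorem Complex.norm_cosh_le (w : ℂ) : ‖Complex.cosh w‖ ≤ Real.cosh w.re := by
  rw [Complex.cosh, norm_div, Real.cosh_eq, Complex.norm_ofNat]
  gcongr
  refine (norm_add_le _ _).trans_eq ?_
  simp [Complex.norm_exp]

/-- The mean value inequality on `[0, x]`. The factor `x` keeps the quotient by `sinh (B x)` bounded
near the origin. -/
theorem Complex.norm_sinh_mul_le (z : ℂ) {x : ℝ} (hx : 0 ≤ x) :
    ‖Complex.sinh (z * x)‖ ≤ ‖z‖ * x * Real.exp (|z.re| * x) := by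
  have hd : ∀ s : ℝ, HasDerivAt (fun s : ℝ => Complex.sinh (z * s)) (Complex.cosh (z * s) * z) s := by
    intro s
    have h : HasDerivAt (fun s : ℂ => Complex.sinh (z * s)) (Complex.cosh (z * s) * z) (s : ℂ) := by
      simpa using ((hasDerivAt_id (s : ℂ)).const_mul z).csinh
    exact h.comp_ofReal
  have h := (convex_Icc 0 x).norm_image_sub_le_of_norm_hasDerivWithin_le
    (f := fun s : ℝ => Complex.sinh (z * s)) (C := Real.exp (|z.re| * x) * ‖z‖)
    (fun s _ => (hd s).hasDerivWithinAt) (fun s hs => ?_) (Set.left_mem_Icc.2 hx)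
    (Set.right_mem_Icc.2 hx)
  · simp only [Complex.ofReal_zero, mul_zero, Complex.sinh_zero, sub_zero, Real.norm_eq_abs,
      abs_of_nonneg hx] at h
    linarith
  · rw [norm_mul]
    gcongr
    refine (Complex.norm_cosh_le _).trans ?_
    have h1 : Real.cosh (z * s).re ≤ Real.cosh (|z.re| * x) := by
      rw [Real.cosh_le_cosh, Complex.re_mul_ofReal, abs_mul, abs_mul, abs_abs, abs_of_nonneg hx,
        abs_of_nonneg hs.1]
      exact mul_le_mul_of_nonneg_left hs.2 (abs_nonneg _)
    refine h1.trans ?_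
    rw [Real.cosh_eq]
    have h2 : Real.exp (-(|z.re| * x)) ≤ Real.exp (|z.re| * x) :=
      Real.exp_le_exp.2 (by have := mul_nonneg (abs_nonneg z.re) hx; linarith)
    linarith

/-- Equivalent to `1 + 2 y ≤ exp (2 y)`. It bounds `1 / sinh` both near zero and at infinity, at the
price of a linear factor. -/
theorem Real.mul_exp_le_sinh_mul (y : ℝ) :
    y * Real.exp y ≤ Real.sinh y * (1 + 2 * y) := by
  have h1 : 2 * y + 1 ≤ Real.exp (2 * y) := Real.add_one_le_exp _
  have h2 : Real.exp y = Real.exp (2 * y) * Real.exp (-y) := by rw [← Real.exp_add]; ring_nf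
  rw [Real.sinh_eq]
  have h3 := mul_le_mul_of_nonneg_right h1 (Real.exp_pos (-y)).le
  rw [← h2] at h3
  nlinarith

section

variable {B : ℝ} (hB : 0 < B) {z : ℂ} (hz : |z.re| < B)
include hB hz

theorem exists_norm_sinh_div_sinh_le : ∃ M ε : ℝ, 0 < ε ∧ ∀ x : ℝ, 0 < x →
    ‖Complex.sinh (z * x) / (Real.sinh (B * x) : ℝ)‖ ≤ M * Real.exp (-ε * x) := by
  set c := B - |z.re| with hc
  have hcpos : 0 < c := sub_pos.2 hz
  -- Half of the gap `c` is kept as the decay rate. The other half absorbs the linear factor,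
  -- through `2 B x = (4 B / c) * (c x / 2)`.
  refine ⟨‖z‖ / B * (1 + 4 * B / c), c / 2, by positivity, fun x hx => ?_⟩
  have hBx : 0 < B * x := mul_pos hB hx
  have hsinh : 0 < Real.sinh (B * x) := Real.sinh_pos_iff.2 hBx
  rw [norm_div, Complex.norm_real, Real.norm_of_nonneg hsinh.le, div_le_iff₀ hsinh]
  have h1 := Complex.norm_sinh_mul_le z hx.le
  have h2 := Real.mul_exp_le_sinh_mul (B * x)
  have h3 : 1 + 2 * (B * x) ≤ (1 + 4 * B / c) * Real.exp (c / 2 * x) := by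
    have h4 : c / 2 * x + 1 ≤ Real.exp (c / 2 * x) := Real.add_one_le_exp _
    refine le_trans ?_ (mul_le_mul_of_nonneg_left h4 (by positivity))
    have h5 : (1 + 4 * B / c) * (c / 2 * x + 1) = 1 + 2 * (B * x) + (c / 2 * x + 4 * B / c) := by
      field_simp
      ring
    rw [h5]
    have : 0 ≤ c / 2 * x + 4 * B / c := by positivity
    linarith
  have h6 : Real.exp (|z.re| * x) = Real.exp (B * x) * (Real.exp (-(c / 2) * x) *
      Real.exp (-(c / 2) * x)) := by
    rw [← Real.exp_add, ← Real.exp_add]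
    congr 1
    rw [hc]
    ring
  have h7 : Real.exp (c / 2 * x) * Real.exp (-(c / 2) * x) = 1 := by
    rw [← Real.exp_add]; ring_nf; exact Real.exp_zero
  set E := Real.exp (-(c / 2) * x) with hE
  have hEpos : 0 < E := Real.exp_pos _
  calc ‖Complex.sinh (z * x)‖ ≤ ‖z‖ * x * Real.exp (|z.re| * x) := h1
    _ = ‖z‖ / B * (B * x * Real.exp (B * x)) * (E * E) := by rw [h6]; field_simp
    _ ≤ ‖z‖ / B * (Real.sinh (B * x) * (1 + 2 * (B * x))) * (E * E) := by gcongr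
    _ ≤ ‖z‖ / B * (Real.sinh (B * x) * ((1 + 4 * B / c) * Real.exp (c / 2 * x))) * (E * E) := by
      gcongr
    _ = ‖z‖ / B * (1 + 4 * B / c) * E * Real.sinh (B * x) * (Real.exp (c / 2 * x) * E) := by ring
    _ = _ := by rw [h7, mul_one]

theorem integrableOn_sinh_div_sinh :
    IntegrableOn (fun x : ℝ => Complex.sinh (z * x) / (Real.sinh (B * x) : ℝ)) (Set.Ioi 0) := by
  obtain ⟨M, ε, hε, h⟩ := exists_norm_sinh_div_sinh_le hB hz
  refine Integrable.mono' ((exp_neg_integrableOn_Ioi 0 hε).const_mul M) ?_ ?_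
  · have h1 : Measurable fun x : ℝ => Complex.sinh (z * x) :=
      (by fun_prop : Continuous fun x : ℝ => Complex.sinh (z * x)).measurable
    have h2 : Measurable fun x : ℝ => ((Real.sinh (B * x) : ℝ) : ℂ) :=
      (by fun_prop : Continuous fun x : ℝ => ((Real.sinh (B * x) : ℝ) : ℂ)).measurable
    exact (h1.div h2).aestronglyMeasurable
  · exact (ae_restrict_iff' measurableSet_Ioi).2 (.of_forall fun x hx => h x hx)

omit hB hz in
-- Partial sums of `1 / sinh (B x) = 2 ∑ exp (-(2 n + 1) B x)`, multiplied by `sinh (z x)`. The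
-- closed form shows that they are dominated by their limit when `0 < B` and `0 < x`.
theorem sum_range_exp_sub_exp {x : ℝ} (hBx : 0 < B * x) (N : ℕ) :
    ∑ n ∈ Finset.range N, (Complex.exp (-((2 * n + 1) * B - z) * x) -
      Complex.exp (-((2 * n + 1) * B + z) * x)) =
      Complex.sinh (z * x) / (Real.sinh (B * x) : ℝ) * (1 - Complex.exp (-(2 * N * B) * x)) := by
  have hsinh : ((Real.sinh (B * x) : ℝ) : ℂ) ≠ 0 :=
    Complex.ofReal_ne_zero.2 (Real.sinh_pos_iff.2 hBx).ne'
  induction N with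
  | zero => simp
  | succ N ih =>
    rw [Finset.sum_range_succ, ih]
    have h1 : Complex.exp (-((2 * N + 1) * B - z) * x) =
        Complex.exp (-(2 * N * B) * x) * Complex.exp (-(B * x)) * Complex.exp (z * x) := by
      rw [← Complex.exp_add, ← Complex.exp_add]; ring_nf
    have h2 : Complex.exp (-((2 * N + 1) * B + z) * x) =
        Complex.exp (-(2 * N * B) * x) * Complex.exp (-(B * x)) * Complex.exp (-(z * x)) := by
      rw [← Complex.exp_add, ← Complex.exp_add]; ring_nf
    have h3 : Complex.exp (-(2 * ((N + 1 : ℕ) : ℂ) * B) * x) =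
        Complex.exp (-(2 * N * B) * x) * Complex.exp (-(B * x)) * Complex.exp (-(B * x)) := by
      rw [← Complex.exp_add, ← Complex.exp_add]; push_cast; ring_nf
    have h4 : ((Real.sinh (B * x) : ℝ) : ℂ) =
        (Complex.exp (B * x) - Complex.exp (-(B * x))) / 2 := by
      rw [Complex.ofReal_sinh, Complex.sinh]; push_cast; rfl
    have h5 : Complex.exp (B * x) * Complex.exp (-(B * x)) = 1 := by
      rw [← Complex.exp_add]; simp
    rw [h1, h2, h3]
    have h6 : Complex.exp (z * x) - Complex.exp (-(z * x)) = 2 * Complex.sinh (z * x) := by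
      rw [Complex.sinh]; ring
    rw [← mul_sub, h6]
    generalize Complex.exp (-(2 * N * B) * x) = E
    generalize Complex.exp (-(B * x)) = e at h4 h5 ⊢
    generalize Complex.exp (B * x) = e' at h4 h5
    have h7 : ((Real.sinh (B * x) : ℝ) : ℂ) * (2 * e) = 1 - e * e := by
      rw [h4]; linear_combination h5
    rw [div_mul_eq_mul_div, div_mul_eq_mul_div, div_add' _ _ _ hsinh, div_left_inj' hsinh]
    linear_combination Complex.sinh (z * x) * E * h7

theorem integral_sum_range_exp_sub_exp (N : ℕ) :
    ∫ x in Set.Ioi (0 : ℝ), ∑ n ∈ Finset.range N, (Complex.exp (-((2 * n + 1) * B - z) * x) -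
      Complex.exp (-((2 * n + 1) * B + z) * x)) =
      ∑ n ∈ Finset.range N, (1 / ((2 * n + 1) * B - z) - 1 / ((2 * n + 1) * B + z)) := by
  have hle : ∀ n : ℕ, B ≤ (2 * n + 1) * B := fun n =>
    le_mul_of_one_le_left hB.le (by have : (0 : ℝ) ≤ n := n.cast_nonneg; linarith)
  obtain ⟨hz1, hz2⟩ := abs_lt.1 hz
  have hre : ∀ n : ℕ, ((2 * (n : ℂ) + 1) * B).re = (2 * n + 1) * B := fun n => by simp
  have h1 : ∀ n : ℕ, (-((2 * (n : ℂ) + 1) * B - z)).re < 0 := fun n => by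
    rw [Complex.neg_re, Complex.sub_re, hre]; linarith [hle n]
  have h2 : ∀ n : ℕ, (-((2 * (n : ℂ) + 1) * B + z)).re < 0 := fun n => by
    rw [Complex.neg_re, Complex.add_re, hre]; linarith [hle n]
  rw [integral_finsetSum _ fun (n : ℕ) _ => show Integrable (fun x : ℝ =>
    Complex.exp (-((2 * (n : ℂ) + 1) * B - z) * x) -
      Complex.exp (-((2 * (n : ℂ) + 1) * B + z) * x))
    (volume.restrict (Set.Ioi 0)) from (integrableOn_exp_mul_complex_Ioi (h1 n) 0).sub
    (integrableOn_exp_mul_complex_Ioi (h2 n) 0)]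
  refine Finset.sum_congr rfl fun n _ => ?_
  rw [integral_sub (integrableOn_exp_mul_complex_Ioi (h1 n) 0)
    (integrableOn_exp_mul_complex_Ioi (h2 n) 0), integral_exp_mul_complex_Ioi (h1 n),
    integral_exp_mul_complex_Ioi (h2 n)]
  simp only [Complex.ofReal_zero, mul_zero, Complex.exp_zero, neg_div_neg_eq]

omit hz in
-- With `u = 1 / 2 - z / (2 B)`, the two fractions are `1 / (u + n)` and `-1 / (u - (n + 1))` up to
-- the factor `1 / (2 B)`. The cotangent series pairs `u + (n + 1)` with `u - (n + 1)`, and this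
-- shift by one leaves the two boundary terms.
theorem sum_range_one_div_sub_one_div (N : ℕ) :
    ∑ n ∈ Finset.range N, (1 / ((2 * n + 1) * B - z) - 1 / ((2 * n + 1) * B + z)) =
      1 / (2 * B) * (∑ n ∈ Finset.range N, cotTerm (1 / 2 - z / (2 * B)) n +
        1 / (1 / 2 - z / (2 * B)) - 1 / (1 / 2 - z / (2 * B) + N)) := by
  have hB' : (B : ℂ) ≠ 0 := Complex.ofReal_ne_zero.2 hB.ne'
  induction N with
  | zero => simp
  | succ N ih =>
    rw [Finset.sum_range_succ, ih, Finset.sum_range_succ, cotTerm]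
    have h1 : 1 / ((2 * N + 1) * B - z) = 1 / (2 * B) * (1 / (1 / 2 - z / (2 * B) + N)) := by
      rw [one_div_mul_one_div]
      congr 1
      field_simp
      ring
    have h2 : 1 / ((2 * N + 1) * B + z) =
        -(1 / (2 * B) * (1 / (1 / 2 - z / (2 * B) - (N + 1)))) := by
      rw [one_div_mul_one_div, ← one_div_neg_eq_neg_one_div]
      congr 1
      field_simp
      ring
    rw [h1, h2]
    push_cast
    ring

theorem half_sub_div_mem_integerComplement :
    (1 / 2 - z / (2 * B) : ℂ) ∈ Complex.integerComplement := by
  rw [Complex.mem_integerComplement_iff]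
  rintro ⟨n, hn⟩
  have h := congrArg Complex.re hn
  have h1 : (1 / 2 - z / (2 * B) : ℂ).re = 1 / 2 - z.re / (2 * B) := by
    rw [show (2 * (B : ℂ)) = ((2 * B : ℝ) : ℂ) by push_cast; rfl, Complex.sub_re,
      Complex.div_ofReal_re]
    norm_num
  rw [h1, Complex.intCast_re] at h
  obtain ⟨hz1, hz2⟩ := abs_lt.1 hz
  have h2 : z.re / (2 * B) < 1 / 2 := by rw [div_lt_iff₀ (by positivity)]; linarith
  have h3 : -(1 / 2) < z.re / (2 * B) := by rw [lt_div_iff₀ (by positivity)]; linarith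
  have h4 : (0 : ℝ) < n := by linarith
  have h5 : (n : ℝ) < 1 := by linarith
  have h6 : 0 < n := by exact_mod_cast h4
  have h7 : n < 1 := by exact_mod_cast h5
  omega

/-- The sine transform of the hyperbolic cosecant, at complex frequencies. -/
theorem integral_sinh_div_sinh :
    ∫ x in Set.Ioi (0 : ℝ), Complex.sinh (z * x) / (Real.sinh (B * x) : ℝ) =
      Real.pi / (2 * B) * Complex.tan (Real.pi * z / (2 * B)) := by
  have hB' : (B : ℂ) ≠ 0 := Complex.ofReal_ne_zero.2 hB.ne'
  have hlim1 : Filter.Tendsto (fun N : ℕ => ∫ x in Set.Ioi (0 : ℝ), ∑ n ∈ Finset.range N,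
      (Complex.exp (-((2 * n + 1) * B - z) * x) - Complex.exp (-((2 * n + 1) * B + z) * x)))
      Filter.atTop (nhds (∫ x in Set.Ioi (0 : ℝ),
        Complex.sinh (z * x) / (Real.sinh (B * x) : ℝ))) := by
    refine tendsto_integral_of_dominated_convergence _ (fun N => ?_)
      (integrableOn_sinh_div_sinh hB hz).norm (fun N => ?_) ?_
    · exact (by fun_prop : Continuous fun x : ℝ => ∑ n ∈ Finset.range N,
        (Complex.exp (-((2 * n + 1) * B - z) * x) -
          Complex.exp (-((2 * n + 1) * B + z) * x))).aestronglyMeasurable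
    · refine (ae_restrict_iff' measurableSet_Ioi).2 (.of_forall fun x (hx : 0 < x) => ?_)
      rw [sum_range_exp_sub_exp (mul_pos hB hx), norm_mul]
      refine mul_le_of_le_one_right (norm_nonneg _) ?_
      have h1 : Complex.exp (-(2 * N * B) * x) = (Real.exp (-(2 * N * B) * x) : ℝ) := by
        push_cast; rfl
      have h2 : Real.exp (-(2 * N * B) * x) ≤ 1 := by
        rw [Real.exp_le_one_iff, neg_mul]
        exact neg_nonpos.2 (by positivity)
      rw [h1, ← Complex.ofReal_one, ← Complex.ofReal_sub, Complex.norm_real,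
        Real.norm_of_nonneg (sub_nonneg.2 h2)]
      linarith [Real.exp_pos (-(2 * N * B) * x)]
    · refine (ae_restrict_iff' measurableSet_Ioi).2 (.of_forall fun x (hx : 0 < x) => ?_)
      simp_rw [sum_range_exp_sub_exp (mul_pos hB hx)]
      have h1 : Filter.Tendsto (fun N : ℕ => Complex.exp (-(2 * N * B) * x)) Filter.atTop
          (nhds 0) := by
        have h2 : ∀ N : ℕ, Complex.exp (-(2 * N * B) * x) =
            ((Real.exp (-(2 * B * x)) ^ N : ℝ) : ℂ) := by
          intro N
          rw [← Real.exp_nat_mul]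
          push_cast
          ring_nf
        simp_rw [h2]
        rw [← Complex.ofReal_zero]
        refine (Complex.continuous_ofReal.tendsto 0).comp
          (tendsto_pow_atTop_nhds_zero_of_lt_one (Real.exp_nonneg _) ?_)
        rw [Real.exp_lt_one_iff]
        exact neg_neg_iff_pos.2 (by positivity)
      simpa using (h1.const_sub 1).const_mul (Complex.sinh (z * x) / (Real.sinh (B * x) : ℝ))
  simp_rw [integral_sum_range_exp_sub_exp hB hz, sum_range_one_div_sub_one_div hB] at hlim1
  refine tendsto_nhds_unique hlim1 ?_
  have hu := half_sub_div_mem_integerComplement hB hz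
  have h1 := tendsto_logDeriv_euler_cot_sub hu
  have h2 : Filter.Tendsto (fun N : ℕ => 1 / (1 / 2 - z / (2 * B) + N)) Filter.atTop (nhds 0) := by
    have h6 := Filter.tendsto_inv₀_cobounded.comp ((tendsto_const_add_cobounded
      (1 / 2 - z / (2 * B) : ℂ)).comp (tendsto_natCast_atTop_cobounded (α := ℂ)))
    refine h6.congr fun N => ?_
    simp
  -- The cotangent at the complementary angle is the tangent.
  have h3 : Complex.cot (Real.pi * (1 / 2 - z / (2 * B))) = Complex.tan (Real.pi * z / (2 * B)) := by
    have h4 : (Real.pi : ℂ) * (1 / 2 - z / (2 * B)) = Real.pi / 2 - Real.pi * z / (2 * B) := by ring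
    rw [h4, Complex.cot, Complex.cos_pi_div_two_sub, Complex.sin_pi_div_two_sub, Complex.tan]
  have h5 := ((h1.add_const (1 / (1 / 2 - z / (2 * B)))).sub h2).const_mul (1 / (2 * (B : ℂ)))
  rw [h3] at h5
  convert h5 using 2
  ring

end

/-! ### The hyperbolic quotient kernels and their Fourier transforms. -/

/-- The quotient of two functions with a simple zero of slope `1` at the origin. -/
theorem continuous_ite_div {u v : ℝ → ℝ} (hu : Continuous u) (hv : Continuous v)
    (hu' : HasDerivAt u 1 0) (hv' : HasDerivAt v 1 0) (hu0 : u 0 = 0) (hv0 : v 0 = 0)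
    (hne : ∀ x, x ≠ 0 → v x ≠ 0) : Continuous fun x => if x = 0 then 1 else u x / v x := by
  have hds : ∀ f : ℝ → ℝ, Continuous f → HasDerivAt f 1 0 → Continuous (dslope f 0) := by
    intro f hf hf'
    rw [← continuousOn_univ, continuousOn_dslope Filter.univ_mem]
    exact ⟨hf.continuousOn, hf'.differentiableAt⟩
  have h : (fun x => if x = 0 then 1 else u x / v x) = fun x => dslope u 0 x / dslope v 0 x := by
    ext x
    split_ifs with hx
    · rw [hx, dslope_same, dslope_same, hu'.deriv, hv'.deriv, div_one]
    · rw [dslope_of_ne _ hx, dslope_of_ne _ hx, slope_def_field, slope_def_field, hu0, hv0,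
        sub_zero, sub_zero, sub_zero, div_div_div_cancel_right₀ hx]
  rw [h]
  refine (hds u hu hu').div (hds v hv hv') fun x => ?_
  rcases eq_or_ne x 0 with rfl | hx
  · rw [dslope_same, hv'.deriv]
    exact one_ne_zero
  · rw [dslope_of_ne _ hx, slope_def_field, hv0, sub_zero, sub_zero]
    exact div_ne_zero (hne x hx) hx

theorem hasDerivAt_sinh_mul_div {B : ℝ} (hB : B ≠ 0) :
    HasDerivAt (fun x => Real.sinh (B * x) / B) 1 0 := by
  have h := (((hasDerivAt_id (0 : ℝ)).const_mul B).sinh).div_const B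
  simpa [hB] using h

theorem sinh_mul_div_ne_zero {B x : ℝ} (hB : B ≠ 0) (hx : x ≠ 0) : Real.sinh (B * x) / B ≠ 0 :=
  div_ne_zero (Real.sinh_ne_zero.2 (mul_ne_zero hB hx)) hB

/-- The function `B * u x / sinh (B * x)`, with the value `1` at the origin. -/
noncomputable def shQuotient (u : ℝ → ℝ) (B : ℝ) (x : ℝ) : ℝ :=
  if x = 0 then 1 else B * u x / Real.sinh (B * x)

theorem continuous_shQuotient {u : ℝ → ℝ} {B : ℝ} (hB : B ≠ 0) (hu : Continuous u)
    (hu' : HasDerivAt u 1 0) (hu0 : u 0 = 0) : Continuous (shQuotient u B) := by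
  refine (continuous_ite_div hu (v := fun x => Real.sinh (B * x) / B) (by fun_prop) hu'
    (hasDerivAt_sinh_mul_div hB) hu0 (by simp) fun x hx => sinh_mul_div_ne_zero hB hx).congr
    fun x => ?_
  rw [shQuotient]
  split_ifs
  · rfl
  · rw [div_div_eq_mul_div, mul_comm]

section

variable {A : ℂ} {B : ℝ} {u : ℝ → ℝ} (hA : A ≠ 0) (hB : 0 < B) (hAB : |A.re| < B)
  (hu : ∀ x : ℝ, (u x : ℂ) = Complex.sinh (A * x) / A)

include hu in
theorem shQuotient_neg (x : ℝ) : shQuotient u B (-x) = shQuotient u B x := by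
  have h : u (-x) = -u x := by
    rw [← Complex.ofReal_inj, Complex.ofReal_neg, hu, hu]
    simp [neg_div]
  simp [shQuotient, h]

include hA hu in
theorem hasDerivAt_of_ofReal_eq (x : ℝ) : HasDerivAt u (Complex.cosh (A * x)).re x := by
  have h : HasDerivAt (fun s : ℂ => Complex.sinh (A * s) / A) (Complex.cosh (A * x)) (x : ℂ) := by
    simpa [hA] using (((hasDerivAt_id (x : ℂ)).const_mul A).csinh).div_const A
  refine h.real_of_complex.congr_of_eventuallyEq (.of_forall fun s => ?_)
  rw [← Complex.ofReal_re (u s), hu]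

include hA hB hu in
theorem continuous_shQuotient_of_ofReal_eq : Continuous (shQuotient u B) := by
  refine continuous_shQuotient hB.ne' (continuous_iff_continuousAt.2 fun x =>
    (hasDerivAt_of_ofReal_eq hA hu x).continuousAt) ?_ ?_
  · simpa using hasDerivAt_of_ofReal_eq hA hu 0
  · rw [← Complex.ofReal_inj, hu]
    simp

include hu in
theorem ofReal_shQuotient {x : ℝ} (hx : x ≠ 0) :
    (shQuotient u B x : ℂ) = B / A * (Complex.sinh (A * x) / (Real.sinh (B * x) : ℝ)) := by
  rw [shQuotient, if_neg hx, Complex.ofReal_div, Complex.ofReal_mul, hu]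
  ring

include hA hB hAB hu

theorem integrable_shQuotient : Integrable (shQuotient u B) := by
  obtain ⟨M, ε, hε, h⟩ := exists_norm_sinh_div_sinh_le hB hAB
  refine ((integrable_exp_neg_mul_abs hε).const_mul (‖(B : ℂ) / A‖ * M)).mono'
    (continuous_shQuotient_of_ofReal_eq hA hB hu).aestronglyMeasurable ?_
  have hpos : ∀ x, 0 < x → ‖shQuotient u B x‖ ≤ ‖(B : ℂ) / A‖ * M * Real.exp (-ε * |x|) := by
    intro x hx
    rw [← Complex.norm_real, ofReal_shQuotient hu hx.ne', norm_mul, mul_assoc, abs_of_pos hx]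
    exact mul_le_mul_of_nonneg_left (h x hx) (norm_nonneg _)
  have hae : ∀ᵐ x : ℝ, x ≠ 0 := by simp [ae_iff]
  filter_upwards [hae] with x hx
  rcases lt_or_gt_of_ne hx with hx | hx
  · have h1 := hpos (-x) (neg_pos.2 hx)
    rwa [shQuotient_neg hu, abs_neg] at h1
  · exact hpos x hx

/-- The Fourier transform of `shQuotient`. -/
theorem cosTransform_shQuotient {p q : ℝ} (hp : (p : ℂ) = Real.pi * Complex.sin (Real.pi * A / B) / A)
    (hq : (q : ℂ) = Complex.cos (Real.pi * A / B)) (hq1 : -1 < q) (t : ℝ) :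
    cosTransform (shQuotient u B) t = p / (q + Real.cosh (Real.pi * t / B)) := by
  have hB' : (B : ℂ) ≠ 0 := Complex.ofReal_ne_zero.2 hB.ne'
  have hre1 : (A + t * Complex.I).re = A.re := by simp
  have hre2 : (A - t * Complex.I).re = A.re := by simp
  have h1 : cosTransform (shQuotient u B) t =
      2 * ∫ x in Set.Ioi (0 : ℝ), shQuotient u B x * Real.cos (t * x) := by
    rw [← integral_comp_abs (f := fun x => shQuotient u B x * Real.cos (t * x)), cosTransform]
    congr 1 with x
    rcases abs_choice x with h | h <;> rw [h]
    rw [shQuotient_neg hu, mul_neg, Real.cos_neg]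
  have h2 : ((2 * ∫ x in Set.Ioi (0 : ℝ), shQuotient u B x * Real.cos (t * x) : ℝ) : ℂ) =
      B / A * (Real.pi / (2 * B) * Complex.tan (Real.pi * (A + t * Complex.I) / (2 * B)) +
        Real.pi / (2 * B) * Complex.tan (Real.pi * (A - t * Complex.I) / (2 * B))) := by
    rw [← integral_sinh_div_sinh hB (by rwa [hre1]), ← integral_sinh_div_sinh hB (by rwa [hre2]),
      ← integral_add (integrableOn_sinh_div_sinh hB (by rwa [hre1]))
        (integrableOn_sinh_div_sinh hB (by rwa [hre2])), ← integral_const_mul,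
      ← integral_const_mul, ← integral_complex_ofReal]
    refine setIntegral_congr_fun measurableSet_Ioi fun x (hx : 0 < x) => ?_
    -- The factor `cos (t x)` is absorbed into complex frequencies `A ± i t`, whose real part is
    -- still below `B` in absolute value.
    have h3 : Complex.sinh ((A + t * Complex.I) * x) + Complex.sinh ((A - t * Complex.I) * x) =
        2 * Complex.sinh (A * x) * Complex.cos (t * x) := by
      rw [add_mul, sub_mul, Complex.sinh_add, Complex.sinh_sub,
        show (t * Complex.I * x : ℂ) = t * x * Complex.I by ring, Complex.cosh_mul_I]
      ring
    rw [← add_div, h3, Complex.ofReal_mul, Complex.ofReal_mul, ofReal_shQuotient hu hx.ne',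
      Complex.ofReal_cos, Complex.ofReal_mul, Complex.ofReal_ofNat]
    ring
  set α : ℂ := Real.pi * (A + t * Complex.I) / (2 * B) with hα
  set β : ℂ := Real.pi * (A - t * Complex.I) / (2 * B) with hβ
  have hαβ : α + β = Real.pi * A / B := by rw [hα, hβ]; field_simp; ring
  have hαβ' : α - β = ((Real.pi * t / B : ℝ) : ℂ) * Complex.I := by
    rw [hα, hβ]; push_cast; field_simp; ring
  set D : ℝ := q + Real.cosh (Real.pi * t / B) with hD
  have hDpos : 0 < D := by
    have := Real.one_le_cosh (Real.pi * t / B)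
    linarith
  -- The denominator appears because `tan α + tan β = sin (α + β) / (cos α * cos β)`, with `α + β =
  -- π A / B` and `α - β = i π t / B`.
  have hcos : (D : ℂ) = 2 * (Complex.cos α * Complex.cos β) := by
    rw [hD, Complex.ofReal_add, hq, ← hαβ, Complex.ofReal_cosh, ← Complex.cos_mul_I,
      ← hαβ', Complex.cos_add, Complex.cos_sub]
    ring
  have hD0 : (D : ℂ) ≠ 0 := Complex.ofReal_ne_zero.2 hDpos.ne'
  have hcos0 : Complex.cos α * Complex.cos β ≠ 0 := fun h => hD0 (by rw [hcos, h, mul_zero])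
  have hα0 := left_ne_zero_of_mul hcos0
  have hβ0 := right_ne_zero_of_mul hcos0
  rw [h1, ← Complex.ofReal_inj, h2, Complex.ofReal_div, hp, hcos, ← hαβ, Complex.sin_add,
    Complex.tan, Complex.tan]
  field_simp

/-- The transform `p / (q + cosh (π t / B))` is nonnegative, decays exponentially, and is largest at
`t = 0`. The condition `p ≤ 1 + q` says that this maximum is at most `1`. -/
theorem isContractionKernel_of_shQuotient {p q : ℝ}
    (hp : (p : ℂ) = Real.pi * Complex.sin (Real.pi * A / B) / A)
    (hq : (q : ℂ) = Complex.cos (Real.pi * A / B)) (hq1 : -1 < q) (hp0 : 0 ≤ p) (hpq : p ≤ 1 + q)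
    {K : ℝ → ℝ → ℝ} (hK : ∀ x y, K x y = shQuotient u B (x - y)) : IsContractionKernel K := by
  have hk := integrable_shQuotient hA hB hAB hu
  have hc := continuous_shQuotient_of_ofReal_eq hA hB hu
  have hT := cosTransform_shQuotient hA hB hAB hu hp hq hq1
  have hden : ∀ t : ℝ, 1 + q ≤ q + Real.cosh (Real.pi * t / B) := fun t => by
    have := Real.one_le_cosh (Real.pi * t / B)
    linarith
  have hq2 : 0 < 1 + q := by linarith
  have hint : Integrable (cosTransform (shQuotient u B)) := by
    -- Since `q` may be negative, `m` is chosen so that `m * cosh ≤ q + cosh` in every case.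
    set m := min 1 (1 + q) with hm
    have hmpos : 0 < m := lt_min one_pos hq2
    have hpi : 0 < Real.pi / B := by positivity
    refine ((integrable_exp_neg_mul_abs hpi).const_mul (p * (2 / m))).mono'
      (continuous_cosTransform hk).aestronglyMeasurable (.of_forall fun t => ?_)
    have h1 := hden t
    have h2 : m * Real.cosh (Real.pi * t / B) ≤ q + Real.cosh (Real.pi * t / B) := by
      nlinarith [min_le_left 1 (1 + q), min_le_right 1 (1 + q), Real.one_le_cosh (Real.pi * t / B)]
    have h3 : Real.exp (Real.pi / B * |t|) / 2 ≤ Real.cosh (Real.pi * t / B) := by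
      rw [← Real.cosh_abs, abs_div, abs_mul, abs_of_pos Real.pi_pos, abs_of_pos hB, Real.cosh_eq,
        mul_div_right_comm]
      linarith [Real.exp_pos (-(Real.pi / B * |t|))]
    rw [hT, Real.norm_of_nonneg (div_nonneg hp0 (hq2.le.trans h1)), mul_assoc]
    rw [div_eq_mul_inv]
    refine mul_le_mul_of_nonneg_left ?_ hp0
    rw [neg_mul, Real.exp_neg, ← inv_div m 2, ← mul_inv]
    refine inv_anti₀ (by positivity) ?_
    calc m / 2 * Real.exp (Real.pi / B * |t|) = m * (Real.exp (Real.pi / B * |t|) / 2) := by ring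
      _ ≤ m * Real.cosh (Real.pi * t / B) := mul_le_mul_of_nonneg_left h3 hmpos.le
      _ ≤ _ := h2
  refine isContractionKernel_of_cosTransform (φ := fun t =>
    cosTransform (shQuotient u B) t / (2 * Real.pi)) (hint.div_const _) (fun t => ?_)
    (fun t => ?_) (fun x y => ?_) fun x => ?_
  · rw [hT]
    exact div_nonneg (div_nonneg hp0 (hq2.le.trans (hden t))) (by positivity)
  · rw [hT]
    gcongr
    rw [div_le_one (hq2.trans_le (hden t))]
    exact hpq.trans (hden t)
  · rw [hK, cosTransform_cosTransform_div hc hk (shQuotient_neg hu) hint]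
  · rw [hK, sub_self, shQuotient, if_pos rfl]

end

/-! ### The four kernels. -/

theorem sinShKernel_abs (A B : ℝ) : sinShKernel |A| B = sinShKernel A B := by
  rcases abs_choice A with h | h <;> rw [h]
  ext x y
  simp [sinShKernel, neg_div_neg_eq]

theorem shShKernel_abs (A B : ℝ) : shShKernel |A| B = shShKernel A B := by
  rcases abs_choice A with h | h <;> rw [h]
  ext x y
  simp [shShKernel, neg_div_neg_eq]

/-- The imaginary parameter `A i` gives `p = π sinh (2 s) / A` and `q = cosh (2 s)`, hence `p / (1 +
q) = (π / A) tanh s`. -/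
theorem isContractionKernel_sinShKernel {A B : ℝ} (hA : 0 < A) (hB : 0 < B)
    (h : Real.tanh (Real.pi * A / (2 * B)) ≤ A / Real.pi) :
    IsContractionKernel (sinShKernel A B) := by
  set s := Real.pi * A / (2 * B) with hs
  have hspos : 0 < s := by positivity
  have h2s : (Real.pi : ℂ) * (A * Complex.I) / B = ((2 * s : ℝ) : ℂ) * Complex.I := by
    rw [hs]; push_cast; ring
  have hA' : (A : ℂ) ≠ 0 := Complex.ofReal_ne_zero.2 hA.ne'
  refine isContractionKernel_of_shQuotient (A := A * Complex.I) (B := B)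
    (u := fun x => Real.sin (A * x) / A) (p := Real.pi * Real.sinh (2 * s) / A)
    (q := Real.cosh (2 * s)) (mul_ne_zero hA' Complex.I_ne_zero) hB (by simpa using hB)
    (fun x => ?_) ?_ ?_ ?_ ?_ ?_ fun x y => ?_
  · rw [show (A * Complex.I * x : ℂ) = ((A * x : ℝ) : ℂ) * Complex.I by push_cast; ring,
      Complex.sinh_mul_I, mul_div_mul_right _ _ Complex.I_ne_zero]
    push_cast
    rfl
  · rw [h2s, Complex.sin_mul_I, ← mul_assoc, mul_div_mul_right _ _ Complex.I_ne_zero]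
    push_cast
    rfl
  · rw [h2s, Complex.cos_mul_I, Complex.ofReal_cosh]
  · linarith [Real.cosh_pos (2 * s)]
  · have := Real.sinh_nonneg_iff.2 (by positivity : 0 ≤ 2 * s)
    positivity
  · rw [Real.tanh_eq_sinh_div_cosh, div_le_div_iff₀ (Real.cosh_pos s) Real.pi_pos] at h
    rw [div_le_iff₀ hA, Real.sinh_two_mul, Real.cosh_two_mul, Real.sinh_sq]
    nlinarith [mul_le_mul_of_nonneg_right h (Real.cosh_pos s).le]
  · simp only [sinShKernel, shQuotient, sub_eq_zero]
    congr 1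
    rw [mul_div_assoc', div_div]

/-- Here `p / (1 + q) = (π / A) tan s`. The inequality `A < B` puts `s` below `π / 2`, so that `cos
s > 0` and `q > -1`. -/
theorem isContractionKernel_shShKernel {A B : ℝ} (hA : 0 < A) (hB : 0 < B) (hAB : A < B)
    (h : Real.tan (Real.pi * A / (2 * B)) ≤ A / Real.pi) :
    IsContractionKernel (shShKernel A B) := by
  set s := Real.pi * A / (2 * B) with hs
  have hspos : 0 < s := by positivity
  have hs2 : s < Real.pi / 2 := by
    rw [hs, div_lt_div_iff₀ (by positivity) two_pos]
    nlinarith [mul_lt_mul_of_pos_left hAB Real.pi_pos]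
  have hcos : 0 < Real.cos s := Real.cos_pos_of_mem_Ioo ⟨by linarith, hs2⟩
  have h2s : (Real.pi : ℂ) * A / B = ((2 * s : ℝ) : ℂ) := by
    rw [hs]; push_cast; ring
  have hA' : (A : ℂ) ≠ 0 := Complex.ofReal_ne_zero.2 hA.ne'
  have hcos2 : 1 + Real.cos (2 * s) = 2 * Real.cos s ^ 2 := by rw [Real.cos_two_mul]; ring
  refine isContractionKernel_of_shQuotient (A := A) (B := B)
    (u := fun x => Real.sinh (A * x) / A) (p := Real.pi * Real.sin (2 * s) / A)
    (q := Real.cos (2 * s)) hA' hB (by simpa [abs_of_pos hA] using hAB)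
    (fun x => ?_) ?_ ?_ ?_ ?_ ?_ fun x y => ?_
  · push_cast
    rfl
  · rw [h2s]
    push_cast
    rfl
  · rw [h2s, Complex.ofReal_cos]
  · nlinarith [sq_pos_of_pos hcos]
  · have := Real.sin_nonneg_of_nonneg_of_le_pi (x := 2 * s) (by positivity) (by linarith)
    positivity
  · rw [Real.tan_eq_sin_div_cos, div_le_div_iff₀ hcos Real.pi_pos] at h
    rw [div_le_iff₀ hA, hcos2, Real.sin_two_mul]
    nlinarith [mul_le_mul_of_nonneg_right h hcos.le]
  · simp only [shShKernel, shQuotient, sub_eq_zero]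
    congr 1
    rw [mul_div_assoc', div_div]

theorem tendsto_one_div_nat_nhdsNE :
    Filter.Tendsto (fun n : ℕ => 1 / ((n : ℝ) + 1)) Filter.atTop (nhdsWithin 0 {0}ᶜ) :=
  tendsto_nhdsWithin_iff.2 ⟨tendsto_one_div_add_atTop_nhds_zero_nat,
    .of_forall fun n => (by positivity : (1 / ((n : ℝ) + 1)) ≠ 0)⟩

theorem tendsto_div_of_hasDerivAt {f : ℝ → ℝ} {f' : ℝ} (hf : HasDerivAt f f' 0) (h0 : f 0 = 0) :
    Filter.Tendsto (fun n : ℕ => f (1 / ((n : ℝ) + 1)) / (1 / ((n : ℝ) + 1))) Filter.atTop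
      (nhds f') := by
  refine (hf.tendsto_slope_zero.comp tendsto_one_div_nat_nhdsNE).congr fun n => ?_
  simp [h0, div_eq_inv_mul]

theorem tendsto_sinh_mul_div (s : ℝ) : Filter.Tendsto
    (fun n : ℕ => Real.sinh (1 / ((n : ℝ) + 1) * s) / (1 / ((n : ℝ) + 1))) Filter.atTop (nhds s) :=
  tendsto_div_of_hasDerivAt (f := fun t => Real.sinh (t * s))
    (by simpa using ((hasDerivAt_id (0 : ℝ)).mul_const s).sinh) (by simp)

/-- The limit of sin/sh kernels as `B → 0`. Their condition holds for every `B` because `tanh < 1 ≤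
A / π`. -/
theorem isContractionKernel_sineKernel {A : ℝ} (hA : Real.pi ≤ A) :
    IsContractionKernel (sineKernel A) := by
  have hApos : 0 < A := Real.pi_pos.trans_le hA
  refine IsContractionKernel.of_tendsto (L := fun n => sinShKernel A (1 / ((n : ℝ) + 1)))
    (.of_forall fun n => isContractionKernel_sinShKernel hApos (by positivity) ?_) ?_ fun x y => ?_
  · exact (Real.tanh_lt_one _).le.trans ((one_le_div Real.pi_pos).2 hA)
  · have h := continuous_ite_div (u := fun x => Real.sin (A * x) / A) (v := fun x => x)
      (by fun_prop) continuous_id ?_ (hasDerivAt_id 0) (by simp) rfl fun x hx => hx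
    · refine (h.comp (by fun_prop : Continuous fun p : ℝ × ℝ => p.1 - p.2)).congr fun p => ?_
      simp only [Function.comp_apply, Function.uncurry, sineKernel, sub_eq_zero, div_div]
    · simpa [hApos.ne'] using (((hasDerivAt_id (0 : ℝ)).const_mul A).sin).div_const A
  · simp only [sinShKernel, sineKernel]
    split_ifs with h
    · exact tendsto_const_nhds
    · have hxy := sub_ne_zero.2 h
      refine (((tendsto_sinh_mul_div (x - y)).inv₀ hxy).const_mul
        (Real.sin (A * (x - y)) / A)).congr' (.of_forall fun n => ?_) |>.trans_eq ?_
      · rw [inv_div]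
        ring
      · rw [← div_eq_mul_inv, div_div]

theorem continuous_linShKernel {B : ℝ} (hB : B ≠ 0) :
    Continuous (Function.uncurry (linShKernel B)) := by
  have h := continuous_shQuotient hB continuous_id (hasDerivAt_id 0) rfl
  refine (h.comp (by fun_prop : Continuous fun p : ℝ × ℝ => p.1 - p.2)).congr fun p => ?_
  simp only [Function.comp_apply, Function.uncurry, linShKernel, shQuotient, sub_eq_zero, id]

/-- The limit of sh/sh kernels as `A → 0`. The ratio `tan (π A / (2 B)) / A` tends to `π / (2 B)`,
and the strict inequality on `B` puts this below `1 / π`, so the condition holds eventually. -/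
theorem isContractionKernel_linShKernel_of_lt {B : ℝ} (hB : Real.pi ^ 2 / 2 < B) :
    IsContractionKernel (linShKernel B) := by
  have hBpos : 0 < B := lt_trans (by positivity) hB
  refine IsContractionKernel.of_tendsto (L := fun n => shShKernel (1 / ((n : ℝ) + 1)) B) ?_
    (continuous_linShKernel hBpos.ne') fun x y => ?_
  · have h1 : ∀ᶠ n : ℕ in Filter.atTop, 1 / ((n : ℝ) + 1) < B :=
      tendsto_one_div_add_atTop_nhds_zero_nat.eventually_lt_const hBpos
    have h2 := tendsto_div_of_hasDerivAt (f := fun t => Real.tan (Real.pi * t / (2 * B)))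
      (f' := Real.pi / (2 * B)) ?_ (by simp)
    · have h3 : Real.pi / (2 * B) < 1 / Real.pi := by
        rw [div_lt_div_iff₀ (by positivity) Real.pi_pos]
        nlinarith
      filter_upwards [h1, h2.eventually_lt_const h3] with n hn1 hn2
      have hn : (0 : ℝ) < 1 / ((n : ℝ) + 1) := by positivity
      refine isContractionKernel_shShKernel hn hBpos hn1 ?_
      rw [div_lt_iff₀ hn] at hn2
      refine hn2.le.trans_eq ?_
      ring
    · have h4 : HasDerivAt (fun t : ℝ => Real.pi * t / (2 * B)) (Real.pi / (2 * B)) 0 := by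
        simpa using ((hasDerivAt_id (0 : ℝ)).const_mul Real.pi).div_const (2 * B)
      have h5 : HasDerivAt Real.tan 1 (Real.pi * 0 / (2 * B)) := by
        simpa using Real.hasDerivAt_tan (x := 0) (by simp)
      have h6 := h5.comp (0 : ℝ) h4
      rw [one_mul] at h6
      exact h6
  · simp only [shShKernel, linShKernel]
    split_ifs with h
    · exact tendsto_const_nhds
    · refine ((tendsto_sinh_mul_div (x - y)).const_mul
        (B / Real.sinh (B * (x - y)))).congr' (.of_forall fun n => ?_) |>.trans_eq ?_
      · rw [div_mul_div_comm, mul_comm (Real.sinh (B * (x - y)))]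
      · ring_nf

/-- At the boundary value no small `A > 0` satisfies the sh/sh condition, because `tan s > s`. The
boundary is therefore reached by letting `B` decrease to it. -/
theorem isContractionKernel_linShKernel {B : ℝ} (hB : Real.pi ^ 2 / 2 ≤ B) :
    IsContractionKernel (linShKernel B) := by
  have hBpos : 0 < B := lt_of_lt_of_le (by positivity) hB
  have hlim : Filter.Tendsto (fun n : ℕ => B + 1 / ((n : ℝ) + 1)) Filter.atTop (nhds B) := by
    simpa using tendsto_one_div_add_atTop_nhds_zero_nat.const_add B
  refine IsContractionKernel.of_tendsto (L := fun n => linShKernel (B + 1 / ((n : ℝ) + 1)))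
    (.of_forall fun n => isContractionKernel_linShKernel_of_lt ?_)
    (continuous_linShKernel hBpos.ne') fun x y => ?_
  · have : (0 : ℝ) < 1 / ((n : ℝ) + 1) := by positivity
    linarith
  · simp only [linShKernel]
    split_ifs with h
    · exact tendsto_const_nhds
    · have hc : ContinuousAt (fun b : ℝ => b * (x - y) / Real.sinh (b * (x - y))) B :=
        ContinuousAt.div (by fun_prop) (by fun_prop)
          (Real.sinh_ne_zero.2 (mul_ne_zero hBpos.ne' (sub_ne_zero.2 h)))
      exact hc.tendsto.comp hlim

theorem proposition4p2 :
    (∀ A B : ℝ, A ≠ 0 → 0 < B →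
      Real.tanh (Real.pi * |A| / (2 * B)) ≤ |A| / Real.pi →
        GeneratesFermionProcess (sinShKernel A B)) ∧
    (∀ A B : ℝ, A ≠ 0 → 0 < B →
      0 ≤ Real.tan (Real.pi * |A| / (2 * B)) →
      Real.tan (Real.pi * |A| / (2 * B)) ≤ |A| / Real.pi →
      |A| / B < 1 →
        GeneratesFermionProcess (shShKernel A B)) ∧
    (∀ A : ℝ, Real.pi ≤ A → GeneratesFermionProcess (sineKernel A)) ∧
    (∀ B : ℝ, Real.pi ^ 2 / 2 ≤ B → GeneratesFermionProcess (linShKernel B)) := by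
  refine ⟨fun A B hA hB h => ?_, fun A B hA hB _ h hAB => ?_, fun A hA => ?_, fun B hB => ?_⟩
  · rw [← sinShKernel_abs]
    exact (isContractionKernel_sinShKernel (abs_pos.2 hA) hB h).generates
  · rw [← shShKernel_abs]
    exact (isContractionKernel_shShKernel (abs_pos.2 hA) hB
      ((div_lt_one hB).1 hAB) h).generates
  · exact (isContractionKernel_sineKernel hA).generates
  · exact (isContractionKernel_linShKernel hB).generates
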